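/- Let $m\ge 1$ be an integer, $N,M\ge 1$, let $v\in L^\infty(\mathbb R^3;\mathbb R)$ and $w\in\mathcal S(\mathbb R^3;\mathbb R)$ be even, and put $\underline w(x,\mathbf X)=\sum_{\ell=1}^m w(x-X^{(\ell)})$ for $\mathbf X=(X^{(1)},\dots,X^{(m)})\in\mathbb R^{3m}$. Let $(\mathbf X_t,\varphi_t)_{t\in\mathbb R}$, with $\varphi\in C^1(\mathbb R,L^2(\mathbb R^3))\cap C(\mathbb R,H^2(\mathbb R^3))$, be a global strong solution of the mean-field equations $$\ddot{\mathbf X}_t=-\int\nabla_{\mathbf X}\underline w(x,\mathbf X_t)|\varphi_t(x)|^2\,dx,\qquad i\partial_t\varphi_t=-\Delta\varphi_t+\underline w(x,\mathbf X_t)\varphi_t+(v*|\varphi_t|^2)\varphi_t,$$ with initial data $(\mathbf X_0,\mathbf V_0,\varphi_0)\in\mathbb R^{6m}\times H^2(\mathbb R^3)$. Let $\mathcal H=L^2(\mathbb R^{3m})\otimes\mathcal F_b$, where $\mathcal F_b=\bigoplus_{n\ge0}L^2(\mathbb R^3)^{\otimes_{\rm sym}n}$ is the bosonic Fock space with annihilation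 and creation operators $a_x,a_x^*$, kinetic energy $T_b=\int a_x^*(-\Delta_x)a_x\,dx$ and number operator $N_b$. Consider on $\mathcal H$ the self-adjoint operator $$\mathbb H=-\tfrac1{2N}\Delta_{\mathbf X}+T_b+\tfrac1{2N}\iint v(x-y)\,a_x^*a_y^*a_xa_y\,dx\,dy$$ and the truncated generator $\mathcal L_M(t)=\mathbb H+\chi(N_b\le M)\,\mathcal I(t)$, where $$\begin{aligned}\mathcal I(t)={}&\int(\underline w(x,\mathbf X)-\underline w(x,\mathbf X_t))\,(N|\varphi_t(x)|^2-a_x^*a_x)\,dx+\int(v*|\varphi_t|^2)(x)\,a_x^*a_x\,dx+\iint v(x-y)\,\overline{\varphi_t}(x)\varphi_t(y)\,a_y^*a_x\,dx\,dy\\&+\sqrt N\int(\underline w(x,\mathbf X)-\underline w(x,\mathbf X_t))\,(\overline{\varphi_t}(x)a_x+\varphi_t(x)a_x^*)\,dx+\tfrac12\iint v(x-y)\,\big(\varphi_t(x)\varphi_t(y)a_x^*a_y^*+\overline{\varphi_t}(x)\overline{\varphi_t}(y)a_xa_y\big)\,dx\,dy\\&+\tfrac1{\sqrt N}\iint v(x-y)\,a_x^*\big(\varphi_t(y)a_y^*+\overline{\varphi_t}(y)a_y\big)a_x\,dx\,dy.\end{aligned}$$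 Let $(U(t,s))_{t,s\in\mathbb R}$ be the propagator generated by $\mathcal L_M(t)$, that is, a strongly continuous family of bounded operators on $\mathcal H$ with $U(t,s)=U(t,r)U(r,s)$ and $U(t,t)=1$ such that for all $\Psi_0\in\mathcal D(\mathbb H)$ and $s\in\mathbb R$ the map $\Psi(t)=U(t,s)\Psi_0$ lies in $C^1(\mathbb R,\mathcal H)\cap C(\mathbb R,\mathcal D(\mathbb H))$ (graph norm on $\mathcal D(\mathbb H)$) and satisfies $i\partial_t\Psi(t)=\mathcal L_M(t)\Psi(t)$. With $\mathbf P=-i\nabla_{\mathbf X}$, let $$\mathscr D_\infty=\bigcap_{k=1}^\infty\mathcal D(|\mathbf X|^k)\cap\mathcal D(|\mathbf P|^k)\cap\mathcal D(N_b^k).$$ If $\Psi_0\in\mathscr D_\infty$, then $U(t,s)\Psi_0\in\mathscr D_\infty$ for all $t,s\in\mathbb R$. -/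

import Mathlib

open MeasureTheory FourierTransform
open scoped ComplexConjugate SchwartzMap ENNReal

noncomputable section

namespace TracerBoson

/-! ### Configurations and the Hilbert space -/

/-- Physical space `ℝ³`. -/
abbrev R3 : Type := EuclideanSpace ℝ (Fin 3)

/-- Positions `𝐗 = (X⁽¹⁾, …, X⁽ᵐ⁾) ∈ ℝ^{3m}` of the tracer particles, with the Euclidean norm. -/
abbrev Tracers (m : ℕ) : Type := EuclideanSpace ℝ (Fin m × Fin 3)

/-- Joint configurations `(𝐗, x₁, …, xₙ) ∈ ℝ^{3m} × ℝ^{3n}` of the `m` tracer particles and `n`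
bosons, with the Euclidean norm and Lebesgue measure. -/
abbrev Config (m n : ℕ) : Type := EuclideanSpace ℝ ((Fin m ⊕ Fin n) × Fin 3)

variable {m n : ℕ}

/-- The position `X⁽ˡ⁾ ∈ ℝ³` of one tracer particle. -/
def tracer (X : Tracers m) (l : Fin m) : R3 := WithLp.toLp 2 fun k => X (l, k)

/-- The tracer part `𝐗` of a configuration (or of a frequency vector). -/
def tracers (z : Config m n) : Tracers m := WithLp.toLp 2 fun p => z (Sum.inl p.1, p.2)

/-- The boson part `(x₁, …, xₙ)` of a configuration (or of a frequency vector). -/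
def bosons (z : Config m n) : Fin n → R3 := fun i => WithLp.toLp 2 fun k => z (Sum.inr i, k)

/-- The configuration with given tracer and boson positions. -/
def config (X : Tracers m) (x : Fin n → R3) : Config m n :=
  WithLp.toLp 2 fun p => Sum.elim (fun l => X (l, p.2)) (fun i => x i p.2) p.1

/-- Relabelling of the bosons, as an isometry of the configuration space. -/
def permute (σ : Equiv.Perm (Fin n)) : Config m n ≃ₗᵢ[ℝ] Config m n :=
  LinearIsometryEquiv.piLpCongrLeft 2 ℝ ℝ
    (Equiv.prodCongr (Equiv.sumCongr (Equiv.refl (Fin m)) σ) (Equiv.refl (Fin 3)))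

/-- `L²(ℝ^{3m} × ℝ^{3n})`. -/
abbrev Sector (m n : ℕ) : Type := Lp ℂ 2 (volume : Measure (Config m n))

/-- `L²(ℝ³)`. -/
abbrev L2R3 : Type := Lp ℂ 2 (volume : Measure R3)

/-- Relabelling of the bosons, as an isometry of `L²(ℝ^{3m} × ℝ^{3n})`. -/
def permuteL2 (σ : Equiv.Perm (Fin n)) : Sector m n →ₗᵢ[ℂ] Sector m n :=
  Lp.compMeasurePreservingₗᵢ ℂ (permute σ) (permute σ).measurePreserving

/-- The elements of the Hilbert sum `⨁ₙ L²(ℝ^{3m} × ℝ^{3n})` that are symmetric in the boson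
variables. -/
def bosonic (m : ℕ) : Submodule ℂ (lp (fun n => Sector m n) 2) where
  carrier := {Ψ | ∀ n (σ : Equiv.Perm (Fin n)), permuteL2 σ (Ψ n) = Ψ n}
  zero_mem' := fun n σ => by simp
  add_mem' := fun {a b} ha hb n σ => by
    simp only [lp.coeFn_add, Pi.add_apply, map_add, ha n σ, hb n σ]
  smul_mem' := fun c a ha n σ => by
    simp only [lp.coeFn_smul, Pi.smul_apply, map_smul, ha n σ]

/-- The Hilbert space `L²(ℝ^{3m}) ⊗ 𝓕_b` of `m` tracer particles and a boson field, realized as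
`⨁ₙ L²(ℝ^{3m}) ⊗ L²(ℝ³)^{⊗_sym n} = ⨁ₙ L²_sym(ℝ^{3m} × ℝ^{3n})`. -/
abbrev Hilb (m : ℕ) : Type := bosonic m

/-- The `n`-boson component of a vector. -/
def comp (Ψ : Hilb m) (n : ℕ) : Sector m n := (Ψ : lp (fun n => Sector m n) 2) n

/-! ### Calculus of the operator-valued distributions `a_x`, `a_x^*` -/

/-- Sequences of functions `F⁽ⁿ⁾(𝐗, x₁, …, xₙ)`. -/
abbrev FockFun (m : ℕ) : Type := (n : ℕ) → Tracers m → (Fin n → R3) → ℂ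

/-- The components of a vector as functions. -/
def toFock (Ψ : Hilb m) : FockFun m := fun n X x => comp Ψ n (config X x)

/-- `F` represents the vector `Φ`: the components agree almost everywhere. -/
def Represents (F : FockFun m) (Φ : Hilb m) : Prop :=
  ∀ n, ∀ᵐ z : Config m n, comp Φ n z = F n (tracers z) (bosons z)

/-- `(a_x F)⁽ⁿ⁾(𝐗, x₁, …, xₙ) = √(n+1) F⁽ⁿ⁺¹⁾(𝐗, x, x₁, …, xₙ)`. -/
def ann (x : R3) (F : FockFun m) : FockFun m :=
  fun n X xs => (Real.sqrt (n + 1) : ℂ) * F (n + 1) X (Fin.cons x xs)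

/-- `∫ G(x) dx` for a family `G(x)` of sequences of functions. -/
def integ (G : R3 → FockFun m) : FockFun m := fun n X xs => ∫ x, G x n X xs

/-- `∫ a_x^* G(x) dx` for a family `G(x)` of sequences of functions. As
`(a_x^* F)⁽ⁿ⁾ = n^{-1/2} ∑ᵢ δ(x - xᵢ) F⁽ⁿ⁻¹⁾(𝐗, x₁, …, x̂ᵢ, …, xₙ)`, its `n`-th component is
`n^{-1/2} ∑ᵢ G(xᵢ)⁽ⁿ⁻¹⁾(𝐗, x₁, …, x̂ᵢ, …, xₙ)`. -/
def creInteg (G : R3 → FockFun m) : FockFun m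
  | 0 => fun _ _ => 0
  | n + 1 => fun X xs =>
      ((Real.sqrt (n + 1) : ℝ) : ℂ)⁻¹ * ∑ i : Fin (n + 1), G (xs i) n X (i.removeNth xs)

/-- Multiplication by a function of the tracer positions. -/
def mulX (c : Tracers m → ℂ) (F : FockFun m) : FockFun m := fun n X xs => c X * F n X xs

/-- The spectral cut-off `χ(N_b ≤ M)`. -/
def cutoff (M : ℝ) (F : FockFun m) : FockFun m :=
  fun n X xs => if (n : ℝ) ≤ M then F n X xs else 0

/-! ### The interaction terms -/

/-- `w̲(x, 𝐗) = ∑_ℓ w(x - X⁽ˡ⁾)`. -/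
def wTot (w : R3 → ℝ) (x : R3) (X : Tracers m) : ℝ := ∑ l, w (x - tracer X l)

/-- `(v * |φ|²)(x)`. -/
def hartree (v : R3 → ℝ) (φ : R3 → ℂ) (x : R3) : ℝ := ∫ y, v (x - y) * ‖φ y‖ ^ 2

/-- `w̲(x, 𝐗) - w̲(x, 𝐘)`, as a complex-valued function of `𝐗`. -/
def dW (w : R3 → ℝ) (Y : Tracers m) (x : R3) (X : Tracers m) : ℂ :=
  ((wTot w x X - wTot w x Y : ℝ) : ℂ)

/-- The diagonal interaction
`∫ (w̲(x,𝐗) - w̲(x,𝐘)) (N|φ(x)|² - a_x^* a_x) dx + ∫ (v*|φ|²)(x) a_x^* a_x dx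
  + ∬ v(x-y) φ̄(x) φ(y) a_y^* a_x dx dy`. -/
def diagInt (N : ℝ) (v w : R3 → ℝ) (Y : Tracers m) (φ : R3 → ℂ) (F : FockFun m) : FockFun m :=
  mulX (fun X => ∫ x, dW w Y x X * ((N * ‖φ x‖ ^ 2 : ℝ) : ℂ)) F
    - creInteg (fun x => mulX (dW w Y x) (ann x F))
    + creInteg (fun x => (hartree v φ x : ℂ) • ann x F)
    + creInteg (fun y => integ fun x => ((v (x - y) : ℂ) * conj (φ x) * φ y) • ann x F)

/-- The off-diagonal interaction
`√N ∫ (w̲(x,𝐗) - w̲(x,𝐘)) (φ̄(x) a_x + φ(x) a_x^*) dx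
  + ½ ∬ v(x-y) (φ(x) φ(y) a_x^* a_y^* + φ̄(x) φ̄(y) a_x a_y) dx dy
  + N^{-1/2} ∬ v(x-y) a_x^* (φ(y) a_y^* + φ̄(y) a_y) a_x dx dy`. -/
def offDiagInt (N : ℝ) (v w : R3 → ℝ) (Y : Tracers m) (φ : R3 → ℂ) (F : FockFun m) :
    FockFun m :=
  (Real.sqrt N : ℂ) •
      (integ (fun x => mulX (dW w Y x) (conj (φ x) • ann x F))
        + creInteg (fun x => mulX (dW w Y x) (φ x • F)))
    + (1 / 2 : ℂ) •
      (creInteg (fun x => creInteg fun y => ((v (x - y) : ℂ) * φ x * φ y) • F)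
        + integ (fun x => integ fun y =>
            ((v (x - y) : ℂ) * conj (φ x) * conj (φ y)) • ann x (ann y F)))
    + (1 / (Real.sqrt N : ℂ)) •
      (creInteg (fun x => creInteg fun y => ((v (x - y) : ℂ) * φ y) • ann x F)
        + creInteg (fun x => integ fun y =>
            ((v (x - y) : ℂ) * conj (φ y)) • ann y (ann x F)))

/-- The truncated interaction `χ(N_b ≤ M) (diagonal + off-diagonal)`. -/
def truncInt (N M : ℝ) (v w : R3 → ℝ) (Y : Tracers m) (φ : R3 → ℂ) (F : FockFun m) : FockFun m :=
  cutoff M (diagInt N v w Y φ F + offDiagInt N v w Y φ F)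

/-- The quartic term `(1/2N) ∬ v(x-y) a_x^* a_y^* a_x a_y dx dy`. -/
def quarticInt (N : ℝ) (v : R3 → ℝ) (F : FockFun m) : FockFun m :=
  (1 / (2 * N : ℂ)) • creInteg (fun x => creInteg fun y => (v (x - y) : ℂ) • ann x (ann y F))

/-! ### Unbounded operators -/

/-- `g ∈ L²` is the image of `f ∈ L²` under the Fourier multiplier with symbol `s`. The Fourier
transform is `∫ e^{-2πi⟨x,ξ⟩} f(x) dx`, so `-i∇` has symbol `2πξ` and `-Δ` has symbol
`(2π‖ξ‖)²`. -/
def FourierMul {E : Type*} [NormedAddCommGroup E] [InnerProductSpace ℝ E] [FiniteDimensional ℝ E]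
    [MeasurableSpace E] [BorelSpace E] (s : E → ℝ) (f g : Lp ℂ 2 (volume : Measure E)) : Prop :=
  ∀ᵐ ξ : E, (𝓕 g : Lp ℂ 2 (volume : Measure E)) ξ =
    (s ξ : ℂ) * (𝓕 f : Lp ℂ 2 (volume : Measure E)) ξ

/-- The symbol of `-Δ_𝐗/(2N) - ∑ᵢ Δ_{xᵢ}`. -/
def kineticSymbol (N : ℝ) (ξ : Config m n) : ℝ :=
  (2 * Real.pi * ‖tracers ξ‖) ^ 2 / (2 * N) + ∑ i, (2 * Real.pi * ‖bosons ξ i‖) ^ 2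

/-- The graph of the self-adjoint operator `ℍ = -Δ_𝐗/(2N) + T_b + (quartic term)`, which is the
direct sum of its `n`-boson parts: `Ψ ∈ 𝒟(ℍ)` and `ℍ Ψ = Θ`. -/
def HamGraph (N : ℝ) (v : R3 → ℝ) (Ψ Θ : Hilb m) : Prop :=
  ∀ n, ∃ κ : Sector m n, FourierMul (kineticSymbol N) (comp Ψ n) κ ∧
    ∀ᵐ z : Config m n, comp Θ n z =
      κ z + quarticInt N v (toFock Ψ) n (tracers z) (bosons z)

/-- The domain `𝒟(ℍ)`. -/
def HamDomain (N : ℝ) (v : R3 → ℝ) : Set (Hilb m) := {Ψ | ∃ Θ, HamGraph N v Ψ Θ}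

/-- The domain of `|𝐗|^k`. -/
def DomXPow (m k : ℕ) : Set (Hilb m) :=
  {Ψ | ∃ Φ : Hilb m, ∀ n, ∀ᵐ z : Config m n,
    comp Φ n z = ((‖tracers z‖ ^ k : ℝ) : ℂ) * comp Ψ n z}

/-- The domain of `|𝐏|^k`, where `𝐏 = -i∇_𝐗`. -/
def DomPPow (m k : ℕ) : Set (Hilb m) :=
  {Ψ | ∃ Φ : Hilb m, ∀ n,
    FourierMul (fun ξ : Config m n => (2 * Real.pi * ‖tracers ξ‖) ^ k) (comp Ψ n) (comp Φ n)}

/-- The domain of `N_b^k`. -/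
def DomNPow (m k : ℕ) : Set (Hilb m) :=
  {Ψ | ∃ Φ : Hilb m, ∀ n, comp Φ n = ((n : ℂ) ^ k) • comp Ψ n}

/-- The space `𝒟_∞ = ⋂_{k ≥ 1} 𝒟(|𝐗|^k) ∩ 𝒟(|𝐏|^k) ∩ 𝒟(N_b^k)`. -/
def DInfty (m : ℕ) : Set (Hilb m) :=
  ⋂ (k : ℕ) (_ : 1 ≤ k), DomXPow m k ∩ DomPPow m k ∩ DomNPow m k

/-! ### The mean-field equations and the truncated dynamics -/

/-- The mean-field force `-∫ ∇_𝐗 w̲(x, 𝐗) |φ(x)|² dx`. -/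
def force (w : R3 → ℝ) (φ : R3 → ℂ) (X : Tracers m) : Tracers m :=
  -∫ x : R3, (‖φ x‖ ^ 2) • gradient (wTot w x) X

/-- `(𝐗_t, φ_t)` is a global strong solution of the mean-field equations
`𝐗'' = -∫ ∇_𝐗 w̲(x, 𝐗_t) |φ_t(x)|² dx`,
`i ∂_t φ_t = -Δφ_t + w̲(x, 𝐗_t) φ_t + (v * |φ_t|²) φ_t`
with initial data `(𝐗₀, 𝐕₀, φ₀)` and with `φ ∈ C¹(ℝ, L²) ∩ C(ℝ, H²)`. -/
def IsMeanFieldSolution (v w : R3 → ℝ) (X₀ V₀ : Tracers m) (φ₀ : L2R3)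
    (X : ℝ → Tracers m) (φ : ℝ → L2R3) : Prop :=
  (∃ V : ℝ → Tracers m,
    (∀ t, HasDerivAt X (V t) t) ∧
    (∀ t, HasDerivAt V (force w (φ t) (X t)) t) ∧
    X 0 = X₀ ∧ V 0 = V₀) ∧
  (∃ dφ lapφ : ℝ → L2R3,
    Continuous dφ ∧ (∀ t, HasDerivAt φ (dφ t) t) ∧
    Continuous lapφ ∧ (∀ t, FourierMul (fun ξ => (2 * Real.pi * ‖ξ‖) ^ 2) (φ t) (lapφ t)) ∧
    (∀ t, ∀ᵐ x, Complex.I * dφ t x =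
      lapφ t x + (wTot w x (X t) : ℂ) * φ t x + (hartree v (φ t) x : ℂ) * φ t x) ∧
    φ 0 = φ₀)

/-- `U(t,s)` is a propagator (a strongly continuous two-parameter family of bounded operators with
`U(t,s) = U(t,r) U(r,s)` and `U(t,t) = 1`) such that for all `Ψ₀ ∈ 𝒟(ℍ)` and `s ∈ ℝ` the map
`Ψ(t) = U(t,s) Ψ₀` lies in `C¹(ℝ, ℋ) ∩ C(ℝ, 𝒟(ℍ))`, where `𝒟(ℍ)` has the graph norm, and solves
`i ∂_t Ψ(t) = ℍ Ψ(t) + χ(N_b ≤ M) 𝓘(t) Ψ(t)`. -/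
structure IsTruncatedPropagator (N M : ℝ) (v w : R3 → ℝ) (X : ℝ → Tracers m)
    (φ : ℝ → L2R3) (U : ℝ → ℝ → Hilb m →L[ℂ] Hilb m) : Prop where
  continuous_apply : ∀ Ψ : Hilb m, Continuous fun p : ℝ × ℝ => U p.1 p.2 Ψ
  comp_eq : ∀ t r s, U t s = (U t r).comp (U r s)
  self_eq : ∀ t, U t t = ContinuousLinearMap.id ℂ (Hilb m)
  solves : ∀ Ψ₀ ∈ HamDomain (m := m) N v, ∀ s : ℝ, ∃ dΨ Θ : ℝ → Hilb m,
    Continuous dΨ ∧ (∀ t, HasDerivAt (fun t => U t s Ψ₀) (dΨ t) t) ∧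
    Continuous Θ ∧ (∀ t, HamGraph N v (U t s Ψ₀) (Θ t)) ∧
    ∀ t, Represents (truncInt N M v w (X t) (φ t) (toFock (U t s Ψ₀)))
      (Complex.I • dΨ t - Θ t)

end TracerBoson

end

set_option linter.unusedSectionVars false

noncomputable section

namespace TracerBoson

open Filter Topology

/-! ### Multiplication operators on `L²` -/

section MulOp

variable {α : Type*} [MeasurableSpace α] {μ : Measure α}

/-! The obstacle is that `|𝐗|^k` and `|𝐏|^k` are unbounded and that nothing places `U(t,s)Ψ₀` in
their domains beforehand, so moments cannot be differentiated along the flow. They are replaced by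
finite differences of unitaries. With the Weyl operators `W(a,b) = exp(i(b X_j + a P_j))` of one
tracer coordinate, a vector in the domain of the `k`-th power of `X_j` or `P_j` satisfies `‖(W -
1)^k f‖ = O(h^k)` in the direction `(0,h)` or `(h,0)`, because `|e^{ix} - 1| ≤ |x|`. Conversely, by
Fatou, such bounds in all coordinates give the moment (`eLpNorm_pow_mul_le_of_bound`,
`exists_moment`); momenta are treated on the Fourier side.

Three facts make the differences propagate. First, the free evolution conjugates Weyl operators into
Weyl operators: `(a,b)` becomes `(a - τb/N, b)` (`sweyl_freeOp`). The quartic term is a bounded real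
function of the boson positions; it commutes with `W` and drops out of the derivative of `‖(W - 1)^k
Ψ_n‖²` (`hasDerivAt_diff_sq`). Second, in each sector the interaction is a sum of products of
bounded operators, all commuting with `W` except multiplication by `w(x - X⁽ˡ⁾)`, whose iterated
differences under a shift by `a` are `O(|a|^i)`. Hence the differences of order `k` of the
interaction term are bounded by those of `Ψ` of orders `i ≤ k` with weights `|a|^(k-i)`, uniformly
in the mean-field position and for bounded `‖φ‖` (`exists_source_bound`). Third, the cut-off stands
to the left of the interaction: sectors with `n > M` have no source, and a sector with `n ≤ M` is
fed only by sectors up to `n + 2`. The sectors `n ≤ ⌊M⌋ + 2` thus form a closed finite system, and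
in every sector above `M` the norms of the differences are exactly conserved (`norm_diff_eq`).

Gronwall's lemma for the sum of the squares of the differences, order `i` carrying the weight
`|h|^(k-i)`, then preserves the size `h^(2k)` with a constant independent of `h`
(`exists_energy_bound`). Since the direction `(a,b)` drifts, the position moment at time `t` needs
differences of `Ψ₀` in the mixed direction `((t-s)/N, 1)`, which arrives at `(0,1)`; the direction
`(1,0)` of the momentum does not move. Mixed differences of order `k` are bounded by pure ones up to
order `2k` (`norm_weyl_diff_le`), which `𝒟_∞` provides. Square summability over the sectors is
inherited from the initial data, and the moments of `N_b` are the case of differences of order zero.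
-/

open Classical in
/-- Multiplication by an essentially bounded function, as a bounded operator on `L²`
(and `0` if the function is not essentially bounded). -/
def mulOp (μ : Measure α) (q : α → ℂ) : Lp ℂ 2 μ →L[ℂ] Lp ℂ 2 μ :=
  if h : MemLp q ⊤ μ then
    (ContinuousLinearMap.mul ℂ ℂ).holderL μ ⊤ 2 2 (h.toLp q)
  else 0

theorem mulOp_coe {q : α → ℂ} (hq : MemLp q ⊤ μ) (f : Lp ℂ 2 μ) :
    mulOp μ q f =ᵐ[μ] fun x => q x * f x := by
  rw [mulOp, dif_pos hq, ContinuousLinearMap.holderL_apply_apply]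
  filter_upwards [(ContinuousLinearMap.mul ℂ ℂ).coeFn_holder (r := 2) (hq.toLp q) f,
    hq.coeFn_toLp] with x hx hx'
  rw [hx, hx']
  rfl

theorem Lp_norm_le_of_ae {β : Type*} [MeasurableSpace β] {ν : Measure β} (f : Lp ℂ 2 μ)
    (g : Lp ℂ 2 ν) {C : ℝ} (hC : 0 ≤ C)
    (h : eLpNorm f 2 μ ≤ ENNReal.ofReal C * eLpNorm g 2 ν) : ‖f‖ ≤ C * ‖g‖ := by
  rw [Lp.norm_def, Lp.norm_def, ← ENNReal.toReal_ofReal hC, ← ENNReal.toReal_mul]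
  exact ENNReal.toReal_mono (ENNReal.mul_ne_top ENNReal.ofReal_ne_top (Lp.eLpNorm_ne_top g)) h

theorem norm_le_mul_of_ae_le {f g : Lp ℂ 2 μ} {C : ℝ} (hC : 0 ≤ C)
    (h : ∀ᵐ x ∂μ, ‖f x‖ ≤ C * ‖g x‖) : ‖f‖ ≤ C * ‖g‖ :=
  Lp_norm_le_of_ae f g hC (eLpNorm_le_mul_eLpNorm_of_ae_le_mul h 2)

theorem norm_eq_of_ae_eq {f g : Lp ℂ 2 μ} (h : ∀ᵐ x ∂μ, ‖f x‖ = ‖g x‖) : ‖f‖ = ‖g‖ := by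
  rw [Lp.norm_def, Lp.norm_def, eLpNorm_congr_norm_ae h]

theorem norm_mulOp_apply_le {q : α → ℂ} (hq : MemLp q ⊤ μ) {C : ℝ} (hC : 0 ≤ C)
    (h : ∀ᵐ x ∂μ, ‖q x‖ ≤ C) (f : Lp ℂ 2 μ) : ‖mulOp μ q f‖ ≤ C * ‖f‖ := by
  refine norm_le_mul_of_ae_le hC ?_
  filter_upwards [mulOp_coe hq f, h] with x hx hx'
  rw [hx, norm_mul]
  gcongr

theorem norm_mulOp_apply {q : α → ℂ} (hq : MemLp q ⊤ μ)
    (h : ∀ᵐ x ∂μ, ‖q x‖ = 1) (f : Lp ℂ 2 μ) : ‖mulOp μ q f‖ = ‖f‖ := by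
  refine norm_eq_of_ae_eq ?_
  filter_upwards [mulOp_coe hq f, h] with x hx hx'
  rw [hx, norm_mul, hx', one_mul]

theorem memLp_top_of_norm_le {q : α → ℂ} (hq : AEStronglyMeasurable q μ) {C : ℝ}
    (h : ∀ x, ‖q x‖ ≤ C) : MemLp q ⊤ μ :=
  memLp_top_of_bound hq C (Filter.Eventually.of_forall h)

theorem inner_Lp_eq (f g : Lp ℂ 2 μ) : inner ℂ f g = ∫ x, conj (f x) * g x ∂μ := by
  rw [L2.inner_def]
  refine integral_congr_ae (Filter.Eventually.of_forall fun x => ?_)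
  simp [mul_comm]

theorem im_inner_mulOp_real {q : α → ℝ} (hq : MemLp (fun x => (q x : ℂ)) ⊤ μ) (f : Lp ℂ 2 μ) :
    (inner ℂ f (mulOp μ (fun x => (q x : ℂ)) f)).im = 0 := by
  have h : (starRingEnd ℂ) (inner ℂ f (mulOp μ (fun x => (q x : ℂ)) f)) =
      inner ℂ f (mulOp μ (fun x => (q x : ℂ)) f) := by
    rw [inner_conj_symm, inner_Lp_eq, inner_Lp_eq]
    refine integral_congr_ae ?_
    filter_upwards [mulOp_coe hq f] with x hx
    rw [hx, map_mul, Complex.conj_ofReal]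
    ring
  exact Complex.conj_eq_iff_im.1 h

end MulOp

/-! ### Weyl operators -/

section Weyl

variable {E : Type*} [NormedAddCommGroup E] [InnerProductSpace ℝ E] [FiniteDimensional ℝ E]
  [MeasurableSpace E] [BorelSpace E]

/-- The phase `exp(i⟨q, z + p/2⟩)`. -/
def weylPhase (p q z : E) : ℂ := Complex.exp (Complex.I * (inner ℝ q (z + (2⁻¹ : ℝ) • p) : ℝ))

theorem norm_weylPhase (p q z : E) : ‖weylPhase p q z‖ = 1 := by
  rw [weylPhase, mul_comm]; exact Complex.norm_exp_ofReal_mul_I _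

theorem continuous_weylPhase (p q : E) : Continuous (weylPhase p q) := by
  unfold weylPhase
  fun_prop

theorem memLp_weylPhase (p q : E) : MemLp (weylPhase p q) ⊤ (volume : Measure E) :=
  memLp_top_of_norm_le (continuous_weylPhase p q).aestronglyMeasurable
    (fun z => (norm_weylPhase p q z).le)

/-- Translation of functions by `p`. -/
def translateOp (p : E) : Lp ℂ 2 (volume : Measure E) →L[ℂ] Lp ℂ 2 (volume : Measure E) :=
  (Lp.compMeasurePreservingₗᵢ ℂ (fun z : E => z + p)
    (measurePreserving_add_right volume p)).toContinuousLinearMap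

theorem translateOp_coe (p : E) (f : Lp ℂ 2 (volume : Measure E)) :
    translateOp p f =ᵐ[volume] fun z => f (z + p) :=
  Lp.coeFn_compMeasurePreserving f (measurePreserving_add_right volume p)

theorem norm_translateOp (p : E) (f : Lp ℂ 2 (volume : Measure E)) : ‖translateOp p f‖ = ‖f‖ :=
  (Lp.compMeasurePreservingₗᵢ ℂ (fun z : E => z + p)
    (measurePreserving_add_right volume p)).norm_map f

/-- The Weyl operator `exp(i(⟨q, X⟩ + ⟨p, -i∇⟩))`. -/
def weyl (p q : E) : Lp ℂ 2 (volume : Measure E) →L[ℂ] Lp ℂ 2 (volume : Measure E) :=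
  (mulOp volume (weylPhase p q)).comp (translateOp p)

theorem weyl_coe (p q : E) (f : Lp ℂ 2 (volume : Measure E)) :
    weyl p q f =ᵐ[volume] fun z => weylPhase p q z * f (z + p) := by
  filter_upwards [mulOp_coe (memLp_weylPhase p q) (translateOp p f), translateOp_coe p f]
    with z hz hz'
  rw [weyl, ContinuousLinearMap.comp_apply, hz, hz']

theorem norm_weyl (p q : E) (f : Lp ℂ 2 (volume : Measure E)) : ‖weyl p q f‖ = ‖f‖ := by
  rw [weyl, ContinuousLinearMap.comp_apply, norm_mulOp_apply (memLp_weylPhase p q)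
    (Filter.Eventually.of_forall (norm_weylPhase p q)), norm_translateOp]

theorem ae_add_right {P : E → Prop} (p : E) (h : ∀ᵐ z : E, P z) : ∀ᵐ z : E, P (z + p) :=
  (measurePreserving_add_right volume p).quasiMeasurePreserving.ae h

theorem weyl_zero_zero : weyl (0 : E) 0 = 1 := by
  ext1 f
  refine Lp.ext ?_
  filter_upwards [weyl_coe 0 0 f] with z hz
  rw [hz]
  simp [weylPhase]

/-- The Weyl relations. The cocycle is half the symplectic form and vanishes for parallel
directions, so the symmetric phase `z + p/2` makes `W` a one-parameter group along every line. -/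
theorem weyl_weyl (p q p' q' : E) (f : Lp ℂ 2 (volume : Measure E)) :
    weyl p q (weyl p' q' f) =
      Complex.exp (Complex.I * ((inner ℝ q' p - inner ℝ q p') / 2 : ℝ)) •
        weyl (p + p') (q + q') f := by
  refine Lp.ext ?_
  filter_upwards [weyl_coe p q (weyl p' q' f), ae_add_right p (weyl_coe p' q' f),
    weyl_coe (p + p') (q + q') f, Lp.coeFn_smul (Complex.exp (Complex.I * ((inner ℝ q' p - inner ℝ q p') / 2 : ℝ)))
      (weyl (p + p') (q + q') f)] with z h1 h2 h3 h4
  rw [h1, h2, h4, Pi.smul_apply, h3, smul_eq_mul, ← mul_assoc, ← mul_assoc, add_assoc]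
  congr 1
  unfold weylPhase
  rw [← Complex.exp_add, ← Complex.exp_add]
  congr 1
  simp only [inner_add_left, inner_add_right, inner_smul_right]
  push_cast
  ring

theorem inner_weyl (p q : E) (f g : Lp ℂ 2 (volume : Measure E)) :
    inner ℂ (weyl p q f) g = inner ℂ f (weyl (-p) (-q) g) := by
  have h : g = weyl p q (weyl (-p) (-q) g) := by
    rw [weyl_weyl]
    simp [weyl_zero_zero]
  conv_lhs => rw [h]
  let V : Lp ℂ 2 (volume : Measure E) →ₗᵢ[ℂ] Lp ℂ 2 (volume : Measure E) :=
    ⟨(weyl p q).toLinearMap, norm_weyl p q⟩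
  exact V.inner_map_map f (weyl (-p) (-q) g)

/-! ### Weyl operators and the Fourier transform -/

/-- Identities for the `L²` Fourier transform are checked on Schwartz functions, where the integral
formula holds, and extended by density. -/
theorem eq_of_eq_schwartz {F : Type*} [TopologicalSpace F] [T2Space F]
    {A B : Lp ℂ 2 (volume : Measure E) → F} (hA : Continuous A) (hB : Continuous B)
    (h : ∀ f : 𝓢(E, ℂ), A (f.toLp 2) = B (f.toLp 2)) (f : Lp ℂ 2 (volume : Measure E)) :
    A f = B f :=
  DenseRange.induction_on (p := fun f => A f = B f)
    (SchwartzMap.denseRange_toLpCLM (p := 2) ENNReal.ofNat_ne_top) f (isClosed_eq hA hB) h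

/-- Translation of a Schwartz function. -/
def translateSchwartz (p : E) (f : 𝓢(E, ℂ)) : 𝓢(E, ℂ) := SchwartzMap.compSubConstCLM ℂ (-p) f

theorem translateSchwartz_apply (p : E) (f : 𝓢(E, ℂ)) (z : E) :
    translateSchwartz p f z = f (z + p) := by
  simp [translateSchwartz]

theorem translateOp_toLp (p : E) (f : 𝓢(E, ℂ)) :
    translateOp p (f.toLp 2) = (translateSchwartz p f).toLp 2 := by
  refine Lp.ext ?_
  filter_upwards [translateOp_coe p (f.toLp 2), ae_add_right p (f.coeFn_toLp 2 volume),
    (translateSchwartz p f).coeFn_toLp 2 volume] with z h1 h2 h3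
  rw [h1, h2, h3, translateSchwartz_apply]

theorem fourier_translateOp (p : E) (f : Lp ℂ 2 (volume : Measure E)) :
    𝓕 (translateOp p f) =
      mulOp volume (weylPhase 0 ((2 * Real.pi) • p)) (𝓕 f : Lp ℂ 2 (volume : Measure E)) := by
  refine eq_of_eq_schwartz (A := fun f => 𝓕 (translateOp p f))
    (B := fun f => mulOp volume (weylPhase 0 ((2 * Real.pi) • p)) (𝓕 f))
    ((Lp.fourierTransformₗᵢ E ℂ).continuous.comp (translateOp p).continuous)
    ((mulOp volume _).continuous.comp (Lp.fourierTransformₗᵢ E ℂ).continuous) (fun f => ?_) f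
  rw [translateOp_toLp, SchwartzMap.toLp_fourier_eq, SchwartzMap.toLp_fourier_eq]
  refine Lp.ext ?_
  filter_upwards [mulOp_coe (memLp_weylPhase 0 ((2 * Real.pi) • p)) ((𝓕 f).toLp 2),
    (𝓕 f).coeFn_toLp 2 volume, (𝓕 (translateSchwartz p f)).coeFn_toLp 2 volume] with z h1 h2 h3
  rw [h1, h2, h3, SchwartzMap.fourier_coe, SchwartzMap.fourier_coe]
  have h4 : ⇑(translateSchwartz p f) = f ∘ fun v => v + p := by
    ext v; exact translateSchwartz_apply p f v
  rw [h4]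
  have := congrFun (VectorFourier.fourierIntegral_comp_add_right Real.fourierChar volume (innerₗ E) f p) z
  refine this.trans ?_
  rw [Circle.smul_def, smul_eq_mul]
  congr 1
  rw [Real.fourierChar_apply, weylPhase]
  congr 1
  simp [inner_smul_left]
  ring

theorem fourierInv_translateOp (p : E) (f : Lp ℂ 2 (volume : Measure E)) :
    𝓕⁻ (translateOp p f) =
      mulOp volume (weylPhase 0 (-(2 * Real.pi) • p)) (𝓕⁻ f : Lp ℂ 2 (volume : Measure E)) := by
  refine eq_of_eq_schwartz (A := fun f => 𝓕⁻ (translateOp p f))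
    (B := fun f => mulOp volume (weylPhase 0 (-(2 * Real.pi) • p)) (𝓕⁻ f))
    ((Lp.fourierTransformₗᵢ E ℂ).symm.continuous.comp (translateOp p).continuous)
    ((mulOp volume _).continuous.comp (Lp.fourierTransformₗᵢ E ℂ).symm.continuous)
    (fun f => ?_) f
  rw [translateOp_toLp, SchwartzMap.toLp_fourierInv_eq, SchwartzMap.toLp_fourierInv_eq]
  refine Lp.ext ?_
  filter_upwards [mulOp_coe (memLp_weylPhase 0 (-(2 * Real.pi) • p)) ((𝓕⁻ f).toLp 2),
    (𝓕⁻ f).coeFn_toLp 2 volume, (𝓕⁻ (translateSchwartz p f)).coeFn_toLp 2 volume] with z h1 h2 h3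
  rw [h1, h2, h3, SchwartzMap.fourierInv_coe, SchwartzMap.fourierInv_coe]
  have h4 : ⇑(translateSchwartz p f) = f ∘ fun v => v + p := by
    ext v; exact translateSchwartz_apply p f v
  rw [h4, Real.fourierInv_eq_fourier_neg, Real.fourierInv_eq_fourier_neg]
  have := congrFun (VectorFourier.fourierIntegral_comp_add_right Real.fourierChar volume (innerₗ E) f p) (-z)
  refine this.trans ?_
  rw [Circle.smul_def, smul_eq_mul]
  congr 1
  rw [Real.fourierChar_apply, weylPhase]
  congr 1
  simp [inner_smul_left]
  ring

theorem fourier_mulOp_phase (q : E) (f : Lp ℂ 2 (volume : Measure E)) :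
    𝓕 (mulOp volume (weylPhase 0 q) f) =
      translateOp (-(2 * Real.pi)⁻¹ • q) (𝓕 f : Lp ℂ 2 (volume : Measure E)) := by
  have h := fourierInv_translateOp (-(2 * Real.pi)⁻¹ • q) (𝓕 f : Lp ℂ 2 (volume : Measure E))
  rw [fourierInv_fourier_eq, smul_smul] at h
  have h2 : -(2 * Real.pi) * -(2 * Real.pi)⁻¹ = 1 := by
    have := Real.pi_pos; field_simp
  rw [h2, one_smul] at h
  rw [← h, fourier_fourierInv_eq]

theorem weyl_eq_smul (p q : E) (f : Lp ℂ 2 (volume : Measure E)) :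
    weyl p q f = Complex.exp (Complex.I * (inner ℝ q p / 2 : ℝ)) •
      mulOp volume (weylPhase 0 q) (translateOp p f) := by
  refine Lp.ext ?_
  filter_upwards [weyl_coe p q f, Lp.coeFn_smul (Complex.exp (Complex.I * (inner ℝ q p / 2 : ℝ)))
    (mulOp volume (weylPhase 0 q) (translateOp p f)),
    mulOp_coe (memLp_weylPhase 0 q) (translateOp p f), translateOp_coe p f] with z h1 h2 h3 h4
  rw [h1, h2, Pi.smul_apply, h3, h4, smul_eq_mul, ← mul_assoc]
  congr 1
  unfold weylPhase
  rw [← Complex.exp_add]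
  congr 1
  simp only [inner_add_right, inner_smul_right]
  push_cast
  simp
  ring

/-- The Fourier transform is a quarter turn of phase space. It sends Weyl operators to Weyl
operators without an extra phase because of the symmetric ordering. -/
theorem fourier_weyl (p q : E) (f : Lp ℂ 2 (volume : Measure E)) :
    𝓕 (weyl p q f) =
      weyl (-(2 * Real.pi)⁻¹ • q) ((2 * Real.pi) • p) (𝓕 f : Lp ℂ 2 (volume : Measure E)) := by
  rw [weyl_eq_smul, FourierTransform.fourier_smul, fourier_mulOp_phase, fourier_translateOp]
  refine Lp.ext ?_
  set c := Complex.exp (Complex.I * (inner ℝ q p / 2 : ℝ)) with hc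
  filter_upwards [weyl_coe (-(2 * Real.pi)⁻¹ • q) ((2 * Real.pi) • p) (𝓕 f : Lp ℂ 2 (volume : Measure E)),
    Lp.coeFn_smul c (translateOp (-(2 * Real.pi)⁻¹ • q) (mulOp volume (weylPhase 0 ((2 * Real.pi) • p))
      (𝓕 f : Lp ℂ 2 (volume : Measure E)))),
    translateOp_coe (-(2 * Real.pi)⁻¹ • q) (mulOp volume (weylPhase 0 ((2 * Real.pi) • p))
      (𝓕 f : Lp ℂ 2 (volume : Measure E))),
    ae_add_right (-(2 * Real.pi)⁻¹ • q) (mulOp_coe (memLp_weylPhase 0 ((2 * Real.pi) • p))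
      (𝓕 f : Lp ℂ 2 (volume : Measure E)))] with z h1 h2 h3 h4
  rw [h1, h2, Pi.smul_apply, h3, h4, smul_eq_mul, ← mul_assoc]
  congr 1
  rw [hc]
  unfold weylPhase
  rw [← Complex.exp_add]
  congr 1
  simp only [inner_add_right, inner_smul_right, inner_smul_left, real_inner_comm q p, inner_zero_right]
  have hpi : (Real.pi : ℂ) ≠ 0 := by exact_mod_cast Real.pi_ne_zero
  simp
  field_simp
  ring

/-- Applied to relabellings, this makes permutation-invariant Fourier multipliers preserve the boson
symmetry. -/
theorem fourier_compIsometry (σ : E ≃ₗᵢ[ℝ] E) (f : Lp ℂ 2 (volume : Measure E)) :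
    𝓕 (Lp.compMeasurePreservingₗᵢ ℂ σ σ.measurePreserving f) =
      Lp.compMeasurePreservingₗᵢ ℂ σ σ.measurePreserving (𝓕 f : Lp ℂ 2 (volume : Measure E)) := by
  refine eq_of_eq_schwartz
    (A := fun f => 𝓕 (Lp.compMeasurePreservingₗᵢ ℂ σ σ.measurePreserving f))
    (B := fun f => Lp.compMeasurePreservingₗᵢ ℂ σ σ.measurePreserving (𝓕 f))
    ((Lp.fourierTransformₗᵢ E ℂ).continuous.comp (LinearIsometry.continuous _))
    ((LinearIsometry.continuous _).comp (Lp.fourierTransformₗᵢ E ℂ).continuous)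
    (fun f => ?_) f
  have h0 : Lp.compMeasurePreservingₗᵢ ℂ σ σ.measurePreserving (f.toLp 2) =
      (SchwartzMap.compCLMOfContinuousLinearEquiv ℂ σ.toContinuousLinearEquiv f).toLp 2 := by
    refine Lp.ext ?_
    filter_upwards [Lp.coeFn_compMeasurePreserving (f.toLp 2) σ.measurePreserving,
      σ.measurePreserving.quasiMeasurePreserving.ae (f.coeFn_toLp 2 volume),
      (SchwartzMap.compCLMOfContinuousLinearEquiv ℂ σ.toContinuousLinearEquiv f).coeFn_toLp 2 volume]
      with z h1 h2 h3
    rw [h3]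
    exact h1.trans h2
  rw [h0, SchwartzMap.toLp_fourier_eq, SchwartzMap.toLp_fourier_eq]
  refine Lp.ext ?_
  filter_upwards [Lp.coeFn_compMeasurePreserving ((𝓕 f).toLp 2) σ.measurePreserving,
      σ.measurePreserving.quasiMeasurePreserving.ae ((𝓕 f).coeFn_toLp 2 volume),
      (𝓕 (SchwartzMap.compCLMOfContinuousLinearEquiv ℂ σ.toContinuousLinearEquiv f)).coeFn_toLp 2 volume]
      with z h1 h2 h3
  rw [h3, SchwartzMap.fourier_coe]
  refine Eq.trans ?_ (h1.trans h2).symm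
  rw [SchwartzMap.fourier_coe]
  exact Real.fourier_comp_linearIsometry σ f z

end Weyl

/-! ### Strong convergence of multiplication operators -/

section Strong

variable {α : Type*} [MeasurableSpace α] {μ : Measure α}

theorem norm_sq_Lp_eq (f : Lp ℂ 2 μ) : ‖f‖ ^ 2 = ∫ x, ‖f x‖ ^ 2 ∂μ := by
  have h := inner_self_eq_norm_sq_to_K (𝕜 := ℂ) f
  rw [inner_Lp_eq] at h
  have h2 : ∀ x, conj (f x) * f x = ((‖f x‖ ^ 2 : ℝ) : ℂ) := fun x => by
    rw [mul_comm, Complex.mul_conj, Complex.normSq_eq_norm_sq]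
  simp_rw [h2] at h
  rw [integral_complex_ofReal] at h
  exact (Complex.ofReal_injective (by rw [h]; push_cast; rfl)).symm

/-- Dominated convergence with dominant `C²|f|²`. Strong continuity and differentiability of the
free evolution and the density of the domain all reduce to it. -/
theorem tendsto_mulOp_zero {ι : Type*} {l : Filter ι} [l.IsCountablyGenerated]
    {m : ι → α → ℂ} {C : ℝ} (hm : ∀ i, AEStronglyMeasurable (m i) μ)
    (hC : ∀ i x, ‖m i x‖ ≤ C) (h : ∀ x, Tendsto (fun i => m i x) l (𝓝 0)) (f : Lp ℂ 2 μ) :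
    Tendsto (fun i => mulOp μ (m i) f) l (𝓝 0) := by
  have hL : ∀ i, MemLp (m i) ⊤ μ := fun i => memLp_top_of_norm_le (hm i) (hC i)
  have key : Tendsto (fun i => ‖mulOp μ (m i) f‖ ^ 2) l (𝓝 0) := by
    have h1 : Tendsto (fun i => ∫ x, (‖m i x‖ * ‖f x‖) ^ 2 ∂μ) l (𝓝 (∫ _, (0 : ℝ) ∂μ)) := by
      refine tendsto_integral_filter_of_dominated_convergence (fun x => C ^ 2 * ‖f x‖ ^ 2) ?_ ?_ ?_ ?_
      · exact Eventually.of_forall fun i =>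
          (((hm i).norm.mul (Lp.aestronglyMeasurable f).norm).pow 2)
      · refine Eventually.of_forall fun i => Eventually.of_forall fun x => ?_
        rw [Real.norm_of_nonneg (by positivity), mul_pow]
        gcongr
        exact hC i x
      · exact ((Lp.memLp f).integrable_norm_pow (by norm_num)).const_mul _
      · refine Eventually.of_forall fun x => ?_
        have := (((h x).norm.mul_const ‖f x‖).pow 2)
        simpa using this
    rw [integral_zero] at h1
    refine h1.congr fun i => ?_
    rw [norm_sq_Lp_eq]
    refine integral_congr_ae ?_
    filter_upwards [mulOp_coe (hL i) f] with x hx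
    rw [hx, norm_mul]
  rw [tendsto_zero_iff_norm_tendsto_zero]
  have := key.sqrt
  simpa [Real.sqrt_sq (norm_nonneg _)] using this

theorem memLp_top_mul {q r : α → ℂ} (hq : MemLp q ⊤ μ) (hr : MemLp r ⊤ μ) :
    MemLp (fun x => q x * r x) ⊤ μ := hr.mul hq

theorem memLp_top_sub {q r : α → ℂ} (hq : MemLp q ⊤ μ) (hr : MemLp r ⊤ μ) :
    MemLp (fun x => q x - r x) ⊤ μ := hq.sub hr

theorem memLp_top_sub_one {q : α → ℂ} (hq : MemLp q ⊤ μ) :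
    MemLp (fun x => q x - 1) ⊤ μ := hq.sub (memLp_top_const 1)

theorem real_smul_Lp (c : ℝ) (f : Lp ℂ 2 μ) : c • f = (c : ℂ) • f := by
  refine Lp.ext ?_
  filter_upwards [Lp.coeFn_smul c f, Lp.coeFn_smul (c : ℂ) f] with x h1 h2
  rw [h1, h2, Pi.smul_apply, Pi.smul_apply, Complex.real_smul, smul_eq_mul]

theorem mulOp_mulOp {q r : α → ℂ} (hq : MemLp q ⊤ μ) (hr : MemLp r ⊤ μ) (f : Lp ℂ 2 μ) :
    mulOp μ q (mulOp μ r f) = mulOp μ (fun x => q x * r x) f := by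
  refine Lp.ext ?_
  filter_upwards [mulOp_coe hq (mulOp μ r f), mulOp_coe hr f,
    mulOp_coe (memLp_top_mul hq hr) f] with x h1 h2 h3
  rw [h1, h2, h3, mul_assoc]

theorem mulOp_one : mulOp μ (fun _ => (1 : ℂ)) = 1 := by
  ext1 f
  refine Lp.ext ?_
  filter_upwards [mulOp_coe (memLp_top_const (1 : ℂ)) f] with x h
  rw [h, one_mul]
  rfl

theorem mulOp_sub {q r : α → ℂ} (hq : MemLp q ⊤ μ) (hr : MemLp r ⊤ μ) :
    mulOp μ q - mulOp μ r = mulOp μ (fun x => q x - r x) := by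
  ext1 f
  refine Lp.ext ?_
  filter_upwards [mulOp_coe hq f, mulOp_coe hr f, Lp.coeFn_sub (mulOp μ q f) (mulOp μ r f),
    mulOp_coe (memLp_top_sub hq hr) f] with x h1 h2 h3 h4
  rw [sub_apply, h3, h4, Pi.sub_apply, h1, h2, sub_mul]

theorem memLp_top_pow {q : α → ℂ} (hq : MemLp q ⊤ μ) (k : ℕ) :
    MemLp (fun x => q x ^ k) ⊤ μ := by
  induction k with
  | zero => simpa using memLp_top_const (1 : ℂ)
  | succ k ih => simp_rw [pow_succ]; exact hq.mul ih

theorem mulOp_pow {q : α → ℂ} (hq : MemLp q ⊤ μ) (k : ℕ) :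
    mulOp μ q ^ k = mulOp μ (fun x => q x ^ k) := by
  induction k with
  | zero => simp [mulOp_one]
  | succ k ih =>
    ext1 f
    rw [pow_succ, ih, mul_apply_eq_comp, mulOp_mulOp (memLp_top_pow hq k) hq]
    simp_rw [pow_succ]

theorem mulOp_sub_one_pow {q : α → ℂ} (hq : MemLp q ⊤ μ) (k : ℕ) :
    (mulOp μ q - 1) ^ k = mulOp μ (fun x => (q x - 1) ^ k) := by
  rw [← mulOp_one, mulOp_sub hq (memLp_top_const _),
    mulOp_pow (memLp_top_sub_one hq)]

/-- If the difference quotients `((e^{ihq} - 1)/h)^k f` are bounded in `L²`, then `q^k f ∈ L²`. -/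
theorem eLpNorm_pow_mul_le_of_bound {q : α → ℝ} (hq : Measurable q) (f : Lp ℂ 2 μ) (k : ℕ) {C : ℝ}
    (hb : ∀ h : ℝ, 0 < h → h ≤ 1 →
      ‖((mulOp μ (fun x => Complex.exp (Complex.I * ((h * q x : ℝ) : ℂ))) - 1) ^ k) f‖
        ≤ C * h ^ k) :
    eLpNorm (fun x => ((q x ^ k : ℝ) : ℂ) * f x) 2 μ ≤ ENNReal.ofReal C := by
  let e : ℕ → α → ℂ := fun n x => Complex.exp (Complex.I * (((1 / ((n : ℝ) + 1)) * q x : ℝ) : ℂ))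
  let F : ℕ → α → ℂ := fun n x => (((n : ℂ) + 1) * (e n x - 1)) ^ k * f x
  have he : ∀ n, Measurable (e n) := fun n => by
    dsimp only [e]; fun_prop
  have heL : ∀ n, MemLp (e n) ⊤ μ := fun n =>
    memLp_top_of_norm_le (he n).aestronglyMeasurable (C := 1) fun x => by
      dsimp only [e]; rw [mul_comm, Complex.norm_exp_ofReal_mul_I]
  have hF : ∀ n, AEStronglyMeasurable (F n) μ := fun n =>
    ((((he n).sub_const 1).const_mul _).pow_const k).aestronglyMeasurable.mul
      (Lp.aestronglyMeasurable f)
  have hlim : ∀ᵐ x ∂μ, Tendsto (fun n => F n x) atTop (𝓝 ((Complex.I * q x) ^ k * f x)) := by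
    refine Eventually.of_forall fun x => ?_
    refine Tendsto.mul_const _ (Tendsto.pow ?_ k)
    have hd : HasDerivAt (fun h : ℝ => Complex.exp (Complex.I * ((h * q x : ℝ) : ℂ)))
        (Complex.I * q x) 0 := by
      have h1 : HasDerivAt (fun h : ℝ => Complex.I * ((h * q x : ℝ) : ℂ)) (Complex.I * q x) 0 := by
        have h0 : HasDerivAt (fun h : ℝ => h * q x) (q x) 0 := by
          simpa using (hasDerivAt_id (0 : ℝ)).mul_const (q x)
        exact h0.ofReal_comp.const_mul Complex.I
      have h2 := h1.cexp
      simpa using h2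
    have hs := hd.tendsto_slope_zero_right
    have hseq : Tendsto (fun n : ℕ => 1 / ((n : ℝ) + 1)) atTop (𝓝[>] 0) :=
      tendsto_nhdsWithin_iff.2 ⟨tendsto_one_div_add_atTop_nhds_zero_nat,
        Eventually.of_forall fun n => by simp only [Set.mem_Ioi]; positivity⟩
    refine (hs.comp hseq).congr fun n => ?_
    simp only [Function.comp_apply, zero_add, zero_mul, Complex.ofReal_zero, mul_zero,
      Complex.exp_zero, e]
    rw [Complex.real_smul]
    congr 1
    push_cast
    rw [one_div, inv_inv]
  -- Fatou along `h = 1/(n+1)`: the quotients converge pointwise to `(iq)^k f`, so the uniform bound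
  -- passes to the limit although `q^k f ∈ L²` is not known beforehand.
  have hle := Lp.eLpNorm_lim_le_liminf_eLpNorm (p := 2) hF _ hlim
  have h1 : eLpNorm (fun x => ((q x ^ k : ℝ) : ℂ) * f x) 2 μ =
      eLpNorm (fun x => (Complex.I * q x) ^ k * f x) 2 μ := by
    refine eLpNorm_congr_norm_ae (Eventually.of_forall fun x => ?_)
    simp
  rw [h1]
  refine hle.trans ?_
  refine liminf_le_of_le (by isBoundedDefault) fun b hbb => ?_
  obtain ⟨n, hn⟩ := hbb.exists
  refine hn.trans ?_
  have hpos : (0 : ℝ) < 1 / ((n : ℝ) + 1) := by positivity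
  have h2 := hb (1 / ((n : ℝ) + 1)) hpos (by
    rw [div_le_one (by positivity)]; linarith [(Nat.cast_nonneg n : (0 : ℝ) ≤ n)])
  change ‖(((mulOp μ (e n)) - 1) ^ k) f‖ ≤ _ at h2
  rw [mulOp_sub_one_pow (heL n)] at h2
  have hm : MemLp (fun x => (e n x - 1) ^ k) ⊤ μ :=
    memLp_top_pow (memLp_top_sub_one (heL n)) k
  have h3 : eLpNorm (F n) 2 μ =
      eLpNorm (((((n : ℂ) + 1) ^ k) • mulOp μ (fun x => (e n x - 1) ^ k) f : Lp ℂ 2 μ)) 2 μ := by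
    refine eLpNorm_congr_ae ?_
    filter_upwards [mulOp_coe hm f, Lp.coeFn_smul (((n : ℂ) + 1) ^ k)
      (mulOp μ (fun x => (e n x - 1) ^ k) f)] with x hx1 hx2
    rw [hx2, Pi.smul_apply, hx1]
    simp only [F, smul_eq_mul, mul_pow]
    ring
  rw [h3, ← Lp.enorm_def, ← ofReal_norm]
  refine ENNReal.ofReal_le_ofReal ?_
  rw [norm_smul, norm_pow]
  have h4 : ‖(n : ℂ) + 1‖ = (n : ℝ) + 1 := by
    have : ((n : ℂ) + 1) = (((n : ℝ) + 1 : ℝ) : ℂ) := by push_cast; rfl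
    rw [this, Complex.norm_real, Real.norm_of_nonneg (by positivity)]
  rw [h4]
  calc ((n : ℝ) + 1) ^ k * _ ≤ ((n : ℝ) + 1) ^ k * (C * (1 / ((n : ℝ) + 1)) ^ k) := by gcongr
    _ = C := by
      rw [mul_comm, mul_assoc, ← mul_pow, one_div, inv_mul_cancel₀ (by positivity), one_pow, mul_one]

theorem norm_exp_I_sub_one_le (x : ℝ) : ‖Complex.exp (Complex.I * (x : ℂ)) - 1‖ ≤ |x| := by
  have := Real.norm_exp_I_mul_ofReal_sub_one_le (x := x)
  simpa using this

theorem norm_mulOp_phase_sub_one_pow_le {q : α → ℝ} (hq : Measurable q) (f g : Lp ℂ 2 μ) (k : ℕ)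
    (hg : ∀ᵐ x ∂μ, |q x| ^ k * ‖f x‖ ≤ ‖g x‖) (h : ℝ) :
    ‖((mulOp μ (fun x => Complex.exp (Complex.I * ((h * q x : ℝ) : ℂ))) - 1) ^ k) f‖
      ≤ |h| ^ k * ‖g‖ := by
  have he : Measurable fun x => Complex.exp (Complex.I * ((h * q x : ℝ) : ℂ)) := by fun_prop
  have heL : MemLp (fun x => Complex.exp (Complex.I * ((h * q x : ℝ) : ℂ))) ⊤ μ :=
    memLp_top_of_norm_le he.aestronglyMeasurable (C := 1) fun x => by
      rw [mul_comm, Complex.norm_exp_ofReal_mul_I]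
  rw [mulOp_sub_one_pow heL]
  refine norm_le_mul_of_ae_le (by positivity) ?_
  filter_upwards [mulOp_coe (memLp_top_pow (memLp_top_sub_one heL) k) f, hg] with x h1 h2
  refine le_trans ?_ (mul_le_mul_of_nonneg_left h2 (by positivity))
  rw [h1, norm_mul, norm_pow, ← mul_assoc, ← mul_pow, ← abs_mul]
  gcongr
  exact norm_exp_I_sub_one_le _

end Strong

/-! ### The free evolution -/

section Free

variable {E : Type*} [NormedAddCommGroup E] [InnerProductSpace ℝ E] [FiniteDimensional ℝ E]
  [MeasurableSpace E] [BorelSpace E]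

/-- The phase `exp(iτ s(ξ))`. -/
def freePhase (s : E → ℝ) (τ : ℝ) (ξ : E) : ℂ := Complex.exp (Complex.I * ((τ * s ξ : ℝ) : ℂ))

theorem norm_freePhase (s : E → ℝ) (τ : ℝ) (ξ : E) : ‖freePhase s τ ξ‖ = 1 := by
  rw [freePhase, mul_comm]; exact Complex.norm_exp_ofReal_mul_I _

theorem memLp_freePhase {s : E → ℝ} (hs : Measurable s) (τ : ℝ) :
    MemLp (freePhase s τ) ⊤ (volume : Measure E) :=
  memLp_top_of_norm_le (by unfold freePhase; fun_prop) (fun ξ => (norm_freePhase s τ ξ).le)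

/-- The Fourier multiplier `exp(iτ s)`. -/
def freeOp (s : E → ℝ) (τ : ℝ) (f : Lp ℂ 2 (volume : Measure E)) : Lp ℂ 2 (volume : Measure E) :=
  𝓕⁻ (mulOp volume (freePhase s τ) (𝓕 f : Lp ℂ 2 (volume : Measure E)))

theorem fourier_freeOp (s : E → ℝ) (τ : ℝ) (f : Lp ℂ 2 (volume : Measure E)) :
    𝓕 (freeOp s τ f) = mulOp volume (freePhase s τ) (𝓕 f : Lp ℂ 2 (volume : Measure E)) :=
  fourier_fourierInv_eq _

theorem fourier_injective {f g : Lp ℂ 2 (volume : Measure E)}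
    (h : (𝓕 f : Lp ℂ 2 (volume : Measure E)) = 𝓕 g) : f = g :=
  (Lp.fourierTransformₗᵢ E ℂ).injective h

theorem fourier_sub' (f g : Lp ℂ 2 (volume : Measure E)) :
    (𝓕 (f - g) : Lp ℂ 2 (volume : Measure E)) = 𝓕 f - 𝓕 g :=
  (Lp.fourierTransformₗᵢ E ℂ).map_sub f g

theorem freeOp_add (s : E → ℝ) (τ : ℝ) (f g : Lp ℂ 2 (volume : Measure E)) :
    freeOp s τ (f + g) = freeOp s τ f + freeOp s τ g := by
  refine fourier_injective ?_
  rw [fourier_freeOp, FourierTransform.fourier_add, FourierTransform.fourier_add, fourier_freeOp,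
    fourier_freeOp, map_add]

theorem freeOp_smul (s : E → ℝ) (τ : ℝ) (c : ℂ) (f : Lp ℂ 2 (volume : Measure E)) :
    freeOp s τ (c • f) = c • freeOp s τ f := by
  refine fourier_injective ?_
  rw [fourier_freeOp, FourierTransform.fourier_smul, FourierTransform.fourier_smul, fourier_freeOp,
    map_smul]

theorem freeOp_sub (s : E → ℝ) (τ : ℝ) (f g : Lp ℂ 2 (volume : Measure E)) :
    freeOp s τ (f - g) = freeOp s τ f - freeOp s τ g := by
  refine fourier_injective ?_
  rw [fourier_freeOp, fourier_sub', fourier_sub', fourier_freeOp, fourier_freeOp, map_sub]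

theorem norm_freeOp {s : E → ℝ} (hs : Measurable s) (τ : ℝ) (f : Lp ℂ 2 (volume : Measure E)) :
    ‖freeOp s τ f‖ = ‖f‖ := by
  rw [← Lp.norm_fourier_eq (freeOp s τ f), fourier_freeOp, norm_mulOp_apply (memLp_freePhase hs τ)
    (Eventually.of_forall (norm_freePhase s τ)), Lp.norm_fourier_eq]

theorem inner_freeOp {s : E → ℝ} (hs : Measurable s) (τ : ℝ)
    (f g : Lp ℂ 2 (volume : Measure E)) :
    inner ℂ (freeOp s τ f) (freeOp s τ g) = inner ℂ f g := by
  let V : Lp ℂ 2 (volume : Measure E) →ₗᵢ[ℂ] Lp ℂ 2 (volume : Measure E) :=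
    ⟨⟨⟨freeOp s τ, freeOp_add s τ⟩, freeOp_smul s τ⟩, norm_freeOp hs τ⟩
  exact V.inner_map_map f g

theorem tendsto_freeOp {s : E → ℝ} (hs : Measurable s) (τ : ℝ)
    (f : Lp ℂ 2 (volume : Measure E)) :
    Tendsto (fun h : ℝ => freeOp s (τ + h) f) (𝓝 0) (𝓝 (freeOp s τ f)) := by
  rw [tendsto_iff_norm_sub_tendsto_zero]
  have h1 : ∀ h : ℝ, ‖freeOp s (τ + h) f - freeOp s τ f‖ =
      ‖mulOp volume (fun ξ => freePhase s (τ + h) ξ - freePhase s τ ξ)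
        (𝓕 f : Lp ℂ 2 (volume : Measure E))‖ := fun h => by
    rw [← Lp.norm_fourier_eq, fourier_sub', fourier_freeOp, fourier_freeOp,
      ← sub_apply, mulOp_sub (memLp_freePhase hs _) (memLp_freePhase hs _)]
  simp_rw [h1]
  rw [← tendsto_zero_iff_norm_tendsto_zero]
  refine tendsto_mulOp_zero (C := 2) (fun h => ?_) (fun h ξ => ?_) (fun ξ => ?_) _
  · exact (memLp_freePhase hs _).1.sub (memLp_freePhase hs _).1
  · refine (norm_sub_le _ _).trans ?_
    rw [norm_freePhase, norm_freePhase]; norm_num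
  · have hc : Continuous fun h : ℝ => freePhase s (τ + h) ξ - freePhase s τ ξ := by
      unfold freePhase; fun_prop
    simpa using hc.tendsto 0

theorem tendsto_freeOp_slope {s : E → ℝ} (hs : Measurable s) (τ : ℝ)
    {f κ : Lp ℂ 2 (volume : Measure E)} (hκ : FourierMul s f κ) :
    Tendsto (fun h : ℝ => h⁻¹ • (freeOp s (τ + h) f - freeOp s τ f)) (𝓝[≠] 0)
      (𝓝 (freeOp s τ (Complex.I • κ))) := by
  rw [tendsto_iff_norm_sub_tendsto_zero]
  -- The remainder multiplier is divided by `h s(ξ)` so that it acts on `κ̂ = s f̂`; this makes it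
  -- bounded by `2` even for unbounded `s`. Where `s(ξ) = 0` the quotient is `0` by convention,
  -- which is harmless because `κ̂` vanishes there.
  let m : ℝ → E → ℂ := fun h ξ => freePhase s τ ξ *
    ((Complex.exp (Complex.I * ((h * s ξ : ℝ) : ℂ)) - 1 - Complex.I * ((h * s ξ : ℝ) : ℂ)) /
      ((h * s ξ : ℝ) : ℂ))
  have hmm : ∀ h, AEStronglyMeasurable (m h) (volume : Measure E) := fun h => by
    refine Measurable.aestronglyMeasurable ?_
    dsimp only [m]; unfold freePhase; fun_prop
  have hmb : ∀ h ξ, ‖m h ξ‖ ≤ 2 := fun h ξ => by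
    simp only [m, norm_mul, norm_freePhase, one_mul, norm_div]
    refine div_le_of_le_mul₀ (norm_nonneg _) (by norm_num) ?_
    refine (norm_sub_le _ _).trans ?_
    have := norm_exp_I_sub_one_le (h * s ξ)
    simp only [norm_mul, Complex.norm_I, one_mul, Complex.norm_real, Real.norm_eq_abs,
      abs_mul] at this ⊢
    linarith
  have hm0 : ∀ ξ, Tendsto (fun h => m h ξ) (𝓝[≠] 0) (𝓝 0) := fun ξ => by
    have hb : ∀ᶠ h in 𝓝[≠] (0 : ℝ), ‖m h ξ‖ ≤ |h * s ξ| := by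
      have hc : Continuous fun h : ℝ => |h * s ξ| := by fun_prop
      have : ∀ᶠ h in 𝓝 (0 : ℝ), |h * s ξ| < 1 :=
        (hc.tendsto 0).eventually_lt_const (by simp)
      filter_upwards [mem_nhdsWithin_of_mem_nhds this] with h hh
      simp only [m, norm_mul, norm_freePhase, one_mul, norm_div]
      have h1 := Complex.norm_exp_sub_one_sub_id_le (x := Complex.I * ((h * s ξ : ℝ) : ℂ)) (by
        rw [norm_mul, Complex.norm_I, one_mul, Complex.norm_real]; exact hh.le)
      rw [norm_mul, Complex.norm_I, one_mul, Complex.norm_real, Real.norm_eq_abs] at h1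
      rw [Complex.norm_real, Real.norm_eq_abs]
      refine div_le_of_le_mul₀ (abs_nonneg _) (abs_nonneg _) ?_
      rw [← sq]; exact h1
    refine squeeze_zero_norm' hb ?_
    have hc : Continuous fun h : ℝ => |h * s ξ| := by fun_prop
    simpa using (hc.tendsto 0).mono_left nhdsWithin_le_nhds
  have key := (tendsto_mulOp_zero hmm hmb hm0 (𝓕 κ : Lp ℂ 2 (volume : Measure E))).norm
  rw [norm_zero] at key
  refine key.congr' ?_
  filter_upwards [self_mem_nhdsWithin] with h hh
  have hh : h ≠ 0 := hh
  rw [real_smul_Lp, ← Lp.norm_fourier_eq (_ - _), fourier_sub', FourierTransform.fourier_smul, fourier_sub',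
    fourier_freeOp, fourier_freeOp, fourier_freeOp, FourierTransform.fourier_smul]
  set fh : Lp ℂ 2 (volume : Measure E) := 𝓕 f
  set kh : Lp ℂ 2 (volume : Measure E) := 𝓕 κ
  congr 1
  refine Lp.ext ?_
  filter_upwards [mulOp_coe (memLp_top_of_norm_le (hmm h) (hmb h)) kh, hκ,
    mulOp_coe (memLp_freePhase hs (τ + h)) fh, mulOp_coe (memLp_freePhase hs τ) fh,
    mulOp_coe (memLp_freePhase hs τ) (Complex.I • kh), Lp.coeFn_smul Complex.I kh,
    Lp.coeFn_sub (((h⁻¹ : ℝ) : ℂ) • (mulOp volume (freePhase s (τ + h)) fh -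
      mulOp volume (freePhase s τ) fh)) (mulOp volume (freePhase s τ) (Complex.I • kh)),
    Lp.coeFn_smul ((h⁻¹ : ℝ) : ℂ) (mulOp volume (freePhase s (τ + h)) fh -
      mulOp volume (freePhase s τ) fh),
    Lp.coeFn_sub (mulOp volume (freePhase s (τ + h)) fh) (mulOp volume (freePhase s τ) fh)]
    with ξ h1 h2 h3 h4 h5 h6 h7 h8 h9
  rw [h1, h7, Pi.sub_apply, h8, Pi.smul_apply, h9, Pi.sub_apply, h3, h4, h5, h6, Pi.smul_apply, h2]
  have hph : freePhase s (τ + h) ξ = freePhase s τ ξ *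
      Complex.exp (Complex.I * ((h * s ξ : ℝ) : ℂ)) := by
    unfold freePhase
    rw [← Complex.exp_add]; congr 1; push_cast; ring
  rw [hph]
  simp only [m, smul_eq_mul]
  rcases eq_or_ne (s ξ) 0 with h0 | h0
  · simp [h0]
  · have hc : (h : ℂ) ≠ 0 := by exact_mod_cast hh
    have hsc : (s ξ : ℂ) ≠ 0 := by exact_mod_cast h0
    push_cast
    field_simp
    ring

/-- Differentiation in the interaction picture. -/
theorem hasDerivAt_freeOp {s : E → ℝ} (hs : Measurable s) (t₀ t : ℝ)
    {u : ℝ → Lp ℂ 2 (volume : Measure E)} {u' κ : Lp ℂ 2 (volume : Measure E)}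
    (hu : HasDerivAt u u' t) (hκ : FourierMul s (u t) κ) :
    HasDerivAt (fun r => freeOp s (r - t₀) (u r)) (freeOp s (t - t₀) (u' + Complex.I • κ)) t := by
  rw [hasDerivAt_iff_tendsto_slope_zero] at hu ⊢
  have h1 := tendsto_freeOp_slope hs (t - t₀) hκ
  -- The slope splits into the slope of `u`, transported by the isometries at time `t + h`, and the
  -- slope of the free evolution at the fixed vector `u t`. Only the second needs `u t` in the
  -- domain.
  have h2 : Tendsto (fun h : ℝ => freeOp s (t - t₀ + h) (h⁻¹ • (u (t + h) - u t))) (𝓝[≠] 0)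
      (𝓝 (freeOp s (t - t₀) u')) := by
    have h3 := (tendsto_freeOp hs (t - t₀) u').mono_left (nhdsWithin_le_nhds (s := {0}ᶜ))
    have h4 : Tendsto (fun h : ℝ => freeOp s (t - t₀ + h) (h⁻¹ • (u (t + h) - u t) - u')) (𝓝[≠] 0)
        (𝓝 0) := by
      rw [tendsto_zero_iff_norm_tendsto_zero]
      simp_rw [norm_freeOp hs]
      exact tendsto_iff_norm_sub_tendsto_zero.1 hu
    have h5 := h4.add h3
    rw [zero_add] at h5
    refine h5.congr fun h => ?_
    rw [← freeOp_add, sub_add_cancel]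
  have h6 := h2.add h1
  rw [← freeOp_add] at h6
  refine h6.congr fun h => ?_
  rw [real_smul_Lp, real_smul_Lp, real_smul_Lp, freeOp_smul, freeOp_sub, ← smul_add, sub_add_sub_cancel]
  congr 3
  ring_nf

end Free

/-! ### Finite differences -/

section Differences

/-- The iterated forward differences of `u` up to order `m` are of size `A h^i`. -/
def DiffBound {F : Type*} [SeminormedAddCommGroup F] (m : ℕ) (A h : ℝ) (u : ℕ → F) : Prop :=
  ∀ i r, i + r ≤ m → ‖(fwdDiff 1)^[i] u r‖ ≤ A * h ^ i

variable {F G H : Type*} [SeminormedAddCommGroup F] [SeminormedAddCommGroup G]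
  [SeminormedAddCommGroup H]

theorem DiffBound.fwdDiff {m : ℕ} {A h : ℝ} {u : ℕ → F} (hu : DiffBound (m + 1) A h u) :
    DiffBound m (A * h) h (_root_.fwdDiff 1 u) := fun i r hir => by
  have := hu (i + 1) r (by omega)
  rwa [Function.iterate_succ_apply, pow_succ', ← mul_assoc] at this

theorem DiffBound.shift {m : ℕ} {A h : ℝ} {u : ℕ → F} (hu : DiffBound (m + 1) A h u) :
    DiffBound m A h (fun r => u (r + 1)) := fun i r hir => by
  rw [fwdDiff_iter_comp_add]
  exact hu i (r + 1) (by omega)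

theorem DiffBound.mono {m m' : ℕ} {A h : ℝ} {u : ℕ → F} (hu : DiffBound m A h u) (hm : m' ≤ m) :
    DiffBound m' A h u := fun i r hir => hu i r (hir.trans hm)

/-- Discrete Leibniz rule `Δ B(u,v) = B(Δu, v(· + 1)) + B(u, Δv)`. Each differencing doubles the
number of terms, hence `2^i`. -/
theorem DiffBound.bilin (B : F →+ G →+ H) (hB : ∀ x y, ‖B x y‖ ≤ ‖x‖ * ‖y‖) (i : ℕ) :
    ∀ {m : ℕ} {A A' h : ℝ} {u : ℕ → F} {v : ℕ → G}, DiffBound m A h u → DiffBound m A' h v →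
      ∀ r, i + r ≤ m → ‖(_root_.fwdDiff 1)^[i] (fun r => B (u r) (v r)) r‖ ≤ 2 ^ i * (A * A') * h ^ i := by
  induction i with
  | zero =>
    intro m A A' h u v hu hv r hr
    have h1 := hu 0 r hr
    have h2 := hv 0 r hr
    simp only [Function.iterate_zero, id, pow_zero, mul_one, one_mul] at h1 h2 ⊢
    exact (hB _ _).trans (mul_le_mul h1 h2 (norm_nonneg _) ((norm_nonneg _).trans h1))
  | succ i ih =>
    intro m A A' h u v hu hv r hr
    obtain ⟨m, rfl⟩ : ∃ k, m = k + 1 := ⟨m - 1, by omega⟩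
    have e : _root_.fwdDiff 1 (fun r => B (u r) (v r)) =
        (fun r => B (_root_.fwdDiff 1 u r) (v (r + 1))) + fun r => B (u r) (_root_.fwdDiff 1 v r) := by
      ext r
      simp only [_root_.fwdDiff, Pi.add_apply, map_sub, AddMonoidHom.sub_apply]
      abel
    rw [Function.iterate_succ_apply, e, fwdDiff_iter_add, Pi.add_apply]
    refine (norm_add_le _ _).trans ?_
    have h1 := ih hu.fwdDiff hv.shift r (by omega)
    have h2 := ih (hu.mono (Nat.le_succ m)) hv.fwdDiff r (by omega)
    calc _ ≤ _ := add_le_add h1 h2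
      _ = _ := by ring

theorem hasDerivAt_fwdDiff_iter {V : Type*} [NormedAddCommGroup V] [NormedSpace ℝ V] (h : ℝ)
    {f f' : ℝ → V} (hf : ∀ x, HasDerivAt f (f' x) x) (m : ℕ) :
    ∀ x, HasDerivAt ((_root_.fwdDiff h)^[m] f) ((_root_.fwdDiff h)^[m] f' x) x := by
  induction m generalizing f f' with
  | zero => exact hf
  | succ m ih =>
    simp only [Function.iterate_succ_apply]
    refine ih fun x => ?_
    have := (hf (x + h)).comp_add_const x h
    exact this.sub (hf x)

/-- The mean value theorem applied `m` times. All points visited stay within `m|h|` of `x`, so a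
derivative bound on `|y| ≤ R` suffices. -/
theorem norm_fwdDiff_iter_le {V : Type*} [NormedAddCommGroup V] [NormedSpace ℝ V] (m : ℕ) :
    ∀ {f : ℝ → V} (_ : ContDiff ℝ ((⊤ : ℕ∞) : WithTop ℕ∞) f) {C R : ℝ} (h : ℝ)
      (_ : ∀ y, |y| ≤ R → ‖iteratedDeriv m f y‖ ≤ C) (x : ℝ) (_ : |x| + m * |h| ≤ R),
      ‖(_root_.fwdDiff h)^[m] f x‖ ≤ C * |h| ^ m := by
  induction m with
  | zero =>
    intro f _ C R h hC x hx
    simpa using hC x (by simpa using hx)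
  | succ m ih =>
    intro f hf C R h hC x hx
    have hfd : ∀ x, HasDerivAt f (deriv f x) x := fun x =>
      (hf.differentiable (by simp) x).hasDerivAt
    have hf' : ContDiff ℝ ((⊤ : ℕ∞) : WithTop ℕ∞) (deriv f) := by
      have := (contDiff_infty_iff_deriv).1 hf
      exact this.2
    rw [Function.iterate_succ_apply']
    have key := Convex.norm_image_sub_le_of_norm_hasDerivWithin_le
      (f := (_root_.fwdDiff h)^[m] f) (f' := (_root_.fwdDiff h)^[m] (deriv f))
      (s := Set.uIcc x (x + h)) (C := C * |h| ^ m) (x := x) (y := x + h)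
      (fun y _ => (hasDerivAt_fwdDiff_iter h hfd m y).hasDerivWithinAt)
      (fun y hy => ih hf' h (R := R) (fun z hz => by
        rw [← iteratedDeriv_succ']; exact hC z hz) y (by
          have h1 : |y - x| ≤ |x + h - x| := Set.abs_sub_left_of_mem_uIcc hy
          have h2 : |y| ≤ |y - x| + |x| := by simpa using abs_add_le (y - x) x
          rw [add_sub_cancel_left] at h1
          push_cast at hx
          linarith)) (convex_uIcc _ _) Set.left_mem_uIcc Set.right_mem_uIcc
    rw [add_sub_cancel_left, Real.norm_eq_abs] at key
    rw [pow_succ, ← mul_assoc]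
    exact key

theorem fwdDiff_iter_affine {V : Type*} [AddCommGroup V] (f : ℝ → V) (x h : ℝ) (i : ℕ) :
    ∀ r : ℕ, (_root_.fwdDiff 1)^[i] (fun r : ℕ => f (x + r * h)) r =
      (_root_.fwdDiff h)^[i] f (x + r * h) := by
  induction i with
  | zero => intro r; rfl
  | succ i ih =>
    intro r
    rw [Function.iterate_succ_apply', Function.iterate_succ_apply']
    simp only [_root_.fwdDiff, ih]
    push_cast
    congr 2
    ring_nf

/-- This phase is the Weyl cocycle that appears when `W(xp, xq)` is split into a multiplication and
a translation, with `x = (r - k)h`. It is a fixed smooth function sampled with spacing `h`. -/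
theorem exists_diffBound_quadraticPhase (c : ℝ) (k : ℕ) : ∃ C : ℝ, 0 ≤ C ∧ ∀ h : ℝ, |h| ≤ 1 →
    DiffBound (2 * k) C |h| (fun r : ℕ =>
      Complex.exp (Complex.I * ((c * (((r : ℝ) - k) * h) ^ 2 : ℝ) : ℂ))) := by
  let f : ℝ → ℂ := fun x => Complex.exp (Complex.I * ((c * x ^ 2 : ℝ) : ℂ))
  have hf : ContDiff ℝ ((⊤ : ℕ∞) : WithTop ℕ∞) f := by
    have h1 : ContDiff ℝ ((⊤ : ℕ∞) : WithTop ℕ∞) (fun x : ℝ => ((c * x ^ 2 : ℝ) : ℂ)) :=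
      Complex.ofRealCLM.contDiff.comp (contDiff_const.mul (contDiff_id.pow 2))
    exact (contDiff_const.mul h1).cexp
  -- The radius `5k` is the sum of `k` for the offset `-kh`, `2k` for `r|h|` and `2k` for the `i`
  -- steps of differencing.
  have hb : ∀ i : ℕ, ∃ C : ℝ, 0 ≤ C ∧ ∀ y, |y| ≤ (5 * k : ℝ) → ‖iteratedDeriv i f y‖ ≤ C := by
    intro i
    have hc : Continuous (iteratedDeriv i f) := hf.continuous_iteratedDeriv i (by exact_mod_cast le_top)
    obtain ⟨C, hC⟩ := (isCompact_Icc (a := -(5 * k : ℝ)) (b := 5 * k)).exists_bound_of_continuousOn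
      hc.continuousOn
    exact ⟨max C 0, le_max_right _ _, fun y hy => (hC y (abs_le.1 hy)).trans (le_max_left _ _)⟩
  choose C hC0 hC using hb
  refine ⟨∑ i ∈ Finset.range (2 * k + 1), C i, Finset.sum_nonneg fun i _ => hC0 i,
    fun h hh i r hir => ?_⟩
  have e : (fun r : ℕ => Complex.exp (Complex.I * ((c * (((r : ℝ) - k) * h) ^ 2 : ℝ) : ℂ))) =
      fun r : ℕ => f (-(k * h) + r * h) := by
    ext r; simp only [f]; congr 3; ring_nf
  rw [e, fwdDiff_iter_affine]
  have hi : (i : ℝ) ≤ 2 * k := by exact_mod_cast (by omega : i ≤ 2 * k)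
  have hr : (r : ℝ) ≤ 2 * k := by exact_mod_cast (by omega : r ≤ 2 * k)
  have h0 := abs_nonneg h
  have hi0 : (0 : ℝ) ≤ i := by positivity
  have hr0 : (0 : ℝ) ≤ r := by positivity
  have hk0 : (0 : ℝ) ≤ k := by positivity
  refine (norm_fwdDiff_iter_le i hf h (hC i) _ ?_).trans ?_
  · have h1 : |-(k * h) + r * h| ≤ k * |h| + r * |h| := by
      refine (abs_add_le _ _).trans ?_
      rw [abs_neg, abs_mul, abs_mul, abs_of_nonneg hk0, abs_of_nonneg hr0]
    have h2 : k * |h| ≤ (k : ℝ) := mul_le_of_le_one_right hk0 hh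
    have h3 : r * |h| ≤ (r : ℝ) := mul_le_of_le_one_right hr0 hh
    have h4 : i * |h| ≤ (i : ℝ) := mul_le_of_le_one_right hi0 hh
    linarith
  · gcongr
    exact Finset.single_le_sum (f := C) (fun i _ => hC0 i) (Finset.mem_range.2 (by omega))

end Differences

/-! ### Difference bounds for Weyl operators -/

section WeylDifferences

variable {E : Type*} [NormedAddCommGroup E] [InnerProductSpace ℝ E] [FiniteDimensional ℝ E]
  [MeasurableSpace E] [BorelSpace E]

theorem fwdDiff_iter_orbit (G : ℕ → Lp ℂ 2 (volume : Measure E) →L[ℂ] Lp ℂ 2 (volume : Measure E))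
    (V : Lp ℂ 2 (volume : Measure E) →L[ℂ] Lp ℂ 2 (volume : Measure E))
    (hG : ∀ r, G (r + 1) = G r * V) (f : Lp ℂ 2 (volume : Measure E)) (i : ℕ) :
    ∀ r, (fwdDiff 1)^[i] (fun r => G r f) r = G r (((V - 1) ^ i) f) := by
  induction i with
  | zero => intro r; rfl
  | succ i ih =>
    intro r
    rw [Function.iterate_succ_apply']
    simp only [fwdDiff, ih]
    rw [hG, mul_apply_eq_comp, ← map_sub, pow_succ', mul_apply_eq_comp]
    rfl

theorem weyl_mul_weyl_line (p q : E) (x y : ℝ) :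
    weyl (x • p) (x • q) * weyl (y • p) (y • q) = weyl ((x + y) • p) ((x + y) • q) := by
  ext1 f
  rw [mul_apply_eq_comp, weyl_weyl, add_smul, add_smul]
  have : (inner ℝ (y • q) (x • p) - inner ℝ (x • q) (y • p)) / 2 = 0 := by
    simp only [inner_smul_left, inner_smul_right]
    simp
    ring
  rw [this]
  simp

theorem inner_weyl_sub_one_pow (p q : E) (k : ℕ) : ∀ f g : Lp ℂ 2 (volume : Measure E),
    inner ℂ (((weyl p q - 1) ^ k) f) g = inner ℂ f (((weyl (-p) (-q) - 1) ^ k) g) := by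
  induction k with
  | zero => intro f g; rfl
  | succ k ih =>
    intro f g
    rw [pow_succ, pow_succ', mul_apply_eq_comp, mul_apply_eq_comp, ih, sub_apply, sub_apply,
      inner_sub_left, inner_sub_right, inner_weyl]
    rfl

/-- Difference bounds along two conjugate directions imply difference bounds along all directions
they span. -/
theorem norm_weyl_diff_le {k : ℕ} {C₀ : ℝ} (hC₀ : 0 ≤ C₀) (p q : E)
    (hph : ∀ h : ℝ, |h| ≤ 1 → DiffBound (2 * k) C₀ |h| (fun r : ℕ =>
      Complex.exp (Complex.I * ((inner ℝ q p / 2 * (((r : ℝ) - k) * h) ^ 2 : ℝ) : ℂ))))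
    (f : Lp ℂ 2 (volume : Measure E)) (A : ℝ) (hA : 0 ≤ A)
    (hV : ∀ i ≤ 2 * k, ∀ h : ℝ, |h| ≤ 1 → ‖((weyl 0 (h • q) - 1) ^ i) f‖ ≤ A * |h| ^ i)
    (hT : ∀ i ≤ 2 * k, ∀ h : ℝ, |h| ≤ 1 → ‖((weyl (h • p) 0 - 1) ^ i) f‖ ≤ A * |h| ^ i)
    (h : ℝ) (hh : |h| ≤ 1) :
    ‖((weyl (h • p) (h • q) - 1) ^ k) f‖ ≤
      Real.sqrt (2 ^ (2 * k) * (C₀ * (2 ^ (2 * k)))) * A * |h| ^ k := by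
  set Z := weyl (h • p) (h • q) with hZ
  -- Since `Z* - 1 = -Z⁻¹(Z - 1)`, the square `‖(Z - 1)^k f‖²` equals `±⟨f, Z^(-k) (Z - 1)^(2k) f⟩`.
  -- This is a difference of order `2k` of `r ↦ ⟨f, Z^(r-k) f⟩`, a scalar sequence to which the
  -- Leibniz rule applies.
  have hsq : ‖((Z - 1) ^ k) f‖ ^ 2 ≤ (2 ^ (2 * k) * (C₀ * (2 ^ (2 * k)))) * A ^ 2 * |h| ^ (2 * k) := by
    let G : ℕ → Lp ℂ 2 (volume : Measure E) →L[ℂ] Lp ℂ 2 (volume : Measure E) :=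
      fun r => weyl (((r : ℝ) - k) • (h • p)) (((r : ℝ) - k) • (h • q))
    have hG : ∀ r, G (r + 1) = G r * Z := fun r => by
      simp only [G, hZ]
      have := weyl_mul_weyl_line (h • p) (h • q) ((r : ℝ) - k) 1
      rw [one_smul, one_smul] at this
      rw [this]
      push_cast
      congr 2 <;> ring_nf
    have h1 : ‖((Z - 1) ^ k) f‖ ^ 2 =
        ‖(fwdDiff 1)^[2 * k] (fun r => inner ℂ f (G r f)) 0‖ := by
      have h2 : ∀ i r, (fwdDiff 1)^[i] (fun r => inner ℂ f (G r f)) r =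
          inner ℂ f (G r (((Z - 1) ^ i) f)) := by
        intro i
        induction i with
        | zero => intro r; rfl
        | succ i ih =>
          intro r
          rw [Function.iterate_succ_apply']
          simp only [fwdDiff, ih]
          rw [hG, mul_apply_eq_comp, ← inner_sub_right, ← map_sub, pow_succ', mul_apply_eq_comp]
          rfl
      rw [h2]
      have h3 : ∀ j : ℕ, ∀ g, ((weyl (-(h • p)) (-(h • q)) - 1) ^ j) g =
          ((-1 : ℂ) ^ j) • (weyl ((-(j : ℝ)) • (h • p)) ((-(j : ℝ)) • (h • q))) (((Z - 1) ^ j) g) := by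
        intro j
        induction j with
        | zero => intro g; simp [weyl_zero_zero]
        | succ j ih =>
          intro g
          have h4 : ∀ g, (weyl (-(h • p)) (-(h • q)) - 1) g =
              (-1 : ℂ) • weyl (-(h • p)) (-(h • q)) ((Z - 1) g) := by
            intro g
            rw [sub_apply, sub_apply, map_sub, hZ]
            have := weyl_mul_weyl_line (h • p) (h • q) (-1) 1
            simp only [one_smul, neg_smul, neg_add_cancel, zero_smul, weyl_zero_zero] at this
            rw [← mul_apply_eq_comp, this]
            simp
          have hcomm : Commute (weyl (-(h • p)) (-(h • q)) - 1) ((Z - 1) ^ j) := by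
            have h5 : Commute (weyl (-(h • p)) (-(h • q))) Z := by
              have a1 := weyl_mul_weyl_line (h • p) (h • q) (-1) 1
              have a2 := weyl_mul_weyl_line (h • p) (h • q) 1 (-1)
              simp only [one_smul, neg_smul] at a1 a2
              rw [hZ, Commute, SemiconjBy, a1, a2]
              norm_num
            exact ((h5.sub_left (Commute.one_left _)).sub_right (Commute.one_right _)).pow_right j
          rw [pow_succ, mul_apply_eq_comp, ih, ← mul_apply_eq_comp ((Z - 1) ^ j), ← hcomm.eq,
            mul_apply_eq_comp, h4, map_smul, smul_smul, ← pow_succ, ← mul_apply_eq_comp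
              (weyl ((-(j : ℝ)) • (h • p)) ((-(j : ℝ)) • (h • q))), pow_succ' (Z - 1)]
          congr 1
          have h6 := weyl_mul_weyl_line (h • p) (h • q) (-(j : ℝ)) (-1)
          rw [neg_one_smul, neg_one_smul] at h6
          rw [h6, mul_apply_eq_comp]
          push_cast
          rw [neg_add]
      have h7 : inner ℂ (((Z - 1) ^ k) f) (((Z - 1) ^ k) f) =
          (-1 : ℂ) ^ k * inner ℂ f (G 0 (((Z - 1) ^ (2 * k)) f)) := by
        rw [hZ, inner_weyl_sub_one_pow, h3, inner_smul_right, ← mul_apply_eq_comp ((Z - 1) ^ k),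
          ← pow_add, ← two_mul]
        simp [G, hZ]
      have h8 := congrArg norm (inner_self_eq_norm_sq_to_K (𝕜 := ℂ) (((Z - 1) ^ k) f))
      rw [h7, norm_mul, norm_pow, norm_neg, norm_one, one_pow, one_mul] at h8
      rw [h8]
      simp
    -- `Z^(r-k)` is a quadratic phase times a multiplication times a translation. The multiplication
    -- is moved to the left entry of the inner product; taking the adjoint reverses its sign, hence
    -- `-h`.
    have h9 : (fun r => inner ℂ f (G r f)) = fun r : ℕ =>
        Complex.exp (Complex.I * ((inner ℝ q p / 2 * (((r : ℝ) - k) * h) ^ 2 : ℝ) : ℂ)) *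
        inner ℂ (weyl 0 (((r : ℝ) - k) • ((-h) • q)) f) (weyl (((r : ℝ) - k) • (h • p)) 0 f) := by
      ext r
      rw [inner_weyl, weyl_weyl, inner_smul_right, ← mul_assoc, ← Complex.exp_add]
      have e1 : (-(0 : E)) + ((r : ℝ) - k) • (h • p) = ((r : ℝ) - k) • (h • p) := by simp
      have e2 : -(((r : ℝ) - k) • ((-h) • q)) + 0 = ((r : ℝ) - k) • (h • q) := by simp
      rw [e1, e2]
      have e3 : Complex.I * ((inner ℝ q p / 2 * (((r : ℝ) - k) * h) ^ 2 : ℝ) : ℂ) +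
          Complex.I * (((inner ℝ (0 : E) (-(0 : E)) - inner ℝ (-(((r : ℝ) - k) • ((-h) • q)))
            (((r : ℝ) - k) • (h • p))) / 2 : ℝ) : ℂ) = 0 := by
        rw [← mul_add, ← Complex.ofReal_add]
        simp only [inner_neg_left, inner_smul_left, inner_smul_right, inner_zero_left]
        simp
        ring
      rw [e3]
      simp [G]
    have bV : DiffBound (2 * k) A |h| (fun r : ℕ => weyl 0 (((r : ℝ) - k) • ((-h) • q)) f) := by
      intro i r hir
      rw [fwdDiff_iter_orbit (fun r : ℕ => weyl 0 (((r : ℝ) - k) • ((-h) • q))) (weyl 0 ((-h) • q))]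
      · rw [norm_weyl]
        simpa using hV i (by omega) (-h) (by simpa using hh)
      · intro r
        have := weyl_mul_weyl_line (0 : E) ((-h) • q) ((r : ℝ) - k) 1
        simp only [smul_zero, one_smul] at this
        simp only [this]
        push_cast
        congr 2; ring_nf
    have bT : DiffBound (2 * k) A |h| (fun r : ℕ => weyl (((r : ℝ) - k) • (h • p)) 0 f) := by
      intro i r hir
      rw [fwdDiff_iter_orbit (fun r : ℕ => weyl (((r : ℝ) - k) • (h • p)) 0) (weyl (h • p) 0)]
      · rw [norm_weyl]
        exact hT i (by omega) h hh
      · intro r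
        have := weyl_mul_weyl_line (h • p) (0 : E) ((r : ℝ) - k) 1
        simp only [smul_zero, one_smul] at this
        simp only [this]
        push_cast
        congr 2; ring_nf
    let B₁ : Lp ℂ 2 (volume : Measure E) →+ Lp ℂ 2 (volume : Measure E) →+ ℂ :=
      AddMonoidHom.mk' (fun x => AddMonoidHom.mk' (fun y => inner ℂ x y) fun y y' =>
        inner_add_right x y y') fun x x' => by ext y; exact inner_add_left x x' y
    have hI : DiffBound (2 * k) (2 ^ (2 * k) * (A * A)) |h| (fun r : ℕ =>
        inner ℂ (weyl 0 (((r : ℝ) - k) • ((-h) • q)) f) (weyl (((r : ℝ) - k) • (h • p)) 0 f)) := by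
      intro i r hir
      refine (DiffBound.bilin B₁ (fun x y => norm_inner_le_norm x y) i bV bT r hir).trans ?_
      gcongr
      · norm_num
      · omega
    -- Second use of the Leibniz rule, for the phase against the inner product. The two uses account
    -- for the two factors `2^(2k)` under the root.
    have hfin := DiffBound.bilin (AddMonoidHom.mul (R := ℂ)) (fun x y => (norm_mul x y).le) (2 * k)
      (hph h hh) hI 0 (by omega)
    rw [h1, h9]
    refine hfin.trans (le_of_eq ?_)
    ring
  have h10 := Real.sqrt_le_sqrt hsq
  rw [Real.sqrt_sq (norm_nonneg _)] at h10
  refine h10.trans (le_of_eq ?_)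
  rw [mul_assoc, Real.sqrt_mul (by positivity), mul_assoc]
  congr 1
  rw [mul_comm 2 k, pow_mul, ← mul_pow, Real.sqrt_sq (by positivity)]

end WeylDifferences

variable {m n n' n'' : ℕ}

/-! ### Adding and removing one boson -/

@[simp] theorem tracers_config (X : Tracers m) (x : Fin n → R3) : tracers (config X x) = X := rfl

@[simp] theorem bosons_config (X : Tracers m) (x : Fin n → R3) : bosons (config X x) = x := rfl

@[simp] theorem config_eta (z : Config m n) : config (tracers z) (bosons z) = z := by
  ext ⟨i | i, k⟩ <;> rfl

/-- The configuration with one more boson in the first place. -/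
def join (x : R3) (z : Config m n) : Config m (n + 1) :=
  config (tracers z) (Fin.cons x (bosons z))

/-- The configuration without the first boson. -/
def dropFirst (z : Config m (n + 1)) : Config m n := config (tracers z) (Fin.tail (bosons z))

@[simp] theorem tracers_join (x : R3) (z : Config m n) : tracers (join x z) = tracers z := rfl

@[simp] theorem bosons_join (x : R3) (z : Config m n) :
    bosons (join x z) = Fin.cons x (bosons z) := rfl

@[simp] theorem join_dropFirst (z : Config m (n + 1)) : join (bosons z 0) (dropFirst z) = z := by
  rw [join, dropFirst, tracers_config, bosons_config, Fin.cons_self_tail, config_eta]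

@[simp] theorem dropFirst_join (x : R3) (z : Config m n) : dropFirst (join x z) = z := by
  rw [dropFirst, bosons_join, Fin.tail_cons, tracers_join, config_eta]

theorem config_cons (X : Tracers m) (x : R3) (xs : Fin n → R3) :
    config X (Fin.cons x xs) = join x (config X xs) := rfl

theorem join_apply_inl (x : R3) (z : Config m n) (l : Fin m) (k : Fin 3) :
    join x z (Sum.inl l, k) = z (Sum.inl l, k) := rfl

theorem join_apply_zero (x : R3) (z : Config m n) (k : Fin 3) :
    join x z (Sum.inr 0, k) = x k := rfl

theorem join_apply_succ (x : R3) (z : Config m n) (i : Fin n) (k : Fin 3) :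
    join x z (Sum.inr i.succ, k) = z (Sum.inr i, k) := rfl

theorem join_add (x y : R3) (z z' : Config m n) : join (x + y) (z + z') = join x z + join y z' := by
  ext ⟨i | i, k⟩
  · rfl
  · refine Fin.cases ?_ (fun i => ?_) i <;> rfl

theorem join_smul (c : ℝ) (x : R3) (z : Config m n) : join (c • x) (c • z) = c • join x z := by
  ext ⟨i | i, k⟩
  · rfl
  · refine Fin.cases ?_ (fun i => ?_) i <;> rfl

theorem norm_sq_join (x : R3) (z : Config m n) : ‖join x z‖ ^ 2 = ‖x‖ ^ 2 + ‖z‖ ^ 2 := by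
  rw [EuclideanSpace.norm_sq_eq, EuclideanSpace.norm_sq_eq, EuclideanSpace.norm_sq_eq]
  simp only [Fintype.sum_prod_type, Fintype.sum_sum_type, Fin.sum_univ_succ (n := n),
    join_apply_inl, join_apply_zero, join_apply_succ]
  ring

/-- Adding a boson, as an isometry. -/
def joinIsom (m n : ℕ) : WithLp 2 (R3 × Config m n) ≃ₗᵢ[ℝ] Config m (n + 1) where
  toFun y := join y.fst y.snd
  invFun z := WithLp.toLp 2 (bosons z 0, dropFirst z)
  left_inv y := by
    apply (WithLp.ofLp_injective 2)
    exact Prod.ext rfl (dropFirst_join _ _)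
  right_inv z := join_dropFirst z
  map_add' y y' := join_add _ _ _ _
  map_smul' c y := join_smul _ _ _
  norm_map' y := by
    have h := norm_sq_join y.fst y.snd
    have h2 := WithLp.prod_norm_sq_eq_of_L2 y
    rw [← h2] at h
    exact (sq_eq_sq₀ (norm_nonneg _) (norm_nonneg _)).1 h

theorem measurePreserving_join :
    MeasurePreserving (fun y : R3 × Config m n => join y.1 y.2) :=
  (joinIsom m n).measurePreserving.comp (WithLp.volume_preserving_toLp R3 (Config m n))

theorem measurePreserving_unjoin :
    MeasurePreserving (fun z : Config m (n + 1) => (bosons z 0, dropFirst z)) :=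
  (WithLp.volume_preserving_ofLp R3 (Config m n)).comp
    (joinIsom m n).symm.measurePreserving

theorem ae_join {P : Config m (n + 1) → Prop} (h : ∀ᵐ z, P z) :
    ∀ᵐ y : R3 × Config m n, P (join y.1 y.2) :=
  measurePreserving_join.quasiMeasurePreserving.ae h

theorem ae_ae_join {P : Config m (n + 1) → Prop} (h : ∀ᵐ z, P z) :
    ∀ᵐ z : Config m n, ∀ᵐ x : R3, P (join x z) := by
  have h1 : ∀ᵐ y : Config m n × R3, P (join y.2 y.1) :=
    (Measure.measurePreserving_swap (μ := (volume : Measure (Config m n)))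
      (ν := (volume : Measure R3))).quasiMeasurePreserving.ae (ae_join h)
  exact Measure.ae_ae_of_ae_prod h1

theorem quasiMeasurePreserving_dropFirst :
    Measure.QuasiMeasurePreserving (dropFirst : Config m (n + 1) → Config m n) :=
  Measure.quasiMeasurePreserving_snd.comp measurePreserving_unjoin.quasiMeasurePreserving

/-- The potential `v` is only essentially bounded, so bounds and measurability of `v(x₀ - x₁)`
require that preimages of null sets under the difference map are null. -/
theorem quasiMeasurePreserving_boson_sub :
    Measure.QuasiMeasurePreserving (fun z : Config m (n + 2) => bosons z 0 - bosons z 1) := by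
  have h1 : Measure.QuasiMeasurePreserving
      (fun z : Config m (n + 2) => (bosons z 0, bosons (dropFirst z) 0)) := by
    have h2 : MeasurePreserving (fun y : R3 × Config m (n + 1) =>
        (y.1, (bosons y.2 0, dropFirst y.2))) :=
      (MeasurePreserving.id volume).prod measurePreserving_unjoin
    have h3 : MeasurePreserving (MeasurableEquiv.prodAssoc : (R3 × R3) × Config m n ≃ᵐ _).symm :=
      (measurePreserving_prodAssoc volume volume volume).symm
    exact Measure.quasiMeasurePreserving_fst.comp
      (h3.comp (h2.comp measurePreserving_unjoin)).quasiMeasurePreserving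
  exact (quasiMeasurePreserving_sub_of_right_invariant volume volume).comp h1

/-! ### Insertion and contraction of a one-particle function -/

theorem eLpNorm_mul_prod {α β : Type*} [MeasurableSpace α] [MeasurableSpace β] {μ : Measure α}
    {ν : Measure β} [SFinite μ] [SFinite ν] {f : α → ℂ} {g : β → ℂ}
    (hf : AEStronglyMeasurable f μ) (hg : AEStronglyMeasurable g ν) :
    eLpNorm (fun y : α × β => f y.1 * g y.2) 2 (μ.prod ν) = eLpNorm f 2 μ * eLpNorm g 2 ν := by
  rw [eLpNorm_eq_lintegral_rpow_enorm_toReal (by norm_num) (by norm_num),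
    eLpNorm_eq_lintegral_rpow_enorm_toReal (by norm_num) (by norm_num),
    eLpNorm_eq_lintegral_rpow_enorm_toReal (by norm_num) (by norm_num),
    ← ENNReal.mul_rpow_of_nonneg _ _ (by positivity)]
  simp_rw [enorm_mul]
  congr 1
  rw [← lintegral_prod_mul (hf.enorm.pow_const _) (hg.enorm.pow_const _)]
  refine lintegral_congr fun y => ?_
  rw [ENNReal.mul_rpow_of_nonneg _ _ (by positivity)]

theorem memLp_mul_prod (φ : L2R3) (f : Sector m n) :
    MemLp (fun y : R3 × Config m n => φ y.1 * f y.2) 2 (volume.prod volume) := by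
  refine ⟨(Lp.aestronglyMeasurable φ).comp_fst.mul (Lp.aestronglyMeasurable f).comp_snd, ?_⟩
  rw [eLpNorm_mul_prod (Lp.aestronglyMeasurable φ) (Lp.aestronglyMeasurable f)]
  exact ENNReal.mul_lt_top (Lp.eLpNorm_lt_top φ) (Lp.eLpNorm_lt_top f)

theorem memLp_insert (φ : L2R3) (f : Sector m n) :
    MemLp (fun z : Config m (n + 1) => φ (bosons z 0) * f (dropFirst z)) 2 volume :=
  (memLp_mul_prod φ f).comp_measurePreserving measurePreserving_unjoin

theorem norm_toLp_insert (φ : L2R3) (f : Sector m n) :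
    ‖(memLp_insert φ f).toLp‖ = ‖φ‖ * ‖f‖ := by
  have h : eLpNorm (fun z : Config m (n + 1) => φ (bosons z 0) * f (dropFirst z)) 2 volume =
      eLpNorm φ 2 volume * eLpNorm f 2 volume :=
    (eLpNorm_comp_measurePreserving (memLp_mul_prod φ f).1 measurePreserving_unjoin).trans
      (eLpNorm_mul_prod (Lp.aestronglyMeasurable φ) (Lp.aestronglyMeasurable f))
  rw [Lp.norm_toLp, h, ENNReal.toReal_mul, Lp.norm_def, Lp.norm_def]

/-- The insertion `F ↦ φ(x₀) F(x₁, …, xₙ)` of a one-particle function. -/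
def insertOp (φ : L2R3) : Sector m n →L[ℂ] Sector m (n + 1) :=
  LinearMap.mkContinuous
    { toFun := fun f => (memLp_insert φ f).toLp
      map_add' := fun f g => by
        rw [← MemLp.toLp_add]
        refine MemLp.toLp_congr _ _ ?_
        filter_upwards [quasiMeasurePreserving_dropFirst.ae (Lp.coeFn_add f g)] with z hz
        simp only [hz, Pi.add_apply, mul_add]
      map_smul' := fun c f => by
        rw [RingHom.id_apply, ← MemLp.toLp_const_smul]
        refine MemLp.toLp_congr _ _ ?_
        filter_upwards [quasiMeasurePreserving_dropFirst.ae (Lp.coeFn_smul c f)] with z hz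
        simp only [hz, Pi.smul_apply, smul_eq_mul]
        ring } ‖φ‖ fun f => (norm_toLp_insert φ f).le

theorem insertOp_coe (φ : L2R3) (f : Sector m n) :
    insertOp φ f =ᵐ[volume] fun z => φ (bosons z 0) * f (dropFirst z) :=
  (memLp_insert φ f).coeFn_toLp

theorem norm_insertOp_le (φ : L2R3) : ‖(insertOp φ : Sector m n →L[ℂ] _)‖ ≤ ‖φ‖ :=
  LinearMap.mkContinuous_norm_le _ (norm_nonneg _) _

/-- The contraction `F ↦ ∫ φ̄(x) F(x, x₁, …, xₙ) dx` with a one-particle function. -/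
def contractOp (φ : L2R3) : Sector m (n + 1) →L[ℂ] Sector m n :=
  ContinuousLinearMap.adjoint (insertOp φ)

theorem norm_contractOp_le (φ : L2R3) : ‖(contractOp φ : Sector m (n + 1) →L[ℂ] _)‖ ≤ ‖φ‖ := by
  rw [contractOp, LinearIsometryEquiv.norm_map]
  exact norm_insertOp_le φ

/-- Adding a boson, as a measurable equivalence. -/
def joinEquiv (m n : ℕ) : R3 × Config m n ≃ᵐ Config m (n + 1) where
  toFun y := join y.1 y.2
  invFun z := (bosons z 0, dropFirst z)
  left_inv _ := Prod.ext rfl (dropFirst_join _ _)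
  right_inv z := join_dropFirst z
  measurable_toFun := measurePreserving_join.measurable
  measurable_invFun := measurePreserving_unjoin.measurable

/-- Defining the contraction as an adjoint gives its norm bound and its covariance by duality. The
integral formula is recovered by Fubini. -/
theorem contractOp_coe (φ : L2R3) (F : Sector m (n + 1)) :
    contractOp φ F =ᵐ[volume] fun z => ∫ x, conj (φ x) * F (join x z) := by
  have hint : ∀ G : Sector m n, Integrable (fun y : R3 × Config m n =>
      conj (φ y.1 * G y.2) * F (join y.1 y.2)) (volume.prod volume) := fun G => by
    have h1 : MemLp (fun y : R3 × Config m n => F (join y.1 y.2)) 2 (volume.prod volume) :=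
      (Lp.memLp F).comp_measurePreserving measurePreserving_join
    exact (memLp_mul_prod φ G).star.integrable_mul h1
  have hinner : ∀ G : Sector m n, inner ℂ G (contractOp φ F) =
      ∫ z, conj (G z) * ∫ x, conj (φ x) * F (join x z) := fun G => by
    rw [contractOp, ContinuousLinearMap.adjoint_inner_right, inner_Lp_eq]
    have h1 := (measurePreserving_join (m := m) (n := n)).integral_comp
      (joinEquiv m n).measurableEmbedding (fun z => conj (insertOp φ G z) * F z)
    rw [← h1]
    have h2 : ∫ y : R3 × Config m n, conj (insertOp φ G (join y.1 y.2)) * F (join y.1 y.2) =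
        ∫ y : R3 × Config m n, conj (φ y.1 * G y.2) * F (join y.1 y.2) := by
      refine integral_congr_ae ?_
      filter_upwards [ae_join (insertOp_coe φ G)] with y hy
      rw [hy, dropFirst_join]
      rfl
    rw [h2]
    refine (integral_prod_symm _ (hint G)).trans ?_
    refine integral_congr_ae (Eventually.of_forall fun z => ?_)
    simp only
    rw [← integral_const_mul]
    refine integral_congr_ae (Eventually.of_forall fun x => ?_)
    simp only [map_mul]
    ring
  -- Testing against indicators of sets of finite measure determines a locally integrable function
  -- almost everywhere.
  have hset : ∀ (s : Set (Config m n)) (hs : MeasurableSet s) (hμ : volume s < ⊤),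
      ∫ z, conj ((indicatorConstLp 2 hs hμ.ne (1 : ℂ)) z) *
        ∫ x, conj (φ x) * F (join x z) = ∫ z in s, ∫ x, conj (φ x) * F (join x z) := by
    intro s hs hμ
    rw [← integral_indicator hs]
    refine integral_congr_ae ?_
    filter_upwards [indicatorConstLp_coeFn (p := 2) (hs := hs) (hμs := hμ.ne) (c := (1 : ℂ))]
      with z hz
    rw [hz]
    by_cases h : z ∈ s <;> simp [h]
  refine ae_eq_of_forall_setIntegral_eq_of_sigmaFinite ?_ ?_ ?_
  · intro s hs hμ
    exact integrableOn_Lp_of_measure_ne_top _ (by norm_num) hμ.ne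
  · intro s hs hμ
    have h1 := (hint (indicatorConstLp 2 hs hμ.ne (1 : ℂ))).integral_prod_right
    rw [← integrable_indicator_iff hs]
    refine h1.congr ?_
    filter_upwards [indicatorConstLp_coeFn (p := 2) (hs := hs) (hμs := hμ.ne) (c := (1 : ℂ))]
      with z hz
    simp only [hz]
    by_cases h : z ∈ s <;> simp [h]
  · intro s hs hμ
    rw [← hset s hs hμ, ← hinner, L2.inner_indicatorConstLp_one]

/-! ### Relabelling of bosons -/

theorem permute_bosons (σ : Equiv.Perm (Fin n)) (z : Config m n) (i : Fin n) :
    bosons (permute σ z) i = bosons z (σ.symm i) := rfl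

theorem permute_tracers (σ : Equiv.Perm (Fin n)) (z : Config m n) :
    tracers (permute σ z) = tracers z := rfl

theorem permute_eq (σ : Equiv.Perm (Fin n)) (z : Config m n) :
    permute σ z = config (tracers z) (bosons z ∘ σ.symm) := by
  rw [← config_eta (permute σ z)]
  rfl

theorem permuteL2_coe (σ : Equiv.Perm (Fin n)) (f : Sector m n) :
    permuteL2 σ f =ᵐ[volume] fun z => f (permute σ z) :=
  Lp.coeFn_compMeasurePreserving f (permute σ).measurePreserving

theorem ae_permute (σ : Equiv.Perm (Fin n)) {P : Config m n → Prop} (h : ∀ᵐ z, P z) :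
    ∀ᵐ z, P (permute σ z) :=
  (permute σ).measurePreserving.quasiMeasurePreserving.ae h

/-- Relabelling of the bosons, as a bounded operator. -/
def permOp (σ : Equiv.Perm (Fin n)) : Sector m n →L[ℂ] Sector m n :=
  (permuteL2 σ).toContinuousLinearMap

theorem norm_permOp_le (σ : Equiv.Perm (Fin n)) :
    ‖(permOp σ : Sector m n →L[ℂ] Sector m n)‖ ≤ 1 :=
  LinearIsometry.norm_toContinuousLinearMap_le _

/-- The relabelling that brings the `i`-th boson to the first place. -/
def bringFirst (i : Fin (n + 1)) (z : Config m (n + 1)) : Config m (n + 1) :=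
  join (bosons z i) (config (tracers z) (i.removeNth (bosons z)))

theorem permute_cycleRange (i : Fin (n + 1)) (z : Config m (n + 1)) :
    permute i.cycleRange z = bringFirst i z := by
  rw [permute_eq, bringFirst, ← config_cons, Fin.cons_removeNth_eq_comp_cycleRange_symm]

/-- The sum over all ways of bringing a boson to the first place. -/
def sumOp (m n : ℕ) : Sector m (n + 1) →L[ℂ] Sector m (n + 1) :=
  ∑ i : Fin (n + 1), permOp i.cycleRange

theorem Lp_coeFn_sum {α ι : Type*} [MeasurableSpace α] {μ : Measure α} (s : Finset ι)
    (f : ι → Lp ℂ 2 μ) : ⇑(∑ i ∈ s, f i) =ᵐ[μ] fun x => ∑ i ∈ s, f i x := by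
  classical
  induction s using Finset.induction_on with
  | empty =>
    filter_upwards [Lp.coeFn_zero ℂ 2 μ] with x hx
    simpa using hx
  | insert i s hi ih =>
    rw [Finset.sum_insert hi]
    filter_upwards [Lp.coeFn_add (f i) (∑ i ∈ s, f i), ih] with x h1 h2
    rw [h1, Pi.add_apply, h2, Finset.sum_insert hi]

theorem sumOp_coe (f : Sector m (n + 1)) :
    sumOp m n f =ᵐ[volume] fun z => ∑ i, f (bringFirst i z) := by
  rw [sumOp, sum_apply]
  have h := eventually_all.2 fun i : Fin (n + 1) => permuteL2_coe i.cycleRange f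
  filter_upwards [Lp_coeFn_sum Finset.univ (fun i : Fin (n + 1) => permOp i.cycleRange f), h]
    with z h1 h2
  rw [h1]
  refine Finset.sum_congr rfl fun i _ => ?_
  rw [← permute_cycleRange]
  exact h2 i

theorem ae_bringFirst {P : Config m (n + 1) → Prop} (h : ∀ᵐ z, P z) :
    ∀ᵐ z, ∀ i, P (bringFirst i z) := by
  refine eventually_all.2 fun i => ?_
  filter_upwards [ae_permute i.cycleRange h] with z hz
  rwa [permute_cycleRange] at hz

/-! ### Weyl operators in one tracer coordinate -/

/-- The unit vector of a tracer coordinate. -/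
def dir (n : ℕ) (j : Fin m × Fin 3) : Config m n := EuclideanSpace.single (Sum.inl j.1, j.2) 1

/-- The Weyl operator `exp(i(b X_j + a P_j))` in one tracer coordinate. -/
def sweyl (n : ℕ) (j : Fin m × Fin 3) (a b : ℝ) : Sector m n →L[ℂ] Sector m n :=
  weyl (a • dir n j) (b • dir n j)

theorem bosons_add_dir (z : Config m n) (j : Fin m × Fin 3) (a : ℝ) :
    bosons (z + a • dir n j) = bosons z := by
  ext i k
  simp [bosons, dir]

theorem join_add_dir (x : R3) (z : Config m n) (j : Fin m × Fin 3) (a : ℝ) :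
    join x (z + a • dir n j) = join x z + a • dir (n + 1) j := by
  have h : (dir (n + 1) j : Config m (n + 1)) = join 0 (dir n j) := by
    ext ⟨i | i, k⟩
    · simp [dir, join_apply_inl, PiLp.single_apply]
    · refine Fin.cases ?_ (fun i => ?_) i
      · simp [dir, join_apply_zero]
      · simp [dir, join_apply_succ]
  rw [h, ← join_smul, smul_zero, ← join_add, add_zero]

theorem dropFirst_add_dir (z : Config m (n + 1)) (j : Fin m × Fin 3) (a : ℝ) :
    dropFirst (z + a • dir (n + 1) j) = dropFirst z + a • dir n j := by
  conv_lhs => rw [← join_dropFirst z, ← join_add_dir, dropFirst_join]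

theorem permute_dir (σ : Equiv.Perm (Fin n)) (j : Fin m × Fin 3) :
    permute σ (dir n j) = dir n j := by
  rw [permute_eq]
  ext ⟨i | i, k⟩
  · simp [config, dir, tracers, PiLp.single_apply]
  · simp [config, dir, bosons]

theorem inner_dir (z : Config m n) (j : Fin m × Fin 3) : inner ℝ (dir n j) z = tracers z j := by
  rw [dir, EuclideanSpace.inner_single_left]
  simp [tracers]

theorem tracers_dir_self (j : Fin m × Fin 3) : tracers (dir n j) j = 1 := by
  simp [tracers, dir]

theorem weylPhase_dir (j : Fin m × Fin 3) (a b : ℝ) (z : Config m n) :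
    weylPhase (a • dir n j) (b • dir n j) z =
      Complex.exp (Complex.I * ((b * (tracers z j + a / 2) : ℝ) : ℂ)) := by
  rw [weylPhase, inner_smul_left, inner_add_right, inner_smul_right, inner_smul_right, inner_dir,
    inner_dir, tracers_dir_self]
  congr 3
  simp
  ring_nf
  simp

theorem sweyl_coe (j : Fin m × Fin 3) (a b : ℝ) (f : Sector m n) :
    sweyl n j a b f =ᵐ[volume] fun z =>
      Complex.exp (Complex.I * ((b * (tracers z j + a / 2) : ℝ) : ℂ)) * f (z + a • dir n j) := by
  filter_upwards [weyl_coe (a • dir n j) (b • dir n j) f] with z hz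
  rw [sweyl, hz, weylPhase_dir]

theorem inner_sweyl (j : Fin m × Fin 3) (a b : ℝ) (f g : Sector m n) :
    inner ℂ (sweyl n j a b f) g = inner ℂ f (sweyl n j (-a) (-b) g) := by
  rw [sweyl, sweyl, inner_weyl, neg_smul, neg_smul]

/-- Operators commuting with all Weyl operators in the tracer coordinates. -/
def Covariant (K : Sector m n' →L[ℂ] Sector m n) : Prop :=
  ∀ j a b f, sweyl n j a b (K f) = K (sweyl n' j a b f)

theorem covariant_insertOp (φ : L2R3) : Covariant (insertOp φ : Sector m n →L[ℂ] _) := by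
  intro j a b f
  refine Lp.ext ?_
  filter_upwards [sweyl_coe j a b (insertOp φ f), insertOp_coe φ (sweyl n j a b f),
    ae_add_right (a • dir (n + 1) j) (insertOp_coe φ f),
    quasiMeasurePreserving_dropFirst.ae (sweyl_coe j a b f)] with z h1 h2 h3 h4
  rw [h1, h2, h3, h4, bosons_add_dir, dropFirst_add_dir]
  simp only [dropFirst, tracers_config]
  ring

/-- Dual to the covariance of the insertion, as the adjoint of `W(a,b)` is `W(-a,-b)`. -/
theorem covariant_contractOp (φ : L2R3) : Covariant (contractOp φ : Sector m (n + 1) →L[ℂ] _) := by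
  intro j a b F
  refine ext_inner_left ℂ fun G => ?_
  have h1 : inner ℂ G (sweyl n j a b (contractOp φ F)) =
      inner ℂ (sweyl n j (-a) (-b) G) (contractOp φ F) := by
    rw [inner_sweyl, neg_neg, neg_neg]
  rw [h1, contractOp, ContinuousLinearMap.adjoint_inner_right,
    ContinuousLinearMap.adjoint_inner_right, ← covariant_insertOp φ j (-a) (-b) G, inner_sweyl,
    neg_neg, neg_neg]

theorem covariant_permOp (σ : Equiv.Perm (Fin n)) :
    Covariant (permOp σ : Sector m n →L[ℂ] _) := by
  intro j a b f
  refine Lp.ext ?_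
  filter_upwards [sweyl_coe j a b (permOp σ f), permuteL2_coe σ (sweyl n j a b f),
    ae_add_right (a • dir n j) (permuteL2_coe σ f), ae_permute σ (sweyl_coe j a b f)]
    with z h1 h2 h3 h4
  refine h1.trans (Eq.trans ?_ h2.symm)
  rw [h4]
  refine congrArg₂ _ rfl (h3.trans ?_)
  rw [map_add, map_smul, permute_dir]

theorem weyl_mulOp {E : Type*} [NormedAddCommGroup E] [InnerProductSpace ℝ E]
    [FiniteDimensional ℝ E] [MeasurableSpace E] [BorelSpace E] {g : E → ℂ}
    (hg : MemLp g ⊤ (volume : Measure E)) (p q : E) (f : Lp ℂ 2 (volume : Measure E)) :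
    weyl p q (mulOp volume g f) = mulOp volume (fun z => g (z + p)) (weyl p q f) := by
  have hg' : MemLp (fun z => g (z + p)) ⊤ (volume : Measure E) :=
    hg.comp_measurePreserving (measurePreserving_add_right volume p)
  refine Lp.ext ?_
  filter_upwards [weyl_coe p q (mulOp volume g f), ae_add_right p (mulOp_coe hg f),
    mulOp_coe hg' (weyl p q f), weyl_coe p q f] with z h1 h2 h3 h4
  rw [h1, h2, h3, h4]
  ring

theorem covariant_mulOp {g : Config m n → ℂ} (hg : MemLp g ⊤ volume)
    (h : ∀ z (j : Fin m × Fin 3) (a : ℝ), g (z + a • dir n j) = g z) : Covariant (mulOp volume g) := by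
  intro j a b f
  rw [sweyl, weyl_mulOp hg]
  congr 2
  ext z
  exact h z j a

theorem Covariant.sub_one_pow {K : Sector m n' →L[ℂ] Sector m n} (hK : Covariant K)
    (j : Fin m × Fin 3) (a b : ℝ) (k : ℕ) : ∀ f,
    ((sweyl n j a b - 1) ^ k) (K f) = K (((sweyl n' j a b - 1) ^ k) f) := by
  induction k with
  | zero => intro f; rfl
  | succ k ih =>
    intro f
    rw [pow_succ, pow_succ, mul_apply_eq_comp, mul_apply_eq_comp, ← ih]
    congr 1
    rw [sub_apply, sub_apply, hK j a b f, map_sub]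
    rfl

/-! ### Operators with bounded iterated commutators -/

/-- The weighted sum of the first `k` iterated differences of a vector. -/
def diffSum (k : ℕ) (j : Fin m × Fin 3) (a b : ℝ) (f : Sector m n) : ℝ :=
  ∑ i ∈ Finset.range (k + 1), |a| ^ (k - i) * ‖((sweyl n j a b - 1) ^ i) f‖

theorem diffSum_nonneg (k : ℕ) (j : Fin m × Fin 3) (a b : ℝ) (f : Sector m n) :
    0 ≤ diffSum k j a b f := Finset.sum_nonneg fun i _ => by positivity

/-- A family of operators, indexed by the mean-field data, whose iterated commutators with Weyl
operators are bounded uniformly for `‖φ‖ ≤ R`. -/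
def Admissible (R : ℝ) (K : L2R3 → Tracers m → (Sector m n' →L[ℂ] Sector m n)) : Prop :=
  ∀ k : ℕ, ∃ C : ℝ, 0 ≤ C ∧ ∀ φ Y, ‖φ‖ ≤ R → ∀ j a b f,
    ‖((sweyl n j a b - 1) ^ k) (K φ Y f)‖ ≤ C * diffSum k j a b f

theorem admissible_of_covariant {R C : ℝ} {K : L2R3 → Tracers m → (Sector m n' →L[ℂ] Sector m n)}
    (h : ∀ φ Y, Covariant (K φ Y)) (hC : ∀ φ Y, ‖φ‖ ≤ R → ‖K φ Y‖ ≤ C) : Admissible R K := by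
  intro k
  refine ⟨max C 0, le_max_right _ _, fun φ Y hφ j a b f => ?_⟩
  rw [(h φ Y).sub_one_pow]
  refine ((K φ Y).le_opNorm _).trans ?_
  refine mul_le_mul ((hC φ Y hφ).trans (le_max_left _ _)) ?_ (norm_nonneg _) (le_max_right _ _)
  have := Finset.single_le_sum (f := fun i => |a| ^ (k - i) * ‖((sweyl n' j a b - 1) ^ i) f‖)
    (fun i _ => by positivity) (Finset.self_mem_range_succ k)
  rwa [Nat.sub_self, pow_zero, one_mul] at this

/-- The weights in `diffSum` are chosen for this stability: `|a|^(k-i) |a|^(i-l) = |a|^(k-l)`. -/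
theorem Admissible.comp {R : ℝ} {K : L2R3 → Tracers m → (Sector m n' →L[ℂ] Sector m n)}
    {K' : L2R3 → Tracers m → (Sector m n'' →L[ℂ] Sector m n')}
    (hK : Admissible R K) (hK' : Admissible R K') :
    Admissible R (fun φ Y => (K φ Y).comp (K' φ Y)) := by
  intro k
  obtain ⟨C, hC, h⟩ := hK k
  choose C' hC' h' using hK'
  refine ⟨C * ∑ i ∈ Finset.range (k + 1), C' i,
    mul_nonneg hC (Finset.sum_nonneg fun i _ => hC' i), fun φ Y hφ j a b f => ?_⟩
  rw [ContinuousLinearMap.comp_apply, mul_assoc]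
  refine (h φ Y hφ j a b _).trans (mul_le_mul_of_nonneg_left ?_ hC)
  rw [Finset.sum_mul]
  refine Finset.sum_le_sum fun i hi => ?_
  have hik : i ≤ k := Nat.lt_succ_iff.1 (Finset.mem_range.1 hi)
  calc |a| ^ (k - i) * ‖((sweyl n' j a b - 1) ^ i) (K' φ Y f)‖
      ≤ |a| ^ (k - i) * (C' i * diffSum i j a b f) := by
        gcongr
        exact h' i φ Y hφ j a b f
    _ = C' i * ∑ l ∈ Finset.range (i + 1), |a| ^ (k - l) * ‖((sweyl n'' j a b - 1) ^ l) f‖ := by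
        rw [diffSum, mul_left_comm, Finset.mul_sum]
        congr 1
        refine Finset.sum_congr rfl fun l hl => ?_
        have hli : l ≤ i := Nat.lt_succ_iff.1 (Finset.mem_range.1 hl)
        rw [← mul_assoc, ← pow_add]
        congr 3
        omega
    _ ≤ C' i * diffSum k j a b f := by
        refine mul_le_mul_of_nonneg_left ?_ (hC' i)
        exact Finset.sum_le_sum_of_subset_of_nonneg
          (Finset.range_subset_range.2 (by omega)) fun l _ _ => by positivity

theorem Admissible.add {R : ℝ} {K K' : L2R3 → Tracers m → (Sector m n' →L[ℂ] Sector m n)}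
    (hK : Admissible R K) (hK' : Admissible R K') : Admissible R (fun φ Y => K φ Y + K' φ Y) := by
  intro k
  obtain ⟨C, hC, h⟩ := hK k
  obtain ⟨C', hC', h'⟩ := hK' k
  refine ⟨C + C', add_nonneg hC hC', fun φ Y hφ j a b f => ?_⟩
  rw [add_apply, map_add, add_mul]
  exact (norm_add_le _ _).trans (add_le_add (h φ Y hφ j a b f) (h' φ Y hφ j a b f))

theorem Admissible.smul {R : ℝ} {K : L2R3 → Tracers m → (Sector m n' →L[ℂ] Sector m n)}
    (hK : Admissible R K) (c : ℂ) : Admissible R (fun φ Y => c • K φ Y) := by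
  intro k
  obtain ⟨C, hC, h⟩ := hK k
  refine ⟨‖c‖ * C, by positivity, fun φ Y hφ j a b f => ?_⟩
  rw [smul_apply, map_smul, norm_smul, mul_assoc]
  exact mul_le_mul_of_nonneg_left (h φ Y hφ j a b f) (norm_nonneg _)

theorem admissible_zero (R : ℝ) :
    Admissible R (fun _ _ => (0 : Sector m n' →L[ℂ] Sector m n)) := fun k =>
  ⟨0, le_rfl, fun φ Y _ j a b f => by rw [zero_apply, map_zero, norm_zero, zero_mul]⟩

theorem Admissible.sum {R : ℝ} {ι : Type*} (s : Finset ι)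
    {K : ι → L2R3 → Tracers m → (Sector m n' →L[ℂ] Sector m n)}
    (hK : ∀ i, Admissible R (K i)) : Admissible R (fun φ Y => ∑ i ∈ s, K i φ Y) := by
  classical
  induction s using Finset.induction_on with
  | empty => simpa using admissible_zero R
  | insert i s hi ih =>
    simp_rw [Finset.sum_insert hi]
    exact (hK i).add ih

theorem admissible_insertOp (R : ℝ) :
    Admissible R (fun φ (_ : Tracers m) => (insertOp φ : Sector m n →L[ℂ] _)) :=
  admissible_of_covariant (fun φ _ => covariant_insertOp φ)
    fun φ _ h => (norm_insertOp_le φ).trans h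

theorem admissible_contractOp (R : ℝ) :
    Admissible R (fun φ (_ : Tracers m) => (contractOp φ : Sector m (n + 1) →L[ℂ] _)) :=
  admissible_of_covariant (fun φ _ => covariant_contractOp φ)
    fun φ _ h => (norm_contractOp_le φ).trans h

theorem admissible_permOp (R : ℝ) (σ : Equiv.Perm (Fin n)) :
    Admissible R (fun _ (_ : Tracers m) => (permOp σ : Sector m n →L[ℂ] _)) :=
  admissible_of_covariant (fun _ _ => covariant_permOp σ) fun _ _ _ => norm_permOp_le σ

theorem admissible_sumOp (R : ℝ) : Admissible R (fun _ (_ : Tracers m) => sumOp m n) :=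
  Admissible.sum Finset.univ fun i => admissible_permOp R (Fin.cycleRange i)

theorem norm_mulOp_le {α : Type*} [MeasurableSpace α] {μ : Measure α} {q : α → ℂ}
    (hq : MemLp q ⊤ μ) {C : ℝ} (hC : 0 ≤ C) (h : ∀ᵐ x ∂μ, ‖q x‖ ≤ C) : ‖mulOp μ q‖ ≤ C :=
  ContinuousLinearMap.opNorm_le_bound _ hC (norm_mulOp_apply_le hq hC h)

/-- Multiplication by the pair potential `v(x₀ - x₁)`. -/
def pairOp (v : R3 → ℝ) : Sector m (n + 2) →L[ℂ] Sector m (n + 2) :=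
  mulOp volume fun z => (v (bosons z 0 - bosons z 1) : ℂ)

theorem exists_ae_norm_le {α F : Type*} [MeasurableSpace α] {μ : Measure α} [NormedAddCommGroup F]
    {f : α → F} (hf : MemLp f ⊤ μ) : ∃ C : ℝ, 0 ≤ C ∧ ∀ᵐ x ∂μ, ‖f x‖ ≤ C := by
  refine ⟨(eLpNorm f ⊤ μ).toReal, ENNReal.toReal_nonneg, ?_⟩
  filter_upwards [ae_le_eLpNormEssSup (f := f) (μ := μ)] with x hx
  rw [← eLpNorm_exponent_top] at hx
  have := ENNReal.toReal_mono hf.2.ne hx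
  simpa using this

theorem exists_pair_bound {v : R3 → ℝ} (hv : MemLp v ⊤ volume) : ∃ C : ℝ, 0 ≤ C ∧
    ∀ m n, ∀ᵐ z : Config m (n + 2), ‖(v (bosons z 0 - bosons z 1) : ℂ)‖ ≤ C := by
  obtain ⟨C, hC0, hC⟩ := exists_ae_norm_le hv
  refine ⟨C, hC0, fun m n => ?_⟩
  filter_upwards [quasiMeasurePreserving_boson_sub.ae hC] with z hz
  simpa using hz

theorem memLp_pair {v : R3 → ℝ} (hv : MemLp v ⊤ volume) :
    MemLp (fun z : Config m (n + 2) => (v (bosons z 0 - bosons z 1) : ℂ)) ⊤ volume := by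
  have h1 := hv.1.comp_quasiMeasurePreserving
    (quasiMeasurePreserving_boson_sub (m := m) (n := n))
  obtain ⟨C, -, hC⟩ := exists_pair_bound hv
  exact memLp_top_of_bound (Complex.continuous_ofReal.comp_aestronglyMeasurable h1) C (hC m n)

theorem pairOp_coe {v : R3 → ℝ} (hv : MemLp v ⊤ volume) (f : Sector m (n + 2)) :
    pairOp v f =ᵐ[volume] fun z => (v (bosons z 0 - bosons z 1) : ℂ) * f z :=
  mulOp_coe (memLp_pair hv) f

theorem admissible_pairOp (R : ℝ) {v : R3 → ℝ} (hv : MemLp v ⊤ volume) :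
    Admissible R (fun _ (_ : Tracers m) => (pairOp v : Sector m (n + 2) →L[ℂ] _)) := by
  obtain ⟨C, hC0, hC⟩ := exists_pair_bound hv
  exact admissible_of_covariant
    (fun _ _ => covariant_mulOp (memLp_pair hv) fun z j a => by rw [bosons_add_dir])
    fun _ _ _ => norm_mulOp_le (memLp_pair hv) hC0 (hC m n)

/-! ### The tracer-boson potential -/

theorem fwdDiff_iter_map {A B F G : Type*} [AddCommGroup A] [AddCommGroup B] [AddCommGroup F]
    [AddCommGroup G] (L : A →+ B) (T : F →+ G) (f : B → F) (p : A) (i : ℕ) : ∀ z : A,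
    (fwdDiff p)^[i] (fun z => T (f (L z))) z = T ((fwdDiff (L p))^[i] f (L z)) := by
  induction i with
  | zero => intro z; rfl
  | succ i ih =>
    intro z
    rw [Function.iterate_succ_apply', Function.iterate_succ_apply']
    simp only [fwdDiff, ih, map_add, map_sub]

theorem hasFDerivAt_fwdDiff_iter {V F : Type*} [NormedAddCommGroup V] [NormedSpace ℝ V]
    [NormedAddCommGroup F] [NormedSpace ℝ F] (p : V) {f : V → F} {f' : V → V →L[ℝ] F}
    (hf : ∀ x, HasFDerivAt f (f' x) x) (i : ℕ) :
    ∀ x, HasFDerivAt ((fwdDiff p)^[i] f) ((fwdDiff p)^[i] f' x) x := by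
  induction i generalizing f f' with
  | zero => exact hf
  | succ i ih =>
    simp only [Function.iterate_succ_apply]
    refine ih fun x => ?_
    exact ((hasFDerivAt_comp_add_right p).2 (hf (x + p))).sub (hf x)

/-- Mean value theorem, using that every derivative of a Schwartz function is globally bounded. The
target space varies in the induction because the derivative takes values in linear maps. -/
theorem exists_schwartz_fwdDiff_bound (i : ℕ) : ∀ {F : Type} [NormedAddCommGroup F]
    [NormedSpace ℝ F] (f : 𝓢(R3, F)), ∃ C : ℝ, 0 ≤ C ∧ ∀ p x,
      ‖(fwdDiff p)^[i] (f : R3 → F) x‖ ≤ C * ‖p‖ ^ i := by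
  induction i with
  | zero =>
    intro F _ _ f
    obtain ⟨C, hC⟩ := f.decay 0 0
    refine ⟨C, hC.1.le, fun p x => ?_⟩
    simpa using hC.2 x
  | succ i ih =>
    intro F _ _ f
    obtain ⟨C, hC0, hC⟩ := ih (SchwartzMap.fderivCLM ℝ R3 F f)
    refine ⟨C, hC0, fun p x => ?_⟩
    have hd : ∀ x, HasFDerivAt f (SchwartzMap.fderivCLM ℝ R3 F f x) x := fun x =>
      (f.differentiableAt).hasFDerivAt
    rw [Function.iterate_succ_apply']
    have key := Convex.norm_image_sub_le_of_norm_hasFDerivWithin_le (s := Set.univ)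
      (f := (fwdDiff p)^[i] (f : R3 → F)) (C := C * ‖p‖ ^ i) (x := x) (y := x + p)
      (fun y _ => (hasFDerivAt_fwdDiff_iter p hd i y).hasFDerivWithinAt)
      (fun y _ => hC p y) convex_univ (Set.mem_univ _) (Set.mem_univ _)
    rw [add_sub_cancel_left, mul_assoc, ← pow_succ] at key
    exact key

/-- Product rule `(W - 1)(g f) = (Δ_p g) W f + g (W - 1) f`, iterated. The phase direction `q` plays
no role for `g`: multiplications commute, so only the shift by `p` costs a difference of `g`. -/
theorem norm_sub_one_pow_mulOp_le {E : Type*} [NormedAddCommGroup E] [InnerProductSpace ℝ E]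
    [FiniteDimensional ℝ E] [MeasurableSpace E] [BorelSpace E] (p q : E) {α : ℝ} (hα : 0 ≤ α)
    (k : ℕ) : ∀ {g : E → ℂ} {K : ℝ}, 0 ≤ K → Continuous g →
      (∀ i ≤ k, ∀ z, ‖(fwdDiff p)^[i] g z‖ ≤ K * α ^ i) → ∀ f : Lp ℂ 2 (volume : Measure E),
      ‖((weyl p q - 1) ^ k) (mulOp volume g f)‖ ≤
        2 ^ k * K * ∑ i ∈ Finset.range (k + 1), α ^ (k - i) * ‖((weyl p q - 1) ^ i) f‖ := by
  induction k with
  | zero =>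
    intro g K hK hg hb f
    have hb0 : ∀ z, ‖g z‖ ≤ K := fun z => by simpa using hb 0 le_rfl z
    have := norm_mulOp_apply_le (memLp_top_of_norm_le hg.aestronglyMeasurable hb0) hK
      (Eventually.of_forall hb0) f
    simpa using this
  | succ k ih =>
    intro g K hK hg hb f
    have hb0 : ∀ z, ‖g z‖ ≤ K := fun z => by simpa using hb 0 (by omega) z
    have hgL : MemLp g ⊤ (volume : Measure E) := memLp_top_of_norm_le hg.aestronglyMeasurable hb0
    have hgL' : MemLp (fun z => g (z + p)) ⊤ (volume : Measure E) :=
      hgL.comp_measurePreserving (measurePreserving_add_right volume p)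
    have e1 : (weyl p q - 1) (mulOp volume g f) =
        mulOp volume (fwdDiff p g) (weyl p q f) + mulOp volume g ((weyl p q - 1) f) := by
      have e2 : mulOp volume (fwdDiff p g) = mulOp volume (fun z => g (z + p)) - mulOp volume g :=
        (mulOp_sub hgL' hgL).symm
      rw [sub_apply, weyl_mulOp hgL, e2, sub_apply, sub_apply, map_sub]
      change _ - mulOp volume g f = _ + (_ - mulOp volume g f)
      abel
    have hcont : Continuous (fwdDiff p g) := by
      unfold fwdDiff; fun_prop
    have b1 := ih (g := fwdDiff p g) (K := K * α) (by positivity) hcont (fun i hi z => by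
      have := hb (i + 1) (by omega) z
      rwa [Function.iterate_succ_apply, pow_succ', ← mul_assoc] at this) (weyl p q f)
    have b2 := ih hK hg (fun i hi z => hb i (by omega) z) ((weyl p q - 1) f)
    have hcomm : ∀ i : ℕ, ‖((weyl p q - 1) ^ i) (weyl p q f)‖ = ‖((weyl p q - 1) ^ i) f‖ := fun i => by
      have hc : Commute ((weyl p q - 1) ^ i) (weyl p q) :=
        ((Commute.refl (weyl p q)).sub_left (Commute.one_left _)).pow_left i
      rw [← mul_apply_eq_comp, hc.eq, mul_apply_eq_comp, norm_weyl]
    simp_rw [hcomm] at b1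
    have hstep : ∀ i : ℕ, ((weyl p q - 1) ^ i) ((weyl p q - 1) f) = ((weyl p q - 1) ^ (i + 1)) f :=
      fun i => by rw [pow_succ, mul_apply_eq_comp]
    simp_rw [hstep] at b2
    rw [pow_succ, mul_apply_eq_comp, e1, map_add]
    refine (norm_add_le _ _).trans ((add_le_add b1 b2).trans ?_)
    set c : ℕ → ℝ := fun i => ‖((weyl p q - 1) ^ i) f‖ with hc
    have s1 : α * ∑ i ∈ Finset.range (k + 1), α ^ (k - i) * c i ≤
        ∑ i ∈ Finset.range (k + 1 + 1), α ^ (k + 1 - i) * c i := by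
      rw [Finset.sum_range_succ _ (k + 1), Finset.mul_sum]
      refine le_add_of_le_of_nonneg (le_of_eq (Finset.sum_congr rfl fun i hi => ?_)) (by positivity)
      have hi' := Finset.mem_range.1 hi
      rw [← mul_assoc, ← pow_succ']
      congr 2
      omega
    have s2 : ∑ i ∈ Finset.range (k + 1), α ^ (k - i) * c (i + 1) ≤
        ∑ i ∈ Finset.range (k + 1 + 1), α ^ (k + 1 - i) * c i := by
      rw [Finset.sum_range_succ' _ (k + 1)]
      refine le_add_of_le_of_nonneg (le_of_eq (Finset.sum_congr rfl fun i hi => ?_)) (by positivity)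
      congr 2
      omega
    calc _ = 2 ^ k * K * (α * ∑ i ∈ Finset.range (k + 1), α ^ (k - i) * c i) +
          2 ^ k * K * ∑ i ∈ Finset.range (k + 1), α ^ (k - i) * c (i + 1) := by ring
      _ ≤ 2 ^ k * K * (∑ i ∈ Finset.range (k + 1 + 1), α ^ (k + 1 - i) * c i) +
          2 ^ k * K * ∑ i ∈ Finset.range (k + 1 + 1), α ^ (k + 1 - i) * c i := by gcongr
      _ = _ := by ring

/-- The position of the first boson relative to a tracer. -/
def relPos (l : Fin m) : Config m (n + 1) →+ R3 where
  toFun z := bosons z 0 - tracer (tracers z) l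
  map_zero' := by ext k; simp [bosons, tracer, tracers]
  map_add' z z' := by ext k; simp [bosons, tracer, tracers]; ring

theorem norm_relPos_dir_le (l : Fin m) (j : Fin m × Fin 3) (a : ℝ) :
    ‖relPos l (a • dir (n + 1) j)‖ ≤ |a| := by
  have h : relPos l (a • dir (n + 1) j) =
      if l = j.1 then EuclideanSpace.single j.2 (-a) else (0 : R3) := by
    ext k
    by_cases hl : l = j.1 <;> by_cases hk : k = j.2 <;>
      simp [relPos, bosons, tracer, tracers, dir, hl, hk]
  rw [h]
  split_ifs <;> simp

theorem continuous_relPos (l : Fin m) : Continuous (relPos l : Config m (n + 1) → R3) := by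
  have : (relPos l : Config m (n + 1) → R3) = fun z => WithLp.toLp 2 fun k =>
      z (Sum.inr 0, k) - z (Sum.inl l, k) := by
    ext z k; simp [relPos, bosons, tracer, tracers]
  rw [this]
  fun_prop

theorem continuous_firstBoson : Continuous (fun z : Config m (n + 1) => bosons z 0) := by
  unfold bosons
  fun_prop

/-- Multiplication by `w̲(x₀, 𝐗) - w̲(x₀, 𝐘)`. -/
def potOp (w : R3 → ℝ) (Y : Tracers m) : Sector m (n + 1) →L[ℂ] Sector m (n + 1) :=
  mulOp volume fun z => dW w Y (bosons z 0) (tracers z)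

theorem schwartz_bounded (w : 𝓢(R3, ℝ)) : ∃ C : ℝ, 0 ≤ C ∧ ∀ x, ‖w x‖ ≤ C := by
  obtain ⟨C, hC0, hC⟩ := exists_schwartz_fwdDiff_bound 0 w
  exact ⟨C, hC0, fun x => by simpa using hC 0 x⟩

theorem continuous_wTot_boson (w : 𝓢(R3, ℝ)) (Y : Tracers m) :
    Continuous (fun z : Config m (n + 1) => ((wTot w (bosons z 0) Y : ℝ) : ℂ)) := by
  unfold wTot
  refine Complex.continuous_ofReal.comp (continuous_finsetSum _ fun l _ => ?_)
  exact w.continuous.comp (continuous_firstBoson.sub continuous_const)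

theorem continuous_pot (w : 𝓢(R3, ℝ)) (l : Fin m) :
    Continuous (fun z : Config m (n + 1) => ((w (relPos l z) : ℝ) : ℂ)) :=
  Complex.continuous_ofReal.comp (w.continuous.comp (continuous_relPos l))

theorem norm_wTot_le {w : R3 → ℝ} {C : ℝ} (hC : ∀ x, ‖w x‖ ≤ C) (x : R3) (Y : Tracers m) :
    ‖((wTot w x Y : ℝ) : ℂ)‖ ≤ m * C := by
  rw [Complex.norm_real, wTot]
  refine (norm_sum_le _ _).trans ((Finset.sum_le_sum fun l _ => hC _).trans ?_)
  simp

theorem memLp_pot (w : 𝓢(R3, ℝ)) (l : Fin m) :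
    MemLp (fun z : Config m (n + 1) => ((w (relPos l z) : ℝ) : ℂ)) ⊤ volume := by
  obtain ⟨C, _, hC⟩ := schwartz_bounded w
  exact memLp_top_of_norm_le (continuous_pot w l).aestronglyMeasurable (C := C)
    fun z => by rw [Complex.norm_real]; exact hC _

theorem memLp_wTot_boson (w : 𝓢(R3, ℝ)) (Y : Tracers m) :
    MemLp (fun z : Config m (n + 1) => ((wTot w (bosons z 0) Y : ℝ) : ℂ)) ⊤ volume := by
  obtain ⟨C, _, hC⟩ := schwartz_bounded w
  exact memLp_top_of_norm_le (continuous_wTot_boson w Y).aestronglyMeasurable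
    fun z => norm_wTot_le hC _ _

theorem dW_eq (w : R3 → ℝ) (Y : Tracers m) (z : Config m (n + 1)) :
    dW w Y (bosons z 0) (tracers z) =
      (∑ l, ((w (relPos l z) : ℝ) : ℂ)) - ((wTot w (bosons z 0) Y : ℝ) : ℂ) := by
  rw [dW]
  push_cast
  congr 1
  rw [wTot]
  push_cast
  rfl

theorem memLp_dW (w : 𝓢(R3, ℝ)) (Y : Tracers m) :
    MemLp (fun z : Config m (n + 1) => dW w Y (bosons z 0) (tracers z)) ⊤ volume := by
  simp_rw [dW_eq]
  exact memLp_top_sub (memLp_finsetSum _ fun l _ => memLp_pot w l) (memLp_wTot_boson w Y)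

theorem potOp_coe (w : 𝓢(R3, ℝ)) (Y : Tracers m) (f : Sector m (n + 1)) :
    potOp w Y f =ᵐ[volume] fun z => dW w Y (bosons z 0) (tracers z) * f z :=
  mulOp_coe (memLp_dW w Y) f

/-- Only the terms `w(x₀ - X⁽ˡ⁾)` fail to commute with tracer translations. The part depending on
`𝐘` is covariant and bounded uniformly in `𝐘`, which makes all constants independent of the
mean-field trajectory. -/
theorem potOp_eq (w : 𝓢(R3, ℝ)) (Y : Tracers m) :
    (potOp w Y : Sector m (n + 1) →L[ℂ] _) =
      (∑ l, mulOp volume fun z => ((w (relPos l z) : ℝ) : ℂ)) +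
        (-1 : ℂ) • mulOp volume fun z => ((wTot w (bosons z 0) Y : ℝ) : ℂ) := by
  have h1 : ∀ s : Finset (Fin m), (∑ l ∈ s, mulOp volume fun z : Config m (n + 1) =>
      ((w (relPos l z) : ℝ) : ℂ)) = mulOp volume fun z => ∑ l ∈ s, ((w (relPos l z) : ℝ) : ℂ) := by
    intro s
    ext1 f
    refine Lp.ext ?_
    rw [sum_apply]
    filter_upwards [Lp_coeFn_sum s (fun l => mulOp volume (fun z : Config m (n + 1) =>
      ((w (relPos l z) : ℝ) : ℂ)) f), eventually_all.2 fun l => mulOp_coe (memLp_pot w l) f,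
      mulOp_coe (memLp_finsetSum s fun l _ => memLp_pot w l) f] with z a1 a2 a3
    rw [a1, a3, Finset.sum_mul]
    exact Finset.sum_congr rfl fun l _ => a2 l
  rw [h1, neg_one_smul, ← sub_eq_add_neg, mulOp_sub (memLp_finsetSum _ fun l _ => memLp_pot w l)
    (memLp_wTot_boson w Y), potOp]
  simp_rw [dW_eq]

theorem admissible_potOp (R : ℝ) (w : 𝓢(R3, ℝ)) :
    Admissible R (fun _ (Y : Tracers m) => (potOp w Y : Sector m (n + 1) →L[ℂ] _)) := by
  simp_rw [potOp_eq]
  obtain ⟨C, hC0, hC⟩ := schwartz_bounded w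
  refine Admissible.add (Admissible.sum _ fun l k => ?_) (Admissible.smul ?_ _)
  · choose K hK0 hK using fun i => exists_schwartz_fwdDiff_bound i w
    have hK1 : 0 ≤ ∑ i ∈ Finset.range (k + 1), K i := Finset.sum_nonneg fun i _ => hK0 i
    refine ⟨2 ^ k * ∑ i ∈ Finset.range (k + 1), K i, by positivity, fun φ Y _ j a b f => ?_⟩
    refine norm_sub_one_pow_mulOp_le _ _ (abs_nonneg a) k hK1 (continuous_pot w l)
      (fun i hi z => ?_) f
    have := fwdDiff_iter_map (relPos l : Config m (n + 1) →+ R3) Complex.ofRealHom.toAddMonoidHom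
      (w : R3 → ℝ) (a • dir (n + 1) j) i z
    simp only [RingHom.toAddMonoidHom_eq_coe, AddMonoidHom.coe_coe, Complex.ofRealHom_eq_coe] at this
    rw [this, Complex.norm_real]
    refine (hK i _ _).trans ?_
    gcongr
    · exact Finset.single_le_sum (f := K) (fun i _ => hK0 i) (Finset.mem_range.2 (by omega))
    · exact norm_relPos_dir_le l j a
  · exact admissible_of_covariant
      (fun _ Y => covariant_mulOp (memLp_wTot_boson w Y) fun z j a => by rw [bosons_add_dir])
      fun _ Y _ => norm_mulOp_le (memLp_wTot_boson w Y) (by positivity)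
        (Eventually.of_forall fun z => norm_wTot_le hC _ _)

/-! ### Representation of the interaction terms by bounded operators -/

/-- `F` represents the `n`-boson vector `h`. -/
def Rep (F : Tracers m → (Fin n → R3) → ℂ) (h : Sector m n) : Prop :=
  ∀ᵐ z : Config m n, h z = F (tracers z) (bosons z)

/-- The family `G(x)` of functions represents `h` as a function of the first boson and the rest. -/
def RepFamily (G : R3 → Tracers m → (Fin n → R3) → ℂ) (h : Sector m (n + 1)) : Prop :=
  ∀ᵐ z : Config m (n + 1), h z = G (bosons z 0) (tracers z) (bosons (dropFirst z))

theorem Rep.add {F F' : Tracers m → (Fin n → R3) → ℂ} {h h' : Sector m n} (H : Rep F h)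
    (H' : Rep F' h') : Rep (F + F') (h + h') := by
  filter_upwards [H, H', Lp.coeFn_add h h'] with z h1 h2 h3
  rw [h3, Pi.add_apply, h1, h2]
  rfl

theorem Rep.smul {F : Tracers m → (Fin n → R3) → ℂ} {h : Sector m n} (H : Rep F h) (c : ℂ) :
    Rep (c • F) (c • h) := by
  filter_upwards [H, Lp.coeFn_smul c h] with z h1 h3
  rw [h3, Pi.smul_apply, h1]
  rfl

theorem rep_zero : Rep (0 : Tracers m → (Fin n → R3) → ℂ) (0 : Sector m n) := by
  filter_upwards [Lp.coeFn_zero ℂ 2 (volume : Measure (Config m n))] with z h1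
  rw [h1]
  rfl

theorem Rep.unique {F : Tracers m → (Fin n → R3) → ℂ} {h h' : Sector m n} (H : Rep F h)
    (H' : Rep F h') : h = h' := by
  refine Lp.ext ?_
  filter_upwards [H, H'] with z h1 h2
  rw [h1, h2]

theorem toFock_eq (Ψ : Hilb m) (z : Config m n) :
    toFock Ψ n (tracers z) (bosons z) = comp Ψ n z := by
  rw [toFock, config_eta]

theorem toFock_join (Ψ : Hilb m) (x : R3) (z : Config m n) :
    toFock Ψ (n + 1) (tracers z) (Fin.cons x (bosons z)) = comp Ψ (n + 1) (join x z) := rfl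

theorem toFock_join_join (Ψ : Hilb m) (x y : R3) (z : Config m n) :
    toFock Ψ (n + 2) (tracers z) (Fin.cons x (Fin.cons y (bosons z))) =
      comp Ψ (n + 2) (join x (join y z)) := rfl

/-- `n^{-1/2}` times the sum over all ways of bringing a boson to the first place. -/
def creOp (m n : ℕ) : Sector m (n + 1) →L[ℂ] Sector m (n + 1) :=
  ((Real.sqrt (n + 1) : ℝ) : ℂ)⁻¹ • sumOp m n

theorem RepFamily.creInteg {G : R3 → FockFun m} {h : Sector m (n + 1)}
    (H : RepFamily (fun x => G x n) h) : Rep (creInteg G (n + 1)) (creOp m n h) := by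
  rw [creOp, smul_apply]
  filter_upwards [Lp.coeFn_smul ((Real.sqrt (n + 1) : ℝ) : ℂ)⁻¹ (sumOp m n h), sumOp_coe h,
    ae_bringFirst H] with z h1 h2 h3
  rw [h1, Pi.smul_apply, h2, smul_eq_mul, TracerBoson.creInteg]
  congr 1
  refine Finset.sum_congr rfl fun i _ => ?_
  rw [h3 i]
  simp [bringFirst]

/-- A relabelling of all bosons but the first. -/
def tailPerm (σ : Equiv.Perm (Fin n)) : Equiv.Perm (Fin (n + 1)) :=
  Equiv.Perm.decomposeFin.symm (0, σ)

theorem permute_tailPerm (σ : Equiv.Perm (Fin n)) (x : R3) (z : Config m n) :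
    permute (tailPerm σ) (join x z) = join x (permute σ z) := by
  rw [permute_eq, permute_eq, ← config_cons, bosons_join, tracers_join]
  congr 1
  ext1 i
  have h0 : (tailPerm σ).symm 0 = 0 := by
    rw [Equiv.symm_apply_eq]; simp [tailPerm]
  have hs : ∀ i : Fin n, (tailPerm σ).symm i.succ = (σ.symm i).succ := fun i => by
    rw [Equiv.symm_apply_eq]; simp [tailPerm]
  refine Fin.cases ?_ (fun i => ?_) i
  · simp [h0]
  · simp [hs]

/-- The operator `creOp` acting on all bosons but the first. -/
def tailCreOp (m n : ℕ) : Sector m (n + 2) →L[ℂ] Sector m (n + 2) :=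
  ((Real.sqrt (n + 1) : ℝ) : ℂ)⁻¹ • ∑ i : Fin (n + 1), permOp (tailPerm i.cycleRange)

theorem tailCreOp_rep {G : R3 → R3 → FockFun m} {h : Sector m (n + 2)}
    (H : ∀ᵐ z : Config m (n + 2), h z = G (bosons z 0) (bosons (dropFirst z) 0) n (tracers z)
      (bosons (dropFirst (dropFirst z)))) :
    RepFamily (fun x => creInteg (G x) (n + 1)) (tailCreOp m n h) := by
  rw [tailCreOp, smul_apply, sum_apply]
  have h2 := eventually_all.2 fun i : Fin (n + 1) => permuteL2_coe (tailPerm i.cycleRange) h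
  have h3 := eventually_all.2 fun i : Fin (n + 1) => ae_permute (tailPerm i.cycleRange) H
  filter_upwards [Lp.coeFn_smul ((Real.sqrt (n + 1) : ℝ) : ℂ)⁻¹
      (∑ i : Fin (n + 1), permOp (tailPerm i.cycleRange) h),
    Lp_coeFn_sum Finset.univ (fun i : Fin (n + 1) => permOp (tailPerm i.cycleRange) h), h2, h3]
    with z h1 h4 h2 h3
  rw [h1, Pi.smul_apply, h4, smul_eq_mul, TracerBoson.creInteg]
  congr 1
  refine Finset.sum_congr rfl fun i _ => ?_
  refine (h2 i).trans ((h3 i).trans ?_)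
  have e : permute (tailPerm i.cycleRange) z = join (bosons z 0) (bringFirst i (dropFirst z)) := by
    conv_lhs => rw [← join_dropFirst z, permute_tailPerm, permute_cycleRange]
  rw [e]
  simp [bringFirst, dropFirst]

theorem rep_creInteg_creInteg {G : R3 → R3 → FockFun m} {h : Sector m (n + 2)}
    (H : ∀ᵐ z : Config m (n + 2), h z = G (bosons z 0) (bosons (dropFirst z) 0) n (tracers z)
      (bosons (dropFirst (dropFirst z)))) :
    Rep (creInteg (fun x => creInteg (G x)) (n + 2)) (creOp m (n + 1) (tailCreOp m n h)) :=
  RepFamily.creInteg (tailCreOp_rep H)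

theorem admissible_creOp (R : ℝ) : Admissible R (fun _ (_ : Tracers m) => creOp m n) :=
  (admissible_sumOp R).smul _

theorem admissible_tailCreOp (R : ℝ) : Admissible R (fun _ (_ : Tracers m) => tailCreOp m n) :=
  (Admissible.sum _ fun _ => admissible_permOp R _).smul _

/-- The exchange of the first two bosons. -/
def swapOp (m n : ℕ) : Sector m (n + 2) →L[ℂ] Sector m (n + 2) := permOp (Equiv.swap 0 1)

theorem permute_swap (x y : R3) (z : Config m n) :
    permute (Equiv.swap 0 1) (join x (join y z)) = join y (join x z) := by
  rw [permute_eq, bosons_join, bosons_join, tracers_join, tracers_join, join, join, tracers_config,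
    bosons_config]
  congr 1
  ext1 i
  refine Fin.cases ?_ (fun i => Fin.cases ?_ (fun i => ?_) i) i
  · simp [Equiv.swap_apply_left]
  · simp
  · have : Equiv.swap (0 : Fin (n + 2)) 1 i.succ.succ = i.succ.succ :=
      Equiv.swap_apply_of_ne_of_ne (Fin.succ_ne_zero _)
        (by rw [← Fin.succ_zero_eq_one]; exact fun h => Fin.succ_ne_zero _ (Fin.succ_injective _ h))
    simp [this]

theorem swapOp_coe (f : Sector m (n + 2)) :
    ∀ᵐ z : Config m (n + 2), swapOp m n f z =
      f (join (bosons (dropFirst z) 0) (join (bosons z 0) (dropFirst (dropFirst z)))) := by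
  filter_upwards [permuteL2_coe (Equiv.swap 0 1) f] with z hz
  refine hz.trans ?_
  rw [← permute_swap, join_dropFirst, join_dropFirst]

theorem admissible_swapOp (R : ℝ) : Admissible R (fun _ (_ : Tracers m) => swapOp m n) :=
  admissible_permOp R _

/-! ### The source estimate -/

/-- The total of the weighted differences of the components with at most `n + 2` bosons. -/
def diffTotal (n k : ℕ) (j : Fin m × Fin 3) (a b : ℝ) (Ψ : Hilb m) : ℝ :=
  ∑ n' ∈ Finset.range (n + 3), diffSum k j a b (comp Ψ n')

theorem diffTotal_nonneg (n k : ℕ) (j : Fin m × Fin 3) (a b : ℝ) (Ψ : Hilb m) :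
    0 ≤ diffTotal n k j a b Ψ := Finset.sum_nonneg fun _ _ => diffSum_nonneg _ _ _ _ _

/-- An interaction term which is represented by vectors satisfying difference bounds. -/
def GoodTerm (R : ℝ) (n : ℕ) (𝒯 : L2R3 → Tracers m → FockFun m → FockFun m) : Prop :=
  ∀ k : ℕ, ∃ C : ℝ, 0 ≤ C ∧ ∀ φ Y, ‖φ‖ ≤ R → ∀ Ψ : Hilb m, ∃ S : Sector m n,
    Rep (𝒯 φ Y (toFock Ψ) n) S ∧
      ∀ j a b, ‖((sweyl n j a b - 1) ^ k) S‖ ≤ C * diffTotal n k j a b Ψ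

theorem GoodTerm.add {R : ℝ} {𝒯 𝒯' : L2R3 → Tracers m → FockFun m → FockFun m}
    (h : GoodTerm R n 𝒯) (h' : GoodTerm R n 𝒯') :
    GoodTerm R n (fun φ Y F => 𝒯 φ Y F + 𝒯' φ Y F) := by
  intro k
  obtain ⟨C, hC, h⟩ := h k
  obtain ⟨C', hC', h'⟩ := h' k
  refine ⟨C + C', add_nonneg hC hC', fun φ Y hφ Ψ => ?_⟩
  obtain ⟨S, hS, hb⟩ := h φ Y hφ Ψ
  obtain ⟨S', hS', hb'⟩ := h' φ Y hφ Ψ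
  refine ⟨S + S', hS.add hS', fun j a b => ?_⟩
  rw [map_add, add_mul]
  exact (norm_add_le _ _).trans (add_le_add (hb j a b) (hb' j a b))

theorem GoodTerm.smul {R : ℝ} {𝒯 : L2R3 → Tracers m → FockFun m → FockFun m}
    (h : GoodTerm R n 𝒯) (c : ℂ) : GoodTerm R n (fun φ Y F => c • 𝒯 φ Y F) := by
  intro k
  obtain ⟨C, hC, h⟩ := h k
  refine ⟨‖c‖ * C, by positivity, fun φ Y hφ Ψ => ?_⟩
  obtain ⟨S, hS, hb⟩ := h φ Y hφ Ψ
  refine ⟨c • S, hS.smul c, fun j a b => ?_⟩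
  rw [map_smul, norm_smul, mul_assoc]
  exact mul_le_mul_of_nonneg_left (hb j a b) (norm_nonneg _)

theorem GoodTerm.sub {R : ℝ} {𝒯 𝒯' : L2R3 → Tracers m → FockFun m → FockFun m}
    (h : GoodTerm R n 𝒯) (h' : GoodTerm R n 𝒯') :
    GoodTerm R n (fun φ Y F => 𝒯 φ Y F - 𝒯' φ Y F) := by
  have := h.add (h'.smul (-1))
  simpa only [neg_one_smul, ← sub_eq_add_neg] using this

theorem goodTerm_of_eq_zero (R : ℝ) {𝒯 : L2R3 → Tracers m → FockFun m → FockFun m}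
    (h : ∀ φ Y F, 𝒯 φ Y F n = 0) : GoodTerm R n 𝒯 := fun k =>
  ⟨0, le_rfl, fun φ Y _ Ψ => ⟨0, by rw [h]; exact rep_zero, fun j a b => by
    rw [map_zero, norm_zero, zero_mul]⟩⟩

/-- Reduces each interaction term to an algebraic factorization into admissible operators. The
source sector satisfies `n' ≤ n + 2` because no term annihilates more than two bosons net. -/
theorem goodTerm_of_op {R : ℝ} {𝒯 : L2R3 → Tracers m → FockFun m → FockFun m}
    (K : L2R3 → Tracers m → (Sector m n' →L[ℂ] Sector m n)) (hn : n' ≤ n + 2)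
    (hK : Admissible R K) (h : ∀ φ Y Ψ, Rep (𝒯 φ Y (toFock Ψ) n) (K φ Y (comp Ψ n'))) :
    GoodTerm R n 𝒯 := by
  intro k
  obtain ⟨C, hC, hb⟩ := hK k
  refine ⟨C, hC, fun φ Y hφ Ψ => ⟨_, h φ Y Ψ, fun j a b => ?_⟩⟩
  refine (hb φ Y hφ j a b _).trans (mul_le_mul_of_nonneg_left ?_ hC)
  exact Finset.single_le_sum (f := fun n' => diffSum k j a b (comp Ψ n'))
    (fun _ _ => diffSum_nonneg _ _ _ _ _) (Finset.mem_range.2 (by omega))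

/-- The average of `w̲` against `|φ|²` is obtained by inserting an auxiliary boson in the state `φ`,
letting the potential act on it and contracting with `φ` again. -/
theorem goodTerm_meanForce (R N : ℝ) (w : 𝓢(R3, ℝ)) (n : ℕ) :
    GoodTerm R n (fun φ (Y : Tracers m) F =>
      mulX (fun X => ∫ x, dW w Y x X * ((N * ‖φ x‖ ^ 2 : ℝ) : ℂ)) F) := by
  refine goodTerm_of_op (n' := n)
    (fun φ Y => (N : ℂ) • (contractOp φ).comp ((potOp w Y).comp (insertOp φ))) (by omega)
    (((admissible_contractOp R).comp ((admissible_potOp R w).comp (admissible_insertOp R))).smul _)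
    fun φ Y Ψ => ?_
  rw [smul_apply, ContinuousLinearMap.comp_apply, ContinuousLinearMap.comp_apply]
  filter_upwards [Lp.coeFn_smul (N : ℂ) (contractOp φ (potOp w Y (insertOp φ (comp Ψ n)))),
    contractOp_coe φ (potOp w Y (insertOp φ (comp Ψ n))),
    ae_ae_join (potOp_coe w Y (insertOp φ (comp Ψ n))),
    ae_ae_join (insertOp_coe φ (comp Ψ n))] with z h1 h2 h3 h4
  rw [h1, Pi.smul_apply, h2, smul_eq_mul, mulX, toFock_eq, ← integral_const_mul,
    ← integral_mul_const]
  refine integral_congr_ae ?_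
  filter_upwards [h3, h4] with x h3 h4
  rw [h3, h4]
  simp only [bosons_join, Fin.cons_zero, tracers_join, dropFirst_join]
  have : ((N * ‖φ x‖ ^ 2 : ℝ) : ℂ) = (N : ℂ) * (conj (φ x) * φ x) := by
    rw [Complex.conj_mul']; push_cast; rfl
  rw [this]
  ring

theorem goodTerm_potential (R : ℝ) (w : 𝓢(R3, ℝ)) (n : ℕ) :
    GoodTerm R n (fun _ (Y : Tracers m) F => creInteg (fun x => mulX (dW w Y x) (ann x F))) := by
  cases n with
  | zero => exact goodTerm_of_eq_zero R fun _ _ _ => rfl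
  | succ n =>
    refine goodTerm_of_op (n' := n + 1)
      (fun _ Y => (creOp m n).comp ((Real.sqrt (n + 1) : ℂ) • potOp w Y)) (by omega)
      ((admissible_creOp R).comp ((admissible_potOp R w).smul _)) fun φ Y Ψ => ?_
    rw [ContinuousLinearMap.comp_apply, smul_apply]
    refine RepFamily.creInteg ?_
    filter_upwards [Lp.coeFn_smul (Real.sqrt (n + 1) : ℂ) (potOp w Y (comp Ψ (n + 1))),
      potOp_coe w Y (comp Ψ (n + 1))] with z h1 h2
    rw [h1, Pi.smul_apply, h2, mulX, ann]
    have := toFock_join Ψ (bosons z 0) (dropFirst z)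
    rw [join_dropFirst] at this
    rw [← this, smul_eq_mul]
    simp only [dropFirst, tracers_config]
    ring

/-- Same insertion and contraction with `v` in place of `w̲`. Evenness of `v` is needed because the
auxiliary boson comes first in the pair potential. -/
theorem goodTerm_hartree (R : ℝ) {v : R3 → ℝ} (hv : MemLp v ⊤ volume) (hv' : ∀ x, v (-x) = v x)
    (n : ℕ) : GoodTerm R n (fun φ (_ : Tracers m) F =>
      creInteg (fun x => (hartree v φ x : ℂ) • ann x F)) := by
  cases n with
  | zero => exact goodTerm_of_eq_zero R fun _ _ _ => rfl
  | succ n =>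
    refine goodTerm_of_op (n' := n + 1)
      (fun φ _ => (creOp m n).comp ((Real.sqrt (n + 1) : ℂ) •
        ((contractOp φ).comp ((pairOp v).comp (insertOp φ))))) (by omega)
      ((admissible_creOp R).comp (((admissible_contractOp R).comp
        ((admissible_pairOp R hv).comp (admissible_insertOp R))).smul _)) fun φ Y Ψ => ?_
    rw [ContinuousLinearMap.comp_apply, smul_apply, ContinuousLinearMap.comp_apply,
      ContinuousLinearMap.comp_apply]
    refine RepFamily.creInteg ?_
    set f := comp Ψ (n + 1) with hf
    filter_upwards [Lp.coeFn_smul (Real.sqrt (n + 1) : ℂ) (contractOp φ (pairOp v (insertOp φ f))),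
      contractOp_coe φ (pairOp v (insertOp φ f)), ae_ae_join (pairOp_coe hv (insertOp φ f)),
      ae_ae_join (insertOp_coe φ f)] with z h1 h2 h3 h4
    rw [h1, Pi.smul_apply, h2, Pi.smul_apply, Pi.smul_apply, Pi.smul_apply, ann]
    have := toFock_join Ψ (bosons z 0) (dropFirst z)
    rw [join_dropFirst, ← hf] at this
    have e : tracers (dropFirst z) = tracers z := rfl
    rw [e] at this
    rw [this, smul_eq_mul, smul_eq_mul, mul_left_comm]
    congr 1
    rw [hartree, ← integral_complex_ofReal, ← integral_mul_const]
    refine integral_congr_ae ?_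
    filter_upwards [h3, h4] with x h3 h4
    rw [h3, h4]
    have e1 : bosons (join x z) 1 = bosons z 0 := rfl
    simp only [bosons_join, Fin.cons_zero, dropFirst_join]
    have e2 : (Fin.cons x (bosons z) : Fin (n + 2) → R3) 1 = bosons z 0 := rfl
    rw [e2, ← hv' (x - bosons z 0), neg_sub]
    push_cast
    rw [← Complex.conj_mul']
    ring

/-- As for the Hartree term, with a swap after the insertion: the inserted `φ` becomes the state of
the surviving boson, and the original boson is contracted. -/
theorem goodTerm_exchange (R : ℝ) {v : R3 → ℝ} (hv : MemLp v ⊤ volume) (n : ℕ) :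
    GoodTerm R n (fun φ (_ : Tracers m) F =>
      creInteg (fun y => integ fun x => ((v (x - y) : ℂ) * conj (φ x) * φ y) • ann x F)) := by
  cases n with
  | zero => exact goodTerm_of_eq_zero R fun _ _ _ => rfl
  | succ n =>
    refine goodTerm_of_op (n' := n + 1)
      (fun φ _ => (creOp m n).comp ((Real.sqrt (n + 1) : ℂ) •
        ((contractOp φ).comp ((pairOp v).comp ((swapOp m n).comp (insertOp φ)))))) (by omega)
      ((admissible_creOp R).comp (((admissible_contractOp R).comp ((admissible_pairOp R hv).comp
        ((admissible_swapOp R).comp (admissible_insertOp R)))).smul _)) fun φ Y Ψ => ?_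
    rw [ContinuousLinearMap.comp_apply, smul_apply, ContinuousLinearMap.comp_apply,
      ContinuousLinearMap.comp_apply, ContinuousLinearMap.comp_apply]
    refine RepFamily.creInteg ?_
    set f := comp Ψ (n + 1) with hf
    filter_upwards [Lp.coeFn_smul (Real.sqrt (n + 1) : ℂ)
        (contractOp φ (pairOp v (swapOp m n (insertOp φ f)))),
      contractOp_coe φ (pairOp v (swapOp m n (insertOp φ f))),
      ae_ae_join (pairOp_coe hv (swapOp m n (insertOp φ f))),
      ae_ae_join (swapOp_coe (insertOp φ f)),
      ae_ae_join (ae_permute (Equiv.swap 0 1) (insertOp_coe φ f))] with z h1 h2 h3 h4 h5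
    rw [h1, Pi.smul_apply, h2, smul_eq_mul, integ, ← integral_const_mul]
    refine integral_congr_ae ?_
    filter_upwards [h3, h4, h5] with x h3 h4 h5
    have e3 : join x z = join x (join (bosons z 0) (dropFirst z)) := by rw [join_dropFirst]
    rw [e3, permute_swap, dropFirst_join] at h5
    rw [h3, h4, dropFirst_join]
    have e4 : bosons (join x z) 0 = x := rfl
    rw [e4, h5]
    rw [Pi.smul_apply, Pi.smul_apply, Pi.smul_apply, ann]
    have := toFock_join Ψ x (dropFirst z)
    rw [← hf] at this
    have e : tracers (dropFirst z) = tracers z := rfl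
    rw [e] at this
    rw [this, smul_eq_mul]
    have e2 : bosons (join x z) 1 = bosons z 0 := rfl
    rw [e2]
    simp only [bosons_join, Fin.cons_zero]
    ring

theorem goodTerm_annihilate (R : ℝ) (w : 𝓢(R3, ℝ)) (n : ℕ) :
    GoodTerm R n (fun φ (Y : Tracers m) F =>
      integ (fun x => mulX (dW w Y x) (conj (φ x) • ann x F))) := by
  refine goodTerm_of_op (n' := n + 1)
    (fun φ Y => (Real.sqrt (n + 1) : ℂ) • (contractOp φ).comp (potOp w Y)) (by omega)
    (((admissible_contractOp R).comp (admissible_potOp R w)).smul _) fun φ Y Ψ => ?_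
  rw [smul_apply, ContinuousLinearMap.comp_apply]
  set f := comp Ψ (n + 1) with hf
  filter_upwards [Lp.coeFn_smul (Real.sqrt (n + 1) : ℂ) (contractOp φ (potOp w Y f)),
    contractOp_coe φ (potOp w Y f), ae_ae_join (potOp_coe w Y f)] with z h1 h2 h3
  rw [h1, Pi.smul_apply, h2, smul_eq_mul, integ, ← integral_const_mul]
  refine integral_congr_ae ?_
  filter_upwards [h3] with x h3
  rw [h3, mulX, Pi.smul_apply, Pi.smul_apply, Pi.smul_apply, ann, toFock_join, ← hf]
  simp only [bosons_join, Fin.cons_zero, tracers_join, smul_eq_mul]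
  ring

theorem goodTerm_create (R : ℝ) (w : 𝓢(R3, ℝ)) (n : ℕ) :
    GoodTerm R n (fun φ (Y : Tracers m) F =>
      creInteg (fun x => mulX (dW w Y x) (φ x • F))) := by
  cases n with
  | zero => exact goodTerm_of_eq_zero R fun _ _ _ => rfl
  | succ n =>
    refine goodTerm_of_op (n' := n)
      (fun φ Y => (creOp m n).comp ((potOp w Y).comp (insertOp φ))) (by omega)
      ((admissible_creOp R).comp ((admissible_potOp R w).comp (admissible_insertOp R)))
      fun φ Y Ψ => ?_
    rw [ContinuousLinearMap.comp_apply, ContinuousLinearMap.comp_apply]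
    refine RepFamily.creInteg ?_
    filter_upwards [potOp_coe w Y (insertOp φ (comp Ψ n)), insertOp_coe φ (comp Ψ n)] with z h1 h2
    rw [h1, h2, mulX, Pi.smul_apply, Pi.smul_apply, Pi.smul_apply]
    have := toFock_eq Ψ (dropFirst z)
    have e : tracers (dropFirst z) = tracers z := rfl
    rw [e] at this
    rw [this]
    rfl

theorem goodTerm_createPair (R : ℝ) {v : R3 → ℝ} (hv : MemLp v ⊤ volume) (n : ℕ) :
    GoodTerm R n (fun φ (_ : Tracers m) F =>
      creInteg (fun x => creInteg fun y => ((v (x - y) : ℂ) * φ x * φ y) • F)) := by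
  rcases n with _ | _ | n
  · exact goodTerm_of_eq_zero R fun _ _ _ => rfl
  · refine goodTerm_of_eq_zero R fun _ _ _ => ?_
    ext X xs
    simp [creInteg]
  · refine goodTerm_of_op (n' := n)
      (fun φ _ => (creOp m (n + 1)).comp ((tailCreOp m n).comp
        ((pairOp v).comp ((insertOp φ).comp (insertOp φ))))) (by omega)
      ((admissible_creOp R).comp ((admissible_tailCreOp R).comp ((admissible_pairOp R hv).comp
        ((admissible_insertOp R).comp (admissible_insertOp R))))) fun φ Y Ψ => ?_
    simp only [ContinuousLinearMap.comp_apply]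
    refine rep_creInteg_creInteg ?_
    filter_upwards [pairOp_coe hv (insertOp φ (insertOp φ (comp Ψ n))),
      insertOp_coe φ (insertOp φ (comp Ψ n)),
      quasiMeasurePreserving_dropFirst.ae (insertOp_coe φ (comp Ψ n))] with z h1 h2 h3
    rw [h1, h2, h3, Pi.smul_apply, Pi.smul_apply, Pi.smul_apply]
    have := toFock_eq Ψ (dropFirst (dropFirst z))
    have e : tracers (dropFirst (dropFirst z)) = tracers z := rfl
    rw [e] at this
    have e2 : bosons z 1 = bosons (dropFirst z) 0 := rfl
    rw [this, smul_eq_mul, e2]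
    ring

theorem goodTerm_annihilatePair (R : ℝ) {v : R3 → ℝ} (hv : MemLp v ⊤ volume)
    (hv' : ∀ x, v (-x) = v x) (n : ℕ) :
    GoodTerm R n (fun φ (_ : Tracers m) F =>
      integ (fun x => integ fun y =>
            ((v (x - y) : ℂ) * conj (φ x) * conj (φ y)) • ann x (ann y F))) := by
  refine goodTerm_of_op (n' := n + 2)
    (fun φ _ => ((Real.sqrt (n + 1) : ℂ) * (Real.sqrt ((n + 1 : ℕ) + 1) : ℂ)) •
      (contractOp φ).comp ((contractOp φ).comp (pairOp v))) (by omega)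
    (((admissible_contractOp R).comp ((admissible_contractOp R).comp
      (admissible_pairOp R hv))).smul _) fun φ Y Ψ => ?_
  rw [smul_apply, ContinuousLinearMap.comp_apply, ContinuousLinearMap.comp_apply]
  set f := comp Ψ (n + 2) with hf
  set c : ℂ := (Real.sqrt (n + 1) : ℂ) * (Real.sqrt ((n + 1 : ℕ) + 1) : ℂ) with hc
  filter_upwards [Lp.coeFn_smul c (contractOp φ (contractOp φ (pairOp v f))),
    contractOp_coe φ (contractOp φ (pairOp v f)),
    ae_ae_join (contractOp_coe φ (pairOp v f)),
    ae_ae_join (ae_ae_join (pairOp_coe hv f))] with z h1 h2 h3 h4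
  rw [h1, Pi.smul_apply, h2, smul_eq_mul, integ, ← integral_const_mul]
  refine integral_congr_ae ?_
  filter_upwards [h3, h4] with x h3 h4
  rw [h3, integ, ← integral_const_mul, ← integral_const_mul]
  refine integral_congr_ae ?_
  filter_upwards [h4] with y h4
  rw [h4, Pi.smul_apply, Pi.smul_apply, Pi.smul_apply, ann, ann, toFock_join_join, ← hf]
  have e1 : bosons (join y (join x z)) 0 = y := rfl
  have e2 : bosons (join y (join x z)) 1 = x := rfl
  rw [e1, e2, ← hv' (y - x), neg_sub, hc, smul_eq_mul]
  push_cast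
  ring

theorem goodTerm_createScatter (R : ℝ) {v : R3 → ℝ} (hv : MemLp v ⊤ volume) (n : ℕ) :
    GoodTerm R n (fun φ (_ : Tracers m) F =>
      creInteg (fun x => creInteg fun y => ((v (x - y) : ℂ) * φ y) • ann x F)) := by
  rcases n with _ | _ | n
  · exact goodTerm_of_eq_zero R fun _ _ _ => rfl
  · refine goodTerm_of_eq_zero R fun _ _ _ => ?_
    ext X xs
    simp [creInteg]
  · refine goodTerm_of_op (n' := n + 1)
      (fun φ _ => (creOp m (n + 1)).comp ((tailCreOp m n).comp
        ((Real.sqrt (n + 1) : ℂ) • (pairOp v).comp ((swapOp m n).comp (insertOp φ))))) (by omega)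
      ((admissible_creOp R).comp ((admissible_tailCreOp R).comp (((admissible_pairOp R hv).comp
        ((admissible_swapOp R).comp (admissible_insertOp R))).smul _))) fun φ Y Ψ => ?_
    simp only [ContinuousLinearMap.comp_apply, smul_apply]
    refine rep_creInteg_creInteg ?_
    set f := comp Ψ (n + 1) with hf
    filter_upwards [Lp.coeFn_smul (Real.sqrt (n + 1) : ℂ) (pairOp v (swapOp m n (insertOp φ f))),
      pairOp_coe hv (swapOp m n (insertOp φ f)), swapOp_coe (insertOp φ f),
      ae_permute (Equiv.swap 0 1) (insertOp_coe φ f)] with z h1 h2 h3 h4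
    have e3 : z = join (bosons z 0) (join (bosons (dropFirst z) 0) (dropFirst (dropFirst z))) := by
      rw [join_dropFirst, join_dropFirst]
    rw [e3, permute_swap, dropFirst_join] at h4
    rw [h1, Pi.smul_apply, h2, h3, h4, Pi.smul_apply, Pi.smul_apply, Pi.smul_apply, ann]
    have := toFock_join Ψ (bosons z 0) (dropFirst (dropFirst z))
    have e : tracers (dropFirst (dropFirst z)) = tracers z := rfl
    rw [e, ← hf] at this
    have e2 : bosons z 1 = bosons (dropFirst z) 0 := rfl
    rw [this, smul_eq_mul, smul_eq_mul, e2]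
    simp only [bosons_join, Fin.cons_zero]
    ring

theorem goodTerm_annihilateScatter (R : ℝ) {v : R3 → ℝ} (hv : MemLp v ⊤ volume) (n : ℕ) :
    GoodTerm R n (fun φ (_ : Tracers m) F =>
      creInteg (fun x => integ fun y =>
            ((v (x - y) : ℂ) * conj (φ y)) • ann y (ann x F))) := by
  cases n with
  | zero => exact goodTerm_of_eq_zero R fun _ _ _ => rfl
  | succ n =>
    refine goodTerm_of_op (n' := n + 2)
      (fun φ _ => (creOp m n).comp (((Real.sqrt (n + 1) : ℂ) * (Real.sqrt ((n + 1 : ℕ) + 1) : ℂ)) •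
        ((contractOp φ).comp ((swapOp m n).comp (pairOp v))))) (by omega)
      ((admissible_creOp R).comp (((admissible_contractOp R).comp ((admissible_swapOp R).comp
        (admissible_pairOp R hv))).smul _)) fun φ Y Ψ => ?_
    simp only [ContinuousLinearMap.comp_apply, smul_apply]
    refine RepFamily.creInteg ?_
    set f := comp Ψ (n + 2) with hf
    set c : ℂ := (Real.sqrt (n + 1) : ℂ) * (Real.sqrt ((n + 1 : ℕ) + 1) : ℂ) with hc
    filter_upwards [Lp.coeFn_smul c (contractOp φ (swapOp m n (pairOp v f))),
      contractOp_coe φ (swapOp m n (pairOp v f)),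
      ae_ae_join (swapOp_coe (pairOp v f)),
      ae_ae_join (ae_permute (Equiv.swap 0 1) (pairOp_coe hv f))] with z h1 h2 h3 h4
    rw [h1, Pi.smul_apply, h2, smul_eq_mul, integ, ← integral_const_mul]
    refine integral_congr_ae ?_
    filter_upwards [h3, h4] with y h3 h4
    have e3 : join y z = join y (join (bosons z 0) (dropFirst z)) := by rw [join_dropFirst]
    rw [e3, permute_swap] at h4
    have e4 : bosons (join y z) 0 = y := rfl
    rw [h3, dropFirst_join, e4, h4, Pi.smul_apply, Pi.smul_apply, Pi.smul_apply, ann, ann]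
    have := toFock_join_join Ψ (bosons z 0) y (dropFirst z)
    have e : tracers (dropFirst z) = tracers z := rfl
    rw [e, ← hf] at this
    have e1 : bosons (join (bosons z 0) (join y (dropFirst z))) 0 = bosons z 0 := rfl
    have e2 : bosons (join (bosons z 0) (join y (dropFirst z))) 1 = y := rfl
    rw [this, e1, e2, hc, smul_eq_mul]
    push_cast
    ring

theorem goodTerm_interaction (R N : ℝ) {v : R3 → ℝ} (hv : MemLp v ⊤ volume)
    (hv' : ∀ x, v (-x) = v x) (w : 𝓢(R3, ℝ)) (n : ℕ) :
    GoodTerm R n (fun φ (Y : Tracers m) F =>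
      diagInt N v w Y φ F + offDiagInt N v w Y φ F) :=
  ((((goodTerm_meanForce R N w n).sub (goodTerm_potential R w n)).add
    (goodTerm_hartree R hv hv' n)).add (goodTerm_exchange R hv n)).add
  (((((goodTerm_annihilate R w n).add (goodTerm_create R w n)).smul _).add
    (((goodTerm_createPair R hv n).add (goodTerm_annihilatePair R hv hv' n)).smul _)).add
    (((goodTerm_createScatter R hv n).add (goodTerm_annihilateScatter R hv n)).smul _))

/-- The differences of the truncated interaction are controlled by those of the vector. -/
theorem exists_source_bound (R N M : ℝ) {v : R3 → ℝ} (hv : MemLp v ⊤ volume)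
    (hv' : ∀ x, v (-x) = v x) (w : 𝓢(R3, ℝ)) (n k : ℕ) : ∃ C : ℝ, 0 ≤ C ∧
      ∀ φ : L2R3, ∀ Y : Tracers m, ‖φ‖ ≤ R → ∀ (Ψ : Hilb m) (S : Sector m n),
      Rep (truncInt N M v w Y φ (toFock Ψ) n) S →
      ∀ j a b, ‖((sweyl n j a b - 1) ^ k) S‖ ≤ C * diffTotal n k j a b Ψ := by
  obtain ⟨C, hC, h⟩ := goodTerm_interaction (m := m) R N hv hv' w n k
  refine ⟨C, hC, fun φ Y hφ Ψ S hS j a b => ?_⟩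
  by_cases hn : (n : ℝ) ≤ M
  · obtain ⟨S', hS', hb⟩ := h φ Y hφ Ψ
    have : S = S' := by
      refine Rep.unique hS ?_
      convert hS' using 1
      ext X xs
      simp [truncInt, cutoff, hn]
    rw [this]
    exact hb j a b
  · have : S = 0 := by
      refine Rep.unique hS ?_
      convert rep_zero using 1
      ext X xs
      simp [truncInt, cutoff, hn]
    rw [this, map_zero, norm_zero]
    exact mul_nonneg hC (diffTotal_nonneg _ _ _ _ _ _)

/-! ### The quartic term as a potential -/

/-- The potential of the quartic term in the `n`-boson sector. -/
def quarticPot (N : ℝ) (v : R3 → ℝ) (z : Config m n) : ℝ :=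
  (2 * N)⁻¹ * ∑ i, ∑ l, if l = i then 0 else v (bosons z i - bosons z l)

theorem quarticPot_add_dir (N : ℝ) (v : R3 → ℝ) (z : Config m n) (j : Fin m × Fin 3) (a : ℝ) :
    quarticPot N v (z + a • dir n j) = quarticPot N v z := by
  rw [quarticPot, quarticPot, bosons_add_dir]

theorem quarticPot_permute (N : ℝ) (v : R3 → ℝ) (σ : Equiv.Perm (Fin n)) (z : Config m n) :
    quarticPot N v (permute σ z) = quarticPot N v z := by
  rw [quarticPot, quarticPot]
  simp only [permute_bosons]
  congr 1
  rw [← Equiv.sum_comp σ.symm (fun i => ∑ l, if l = i then 0 else v (bosons z i - bosons z l))]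
  refine Finset.sum_congr rfl fun i _ => ?_
  rw [← Equiv.sum_comp σ.symm
    (fun l => if l = σ.symm i then 0 else v (bosons z (σ.symm i) - bosons z l))]
  simp

theorem permute_pair (i : Fin (n + 2)) (l : Fin (n + 1)) (z : Config m (n + 2)) :
    permute (tailPerm l.cycleRange) (permute i.cycleRange z) =
      join (bosons z i) (join (i.removeNth (bosons z) l)
        (config (tracers z) (l.removeNth (i.removeNth (bosons z))))) := by
  rw [permute_cycleRange, bringFirst, permute_tailPerm, permute_cycleRange, bringFirst,
    bosons_config, tracers_config]

theorem quarticPot_eq (N : ℝ) (v : R3 → ℝ) (z : Config m (n + 2)) :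
    quarticPot N v z = (2 * N)⁻¹ * ∑ i : Fin (n + 2), ∑ l : Fin (n + 1),
      v (bosons z i - i.removeNth (bosons z) l) := by
  rw [quarticPot]
  congr 1
  refine Finset.sum_congr rfl fun i _ => ?_
  rw [Fin.sum_univ_succAbove _ i]
  simp [Fin.removeNth]

theorem quarticPot_of_le_one (N : ℝ) (v : R3 → ℝ) (hn : n ≤ 1) (z : Config m n) :
    quarticPot N v z = 0 := by
  have : Subsingleton (Fin n) := Fin.subsingleton_iff_le_one.2 hn
  rw [quarticPot, Finset.sum_eq_zero, mul_zero]
  exact fun i _ => Finset.sum_eq_zero fun l _ => if_pos (Subsingleton.elim _ _)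

theorem memLp_quarticPot (N : ℝ) {v : R3 → ℝ} (hv : MemLp v ⊤ volume) :
    MemLp (fun z : Config m n => (quarticPot N v z : ℂ)) ⊤ volume := by
  rcases n with _ | _ | n
  · simp_rw [quarticPot_of_le_one N v (Nat.zero_le 1)]
    simp
  · simp_rw [quarticPot_of_le_one N v (Nat.le_refl 1)]
    simp
  · have key : ∀ (i : Fin (n + 2)) (l : Fin (n + 1)), MemLp (fun z : Config m (n + 2) =>
        (v (bosons z i - i.removeNth (bosons z) l) : ℂ)) ⊤ volume := fun i l => by
      -- Two relabellings bring the bosons `i` and `l` to the first two places, which reduces every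
      -- pair to the pair `(0,1)`.
      have h : (fun z : Config m (n + 2) => (v (bosons z i - i.removeNth (bosons z) l) : ℂ)) =
          ((fun z : Config m (n + 2) => (v (bosons z 0 - bosons z 1) : ℂ)) ∘
            permute (tailPerm l.cycleRange)) ∘ permute i.cycleRange := by
        ext z
        simp only [Function.comp_apply, permute_pair]
        rfl
      rw [h]
      exact ((memLp_pair (m := m) (n := n) hv).comp_measurePreserving
        (permute (tailPerm l.cycleRange)).measurePreserving).comp_measurePreserving
        (permute i.cycleRange).measurePreserving
    have h2 := (memLp_finsetSum Finset.univ fun i _ => memLp_finsetSum Finset.univ fun l _ =>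
      key i l).const_mul (2 * (N : ℂ))⁻¹
    simp_rw [quarticPot_eq]
    push_cast
    exact h2

theorem ae_comp_permute (Ψ : Hilb m) (n : ℕ) :
    ∀ᵐ z : Config m n, ∀ σ : Equiv.Perm (Fin n), comp Ψ n (permute σ z) = comp Ψ n z := by
  refine eventually_all.2 fun σ => ?_
  have h : permuteL2 σ (comp Ψ n) = comp Ψ n := Ψ.2 n σ
  filter_upwards [permuteL2_coe σ (comp Ψ n)] with z hz
  rw [← hz, h]

/-- Symmetry makes all rearranged arguments of `Ψ` equal, and the square roots of the two
annihilations cancel those of the two creations. What remains is a pair potential depending on the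
boson positions only. -/
theorem quarticInt_eq (N : ℝ) (v : R3 → ℝ) (Ψ : Hilb m) (n : ℕ) :
    ∀ᵐ z : Config m n, quarticInt N v (toFock Ψ) n (tracers z) (bosons z) =
      (quarticPot N v z : ℂ) * comp Ψ n z := by
  rcases n with _ | _ | n
  · refine Eventually.of_forall fun z => ?_
    rw [quarticPot_of_le_one N v (Nat.zero_le 1)]
    simp [quarticInt, creInteg]
  · refine Eventually.of_forall fun z => ?_
    rw [quarticPot_of_le_one N v (Nat.le_refl 1)]
    simp [quarticInt, creInteg]
  · have h0 := ae_comp_permute Ψ (n + 2)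
    have h1 : ∀ᵐ z : Config m (n + 2), ∀ i : Fin (n + 2), ∀ σ : Equiv.Perm (Fin (n + 2)),
        comp Ψ (n + 2) (permute σ (permute i.cycleRange z)) =
          comp Ψ (n + 2) (permute i.cycleRange z) :=
      eventually_all.2 fun i => ae_permute i.cycleRange h0
    have h2 : ∀ᵐ z : Config m (n + 2), ∀ (i : Fin (n + 2)) (l : Fin (n + 1)),
        ∀ σ : Equiv.Perm (Fin (n + 2)),
        comp Ψ (n + 2) (permute σ (permute (tailPerm l.cycleRange) (permute i.cycleRange z))) =
          comp Ψ (n + 2) (permute (tailPerm l.cycleRange) (permute i.cycleRange z)) :=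
      eventually_all.2 fun i => eventually_all.2 fun l =>
        ae_permute i.cycleRange (ae_permute (tailPerm l.cycleRange) h0)
    filter_upwards [h0, h1, h2] with z h0 h1 h2
    have key : ∀ (i : Fin (n + 2)) (l : Fin (n + 1)),
        toFock Ψ (n + 2) (tracers z) (Fin.cons (i.removeNth (bosons z) l) (Fin.cons (bosons z i)
          (l.removeNth (i.removeNth (bosons z))))) = comp Ψ (n + 2) z := fun i l => by
      rw [← h0 i.cycleRange, ← h1 i (tailPerm l.cycleRange), ← h2 i l (Equiv.swap 0 1),
        permute_pair, permute_swap]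
      rfl
    have hs1 : (((Real.sqrt ((n : ℝ) + 1) : ℝ) : ℂ)) ≠ 0 := by
      rw [Complex.ofReal_ne_zero]; positivity
    have hs2 : (((Real.sqrt (((n + 1 : ℕ) : ℝ) + 1) : ℝ) : ℂ)) ≠ 0 := by
      rw [Complex.ofReal_ne_zero]; positivity
    simp only [quarticInt, Pi.smul_apply, creInteg, ann, smul_eq_mul, key]
    rw [quarticPot_eq]
    push_cast
    rw [Finset.mul_sum, Finset.mul_sum, Finset.mul_sum, Finset.sum_mul]
    refine Finset.sum_congr rfl fun i _ => ?_
    rw [Finset.mul_sum, Finset.mul_sum, Finset.mul_sum, Finset.mul_sum, Finset.sum_mul]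
    refine Finset.sum_congr rfl fun l _ => ?_
    push_cast at hs2
    field_simp

/-! ### Conjugation of Weyl operators by the free evolution -/

theorem continuous_tracers : Continuous (tracers : Config m n → Tracers m) := by
  unfold tracers
  fun_prop

theorem continuous_bosons (i : Fin n) : Continuous (fun z : Config m n => bosons z i) := by
  unfold bosons
  fun_prop

theorem measurable_kineticSymbol (N : ℝ) :
    Measurable (kineticSymbol N : Config m n → ℝ) := by
  have h1 := (continuous_tracers (m := m) (n := n)).measurable
  have h2 := fun i : Fin n => (continuous_bosons (m := m) i).measurable
  unfold kineticSymbol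
  refine Measurable.add (by fun_prop) (Finset.measurable_sum _ fun i _ => ?_)
  have := h2 i
  fun_prop

theorem kineticSymbol_permute (N : ℝ) (σ : Equiv.Perm (Fin n)) (ξ : Config m n) :
    kineticSymbol N (permute σ ξ) = kineticSymbol N ξ := by
  rw [kineticSymbol, kineticSymbol, permute_tracers]
  simp only [permute_bosons]
  rw [Equiv.sum_comp σ.symm (fun i => (2 * Real.pi * ‖bosons ξ i‖) ^ 2)]

theorem norm_sq_tracers_add_dir (ξ : Config m n) (j : Fin m × Fin 3) (c : ℝ) :
    ‖tracers (ξ + c • dir n j)‖ ^ 2 = ‖tracers ξ‖ ^ 2 + 2 * c * tracers ξ j + c ^ 2 := by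
  have h : tracers (ξ + c • dir n j) = tracers ξ + c • EuclideanSpace.single j (1 : ℝ) := by
    ext p
    obtain ⟨l, k⟩ := p
    obtain ⟨l', k'⟩ := j
    simp [tracers, dir, PiLp.single_apply]
  rw [h, norm_add_sq_real, inner_smul_right, norm_smul, EuclideanSpace.inner_single_right]
  simp
  ring

theorem kineticSymbol_add_dir (N : ℝ) (ξ : Config m n) (j : Fin m × Fin 3) (c : ℝ) :
    kineticSymbol N (ξ + c • dir n j) =
      kineticSymbol N ξ + (2 * Real.pi) ^ 2 * (2 * c * tracers ξ j + c ^ 2) / (2 * N) := by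
  rw [kineticSymbol, kineticSymbol, bosons_add_dir, mul_pow, norm_sq_tracers_add_dir, mul_pow]
  ring

theorem fourier_sweyl (j : Fin m × Fin 3) (a b : ℝ) (f : Sector m n) :
    𝓕 (sweyl n j a b f) =
      sweyl n j (-(2 * Real.pi)⁻¹ * b) (2 * Real.pi * a) (𝓕 f : Sector m n) := by
  rw [sweyl, fourier_weyl, smul_smul, smul_smul, sweyl]

/-- The Heisenberg motion `X ↦ X - τP/N`. In Fourier space the Weyl operator shifts `ξ_j`, which
changes the quadratic kinetic phase by a linear phase; this alters `a`, and the constant term is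
absorbed by the half-shift in the Weyl phase. -/
theorem sweyl_freeOp (N : ℝ) (hN : N ≠ 0) (τ : ℝ) (j : Fin m × Fin 3) (a b : ℝ)
    (f : Sector m n) :
    sweyl n j a b (freeOp (kineticSymbol N) τ f) =
      freeOp (kineticSymbol N) τ (sweyl n j (a - τ * b / N) b f) := by
  refine fourier_injective ?_
  rw [fourier_freeOp, fourier_sweyl, fourier_sweyl, fourier_freeOp]
  set c := -(2 * Real.pi)⁻¹ * b with hc
  have hs := memLp_freePhase (measurable_kineticSymbol (m := m) (n := n) N) τ
  refine Lp.ext ?_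
  filter_upwards [sweyl_coe j c (2 * Real.pi * a)
      (mulOp volume (freePhase (kineticSymbol N) τ) (𝓕 f : Sector m n)),
    ae_add_right (c • dir n j) (mulOp_coe hs (𝓕 f : Sector m n)),
    mulOp_coe hs (sweyl n j c (2 * Real.pi * (a - τ * b / N)) (𝓕 f : Sector m n)),
    sweyl_coe j c (2 * Real.pi * (a - τ * b / N)) (𝓕 f : Sector m n)] with ξ h1 h2 h3 h4
  rw [h1, h2, h3, h4, ← mul_assoc, ← mul_assoc, freePhase, freePhase, ← Complex.exp_add,
    ← Complex.exp_add, ← mul_add, ← mul_add, ← Complex.ofReal_add, ← Complex.ofReal_add,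
    kineticSymbol_add_dir]
  congr 4
  have hπ := Real.pi_ne_zero
  rw [hc]
  field_simp
  ring

theorem sweyl_sub_one_pow_freeOp (N : ℝ) (hN : N ≠ 0) (τ : ℝ) (j : Fin m × Fin 3) (a b : ℝ)
    (k : ℕ) : ∀ f : Sector m n,
    ((sweyl n j a b - 1) ^ k) (freeOp (kineticSymbol N) τ f) =
      freeOp (kineticSymbol N) τ (((sweyl n j (a - τ * b / N) b - 1) ^ k) f) := by
  induction k with
  | zero => intro f; rfl
  | succ k ih =>
    intro f
    rw [pow_succ, pow_succ, mul_apply_eq_comp, mul_apply_eq_comp, ← ih, sub_apply, sub_apply,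
      freeOp_sub, sweyl_freeOp N hN]
    rfl

/-! ### Vectors with given components -/

theorem summable_comp (Ψ : Hilb m) : Summable fun n => ‖comp Ψ n‖ ^ 2 := by
  have h := (lp.hasSum_norm (by norm_num) (Ψ : lp (fun n => Sector m n) 2)).summable
  simpa [comp] using h

theorem norm_sq_hilb (Ψ : Hilb m) : ‖Ψ‖ ^ 2 = ∑' n, ‖comp Ψ n‖ ^ 2 := by
  have h := lp.norm_rpow_eq_tsum (by norm_num) (Ψ : lp (fun n => Sector m n) 2)
  simpa [comp] using h

theorem exists_hilb (f : ∀ n, Sector m n) (hf : ∀ n (σ : Equiv.Perm (Fin n)), permuteL2 σ (f n) = f n)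
    (hs : Summable fun n => ‖f n‖ ^ 2) : ∃ Φ : Hilb m, ∀ n, comp Φ n = f n := by
  have h : Memℓp f 2 := memℓp_gen (by simpa using hs)
  exact ⟨⟨⟨f, h⟩, hf⟩, fun n => rfl⟩

/-- The `n`-boson component as a bounded operator. -/
def compL (n : ℕ) : Hilb m →L[ℂ] Sector m n :=
  (lp.evalCLM ℂ (fun n => Sector m n) 2 n).comp (bosonic m).subtypeL

theorem continuous_comp (n : ℕ) : Continuous fun Ψ : Hilb m => comp Ψ n := (compL n).continuous

theorem comp_sub (Ψ Φ : Hilb m) (n : ℕ) : comp (Ψ - Φ) n = comp Ψ n - comp Φ n := rfl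

theorem comp_smul (c : ℂ) (Ψ : Hilb m) (n : ℕ) : comp (c • Ψ) n = c • comp Ψ n := rfl

theorem permuteL2_mulOp {q : Config m n → ℂ} (hq : MemLp q ⊤ volume) (σ : Equiv.Perm (Fin n))
    (hσ : ∀ z, q (permute σ z) = q z) (f : Sector m n) :
    permuteL2 σ (mulOp volume q f) = mulOp volume q (permuteL2 σ f) := by
  refine Lp.ext ?_
  filter_upwards [permuteL2_coe σ (mulOp volume q f), ae_permute σ (mulOp_coe hq f),
    mulOp_coe hq (permuteL2 σ f), permuteL2_coe σ f] with z h1 h2 h3 h4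
  rw [h1, h2, h3, h4, hσ]

theorem fourier_permuteL2 (σ : Equiv.Perm (Fin n)) (f : Sector m n) :
    𝓕 (permuteL2 σ f) = permuteL2 σ (𝓕 f : Sector m n) :=
  fourier_compIsometry (permute σ) f

theorem permuteL2_fourierInv (σ : Equiv.Perm (Fin n)) (f : Sector m n) :
    permuteL2 σ (𝓕⁻ f : Sector m n) = 𝓕⁻ (permuteL2 σ f) := by
  refine fourier_injective ?_
  rw [fourier_permuteL2, fourier_fourierInv_eq, fourier_fourierInv_eq]

/-! ### Density of the domain -/

/-- The indicator of `{s ≤ R}`. -/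
def lowPass (s : Config m n → ℝ) (R : ℝ) (ξ : Config m n) : ℂ := if s ξ ≤ R then 1 else 0

theorem norm_lowPass_le (s : Config m n → ℝ) (R : ℝ) (ξ : Config m n) : ‖lowPass s R ξ‖ ≤ 1 := by
  unfold lowPass
  split_ifs <;> simp

theorem measurable_lowPass {s : Config m n → ℝ} (hs : Measurable s) (R : ℝ) :
    Measurable (lowPass s R) :=
  Measurable.ite (measurableSet_le hs measurable_const) measurable_const measurable_const

theorem kineticSymbol_nonneg {N : ℝ} (hN : 0 ≤ N) (ξ : Config m n) : 0 ≤ kineticSymbol N ξ := by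
  unfold kineticSymbol
  positivity

/-- Truncation to kinetic energy at most `R` and at most `R` bosons lands in the domain. Both
cut-offs are permutation-invariant, and finitely many sectors make `ℍΨ` square summable without any
bound uniform in `n`. -/
theorem dense_hamDomain {N : ℝ} (hN : 0 ≤ N) {v : R3 → ℝ} (hv : MemLp v ⊤ volume) :
    Dense (HamDomain (m := m) N v) := by
  intro Ψ
  have hk : ∀ n, Measurable (kineticSymbol N : Config m n → ℝ) := fun n =>
    measurable_kineticSymbol N
  have hl : ∀ n (R : ℝ), MemLp (lowPass (kineticSymbol N : Config m n → ℝ) R) ⊤ volume :=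
    fun n R => memLp_top_of_norm_le (measurable_lowPass (hk n) R).aestronglyMeasurable
      (norm_lowPass_le _ R)
  have hkl : ∀ n (R : ℕ), MemLp (fun ξ : Config m n => (kineticSymbol N ξ : ℂ) *
      lowPass (kineticSymbol N) R ξ) ⊤ volume := fun n R => by
    refine memLp_top_of_norm_le (C := R) ?_ fun ξ => ?_
    · exact ((Complex.measurable_ofReal.comp (hk n)).mul
        (measurable_lowPass (hk n) R)).aestronglyMeasurable
    · have := kineticSymbol_nonneg hN ξ
      unfold lowPass
      split_ifs with h
      · simpa [abs_of_nonneg this] using h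
      · simp
  let f : ℕ → ∀ n, Sector m n := fun R n =>
    if n ≤ R then 𝓕⁻ (mulOp volume (lowPass (kineticSymbol N) R) (𝓕 (comp Ψ n) : Sector m n)) else 0
  have hfn : ∀ R n, ‖f R n‖ ≤ ‖comp Ψ n‖ := fun R n => by
    simp only [f]
    split_ifs
    · rw [← Lp.norm_fourier_eq, fourier_fourierInv_eq]
      refine (norm_mulOp_apply_le (hl n R) zero_le_one
        (Eventually.of_forall (norm_lowPass_le _ _)) _).trans ?_
      rw [one_mul, Lp.norm_fourier_eq]
    · simp
  have hsymm : ∀ n (σ : Equiv.Perm (Fin n)), permuteL2 σ (comp Ψ n) = comp Ψ n := Ψ.2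
  have hfs : ∀ R n (σ : Equiv.Perm (Fin n)), permuteL2 σ (f R n) = f R n := fun R n σ => by
    simp only [f]
    split_ifs
    · rw [permuteL2_fourierInv, permuteL2_mulOp (hl n R) σ (fun z => by
        rw [lowPass, kineticSymbol_permute, lowPass]), ← fourier_permuteL2, hsymm]
    · rw [map_zero]
  choose Φ hΦ using fun R => exists_hilb (f R) (hfs R) ((summable_comp Ψ).of_nonneg_of_le
    (fun n => by positivity) fun n => by gcongr; exact hfn R n)
  refine mem_closure_of_tendsto (f := Φ) (b := atTop) ?_ (Eventually.of_forall fun R => ?_)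
  · rw [tendsto_iff_norm_sub_tendsto_zero]
    have h1 : Tendsto (fun R => ‖Φ R - Ψ‖ ^ 2) atTop (𝓝 0) := by
      simp_rw [norm_sq_hilb, comp_sub, hΦ]
      have h2 : (0 : ℝ) = ∑' _ : ℕ, (0 : ℝ) := by simp
      rw [h2]
      refine tendsto_tsum_of_dominated_convergence (bound := fun n => (2 * ‖comp Ψ n‖) ^ 2)
        ?_ (fun n => ?_) (Eventually.of_forall fun R n => ?_)
      · simp_rw [mul_pow]
        exact (summable_comp Ψ).mul_left _
      · have h3 : Tendsto (fun R : ℕ => mulOp volume (fun ξ : Config m n =>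
            lowPass (kineticSymbol N) R ξ - 1) (𝓕 (comp Ψ n) : Sector m n)) atTop (𝓝 0) := by
          refine tendsto_mulOp_zero (l := atTop) (C := 2) (fun R : ℕ =>
            ((measurable_lowPass (hk n) R).sub_const 1).aestronglyMeasurable) (fun R ξ => ?_)
            (fun ξ => ?_) _
          · refine (norm_sub_le _ _).trans ?_
            have := norm_lowPass_le (kineticSymbol N) R ξ
            rw [norm_one]
            linarith
          · refine tendsto_const_nhds.congr' ?_
            obtain ⟨R₀, hR₀⟩ := exists_nat_ge (kineticSymbol N ξ)
            filter_upwards [eventually_ge_atTop R₀] with R hR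
            rw [lowPass, if_pos (hR₀.trans (by exact_mod_cast hR)), sub_self]
        have h4 := (h3.norm).pow 2
        rw [norm_zero, zero_pow two_ne_zero] at h4
        refine h4.congr' ?_
        filter_upwards [eventually_ge_atTop n] with R hR
        simp only [f, if_pos hR]
        rw [← Lp.norm_fourier_eq (_ - comp Ψ n), fourier_sub', fourier_fourierInv_eq,
          ← mulOp_sub (hl n R) (memLp_top_const _), mulOp_one]
        rfl
      · rw [Real.norm_of_nonneg (by positivity)]
        gcongr
        refine (norm_sub_le _ _).trans ?_
        have := hfn R n
        linarith
    have h2 := h1.sqrt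
    simpa using h2
  · have hq : ∀ n, MemLp (fun z : Config m n => (quarticPot N v z : ℂ)) ⊤ volume :=
      fun n => memLp_quarticPot N hv
    let κ : ∀ n, Sector m n := fun n => if n ≤ R then 𝓕⁻ (mulOp volume (fun ξ =>
      (kineticSymbol N ξ : ℂ) * lowPass (kineticSymbol N) R ξ) (𝓕 (comp Ψ n) : Sector m n)) else 0
    have hκs : ∀ n (σ : Equiv.Perm (Fin n)), permuteL2 σ (κ n) = κ n := fun n σ => by
      simp only [κ]
      split_ifs
      · rw [permuteL2_fourierInv, permuteL2_mulOp (hkl n R) σ (fun z => by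
          rw [lowPass, kineticSymbol_permute, lowPass]), ← fourier_permuteL2, hsymm]
      · rw [map_zero]
    obtain ⟨Θ, hΘ⟩ := exists_hilb (fun n => κ n + mulOp volume
      (fun z : Config m n => (quarticPot N v z : ℂ)) (f R n)) (fun n σ => by
        rw [map_add, hκs, permuteL2_mulOp (hq n) σ (fun z => by rw [quarticPot_permute]), hfs])
      (by
        refine summable_of_hasFiniteSupport ((Set.finite_Iic R).subset fun n hn => ?_)
        by_contra h
        apply hn
        simp only [Set.mem_Iic] at h
        simp [κ, f, h])
    refine ⟨Θ, fun n => ⟨κ n, ?_, ?_⟩⟩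
    · rw [FourierMul, hΦ]
      simp only [κ, f]
      split_ifs
      · rw [fourier_fourierInv_eq, fourier_fourierInv_eq]
        filter_upwards [mulOp_coe (hkl n R) (𝓕 (comp Ψ n) : Sector m n),
          mulOp_coe (hl n R) (𝓕 (comp Ψ n) : Sector m n)] with ξ h1 h2
        rw [h1, h2, mul_assoc]
      · have h0 : (𝓕 (0 : Sector m n) : Sector m n) = 0 :=
          (Lp.fourierTransformₗᵢ (Config m n) ℂ).map_zero
        rw [h0]
        filter_upwards [Lp.coeFn_zero ℂ 2 (volume : Measure (Config m n))] with ξ h1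
        rw [h1]
        simp
    · rw [hΘ]
      filter_upwards [Lp.coeFn_add (κ n) (mulOp volume
        (fun z : Config m n => (quarticPot N v z : ℂ)) (f R n)), mulOp_coe (hq n) (f R n),
        quarticInt_eq N v (Φ R) n] with z h1 h2 h3
      rw [h1, Pi.add_apply, h2, h3, hΦ]

/-! ### Evolution of the differences -/

theorem hasDerivAt_norm_sq {H : Type*} [NormedAddCommGroup H] [InnerProductSpace ℂ H]
    [NormedSpace ℝ H] [IsScalarTower ℝ ℂ H] {f : ℝ → H} {f' : H} {t : ℝ} (hf : HasDerivAt f f' t) :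
    HasDerivAt (fun r => ‖f r‖ ^ 2) (2 * (inner ℂ (f t) f').re) t := by
  have h := Complex.reCLM.hasFDerivAt.comp_hasDerivAt t (hf.inner ℂ hf)
  have e : (fun r => ‖f r‖ ^ 2) = Complex.reCLM ∘ fun r => inner ℂ (f r) (f r) := by
    ext r
    rw [Function.comp_apply, inner_self_eq_norm_sq_to_K, Complex.reCLM_apply]
    norm_cast
  rw [e]
  refine h.congr_deriv ?_
  rw [← inner_conj_symm f', Complex.reCLM_apply, Complex.add_re, Complex.conj_re]
  ring

/-- Interaction picture: the unbounded kinetic part of `ℍΨ` cancels against the derivative of the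
free evolution. Only the quartic potential and the truncated interaction `i∂_tΨ - ℍΨ` remain. -/
theorem hasDerivAt_freeOp_comp {N : ℝ} {v : R3 → ℝ} (hv : MemLp v ⊤ volume) (n : ℕ)
    (s t : ℝ) {Ψ : ℝ → Hilb m} {dΨ Θ : Hilb m}
    (hΨ : HasDerivAt Ψ dΨ t) (hΘ : HamGraph N v (Ψ t) Θ) :
    HasDerivAt (fun r => freeOp (kineticSymbol N) (r - s) (comp (Ψ r) n))
      (freeOp (kineticSymbol N) (t - s) ((-Complex.I) •
        (mulOp volume (fun z : Config m n => (quarticPot N v z : ℂ)) (comp (Ψ t) n) +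
          comp (Complex.I • dΨ - Θ) n))) t := by
  obtain ⟨κ, hκ, hΘ⟩ := hΘ n
  have hq := memLp_quarticPot (m := m) (n := n) N hv
  set Q := mulOp volume (fun z : Config m n => (quarticPot N v z : ℂ)) with hQ
  have hΘ' : comp Θ n = κ + Q (comp (Ψ t) n) := by
    refine Lp.ext ?_
    filter_upwards [hΘ, quarticInt_eq N v (Ψ t) n, mulOp_coe hq (comp (Ψ t) n),
      Lp.coeFn_add κ (Q (comp (Ψ t) n))] with z h1 h2 h3 h4
    rw [h1, h2, h4, Pi.add_apply, h3]
  have h1 : HasDerivAt (fun r => comp (Ψ r) n) (comp dΨ n) t :=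
    ((compL n).restrictScalars ℝ).hasFDerivAt.comp_hasDerivAt t hΨ
  have h2 := hasDerivAt_freeOp (measurable_kineticSymbol (m := m) (n := n) N) s t h1 hκ
  have e1 : comp dΨ n + Complex.I • κ =
      (-Complex.I) • (Q (comp (Ψ t) n) + comp (Complex.I • dΨ - Θ) n) := by
    rw [comp_sub, comp_smul, hΘ']
    simp only [smul_add, smul_sub, smul_smul, neg_mul, Complex.I_mul_I, neg_neg, one_smul, neg_smul]
    abel
  rwa [e1] at h2

/-- By `sweyl_sub_one_pow_freeOp` the drifting difference has the norm of a fixed difference of the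
interaction-picture vector, which is differentiable. The quartic term contributes the imaginary part
of the expectation of a real multiplication, which is zero. -/
theorem hasDerivAt_diff_sq {N : ℝ} (hN : N ≠ 0) {v : R3 → ℝ} (hv : MemLp v ⊤ volume) (n : ℕ)
    (j : Fin m × Fin 3) (a b : ℝ) (k : ℕ) (s t : ℝ) {Ψ : ℝ → Hilb m} {dΨ Θ : Hilb m}
    (hΨ : HasDerivAt Ψ dΨ t) (hΘ : HamGraph N v (Ψ t) Θ) :
    HasDerivAt (fun r => ‖((sweyl n j (a - (r - s) * b / N) b - 1) ^ k) (comp (Ψ r) n)‖ ^ 2)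
      (2 * (inner ℂ (((sweyl n j (a - (t - s) * b / N) b - 1) ^ k) (comp (Ψ t) n))
        (((sweyl n j (a - (t - s) * b / N) b - 1) ^ k) (comp (Complex.I • dΨ - Θ) n))).im) t := by
  have hs := measurable_kineticSymbol (m := m) (n := n) N
  have hq := memLp_quarticPot (m := m) (n := n) N hv
  have hcov : Covariant (mulOp volume (fun z : Config m n => (quarticPot N v z : ℂ))) :=
    covariant_mulOp hq fun z j a => by rw [quarticPot_add_dir]
  have h2 := hasDerivAt_freeOp_comp hv n s t hΨ hΘ
  generalize comp (Complex.I • dΨ - Θ) n = S at h2 ⊢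
  have h3 : HasDerivAt (fun r => ((sweyl n j a b - 1) ^ k)
      (freeOp (kineticSymbol N) (r - s) (comp (Ψ r) n))) _ t :=
    (((sweyl n j a b - 1) ^ k).restrictScalars ℝ).hasFDerivAt.comp_hasDerivAt t h2
  have h4 := hasDerivAt_norm_sq h3
  simp only [ContinuousLinearMap.coe_restrictScalars', sweyl_sub_one_pow_freeOp N hN,
    norm_freeOp hs, inner_freeOp hs] at h4
  refine h4.congr_deriv ?_
  rw [map_smul, map_add, hcov.sub_one_pow, inner_smul_right, inner_add_right, Complex.mul_re,
    Complex.add_im, im_inner_mulOp_real hq]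
  simp

/-- The indices of the differences entering the energy. -/
abbrev energyIdx (k L : ℕ) : Finset (ℕ × ℕ) := Finset.range (k + 1) ×ˢ Finset.range L

/-- The weighted difference of order `p.1` in the sector with `p.2` bosons. -/
def wdiff (k : ℕ) (j : Fin m × Fin 3) (h a b : ℝ) (Ψ : Hilb m) (p : ℕ × ℕ) : ℝ :=
  |h| ^ (k - p.1) * ‖((sweyl p.2 j a b - 1) ^ p.1) (comp Ψ p.2)‖

theorem wdiff_nonneg (k : ℕ) (j : Fin m × Fin 3) (h a b : ℝ) (Ψ : Hilb m) (p : ℕ × ℕ) :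
    0 ≤ wdiff k j h a b Ψ p := by unfold wdiff; positivity

/-- The sum of the squares of the weighted differences up to order `k` in the sectors with less
than `L` bosons. -/
def energy (k L : ℕ) (j : Fin m × Fin 3) (h a b : ℝ) (Ψ : Hilb m) : ℝ :=
  ∑ p ∈ energyIdx k L, wdiff k j h a b Ψ p ^ 2

theorem energy_nonneg (k L : ℕ) (j : Fin m × Fin 3) (h a b : ℝ) (Ψ : Hilb m) :
    0 ≤ energy k L j h a b Ψ := Finset.sum_nonneg fun _ _ => sq_nonneg _

theorem continuous_energy (k L : ℕ) (j : Fin m × Fin 3) (h a b : ℝ) :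
    Continuous (energy k L j h a b : Hilb m → ℝ) := by
  unfold energy wdiff
  refine continuous_finsetSum _ fun p _ => ?_
  have h1 : Continuous fun Ψ : Hilb m => ((sweyl p.2 j a b - 1) ^ p.1) (comp Ψ p.2) :=
    ((sweyl p.2 j a b - 1) ^ p.1).continuous.comp (continuous_comp p.2)
  exact (continuous_const.mul h1.norm).pow 2

theorem rep_comp_eq_zero {N M : ℝ} {v w : R3 → ℝ} {Y : Tracers m} {φ : L2R3} {Ψ Ξ : Hilb m}
    (h : Represents (truncInt N M v w Y φ (toFock Ψ)) Ξ) (hn : M < n) : comp Ξ n = 0 := by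
  refine Rep.unique (h n) ?_
  convert rep_zero using 1
  ext X xs
  simp [truncInt, cutoff, hn.not_ge]

theorem exists_energy_rate (R N M : ℝ) {K : ℝ} (hK : 1 ≤ K) {v : R3 → ℝ} (hv : MemLp v ⊤ volume)
    (hv' : ∀ x, v (-x) = v x) (w : 𝓢(R3, ℝ)) (k : ℕ) : ∃ C : ℝ, 0 ≤ C ∧
      ∀ φ : L2R3, ∀ Y : Tracers m, ‖φ‖ ≤ R → ∀ Ψ Ξ : Hilb m,
      Represents (truncInt N M v w Y φ (toFock Ψ)) Ξ → ∀ j h a b, |a| ≤ K * |h| →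
      |∑ p ∈ energyIdx k (⌊M⌋₊ + 3), (|h| ^ (k - p.1)) ^ 2 *
        (2 * (inner ℂ (((sweyl p.2 j a b - 1) ^ p.1) (comp Ψ p.2))
          (((sweyl p.2 j a b - 1) ^ p.1) (comp Ξ p.2))).im)| ≤
        C * energy k (⌊M⌋₊ + 3) j h a b Ψ := by
  choose C hC hsrc using fun n i => exists_source_bound (m := m) R N M hv hv' w n i
  -- Sectors `n < L`, that is `n ≤ ⌊M⌋ + 2`: those with a source together with all sectors feeding
  -- them.
  set L := ⌊M⌋₊ + 3 with hL
  set C₀ := ∑ p ∈ energyIdx k L, C p.2 p.1 with hC₀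
  have hC₀0 : 0 ≤ C₀ := Finset.sum_nonneg fun p _ => hC _ _
  refine ⟨2 * (C₀ * K ^ k) * (energyIdx k L).card, by positivity,
    fun φ Y hφ Ψ Ξ hΞ j h a b hab => ?_⟩
  set x := wdiff k j h a b Ψ with hx
  have hx0 : ∀ p, 0 ≤ x p := wdiff_nonneg k j h a b Ψ
  set X := ∑ p ∈ energyIdx k L, x p with hX
  have hX0 : 0 ≤ X := Finset.sum_nonneg fun p _ => hx0 p
  have hy : ∀ p ∈ energyIdx k L, wdiff k j h a b Ξ p ≤ C₀ * K ^ k * X := by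
    rintro ⟨i, n⟩ hp
    have hik : i ≤ k := Nat.lt_succ_iff.1 (Finset.mem_range.1 (Finset.mem_product.1 hp).1)
    unfold wdiff
    simp only
    by_cases hn : M < n
    · rw [rep_comp_eq_zero hΞ hn, map_zero, norm_zero, mul_zero]
      positivity
    · have hnL : n + 3 ≤ L := by
        have := Nat.le_floor (not_lt.1 hn)
        omega
      have h1 := hsrc n i φ Y hφ Ψ (comp Ξ n) (hΞ n) j a b
      have h2 : |h| ^ (k - i) * diffTotal n i j a b Ψ ≤ K ^ k * X := by
        have h3 : |h| ^ (k - i) * diffTotal n i j a b Ψ ≤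
            K ^ k * ∑ p ∈ energyIdx i (n + 3), x p := by
          rw [Finset.sum_product_right, Finset.mul_sum, diffTotal, Finset.mul_sum]
          refine Finset.sum_le_sum fun n' _ => ?_
          rw [diffSum, Finset.mul_sum, Finset.mul_sum]
          refine Finset.sum_le_sum fun l hl => ?_
          have hli : l ≤ i := Nat.lt_succ_iff.1 (Finset.mem_range.1 hl)
          rw [hx, wdiff, ← mul_assoc, ← mul_assoc]
          refine mul_le_mul_of_nonneg_right ?_ (norm_nonneg _)
          -- The direction stays of size `h`, so the weights `|a|^(i-l)` of the source estimate turn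
          -- into the weights of the energy.
          calc |h| ^ (k - i) * |a| ^ (i - l) ≤ |h| ^ (k - i) * (K * |h|) ^ (i - l) := by gcongr
            _ = K ^ (i - l) * |h| ^ (k - l) := by
                rw [mul_pow, mul_left_comm, ← pow_add]
                congr 2
                omega
            _ ≤ K ^ k * |h| ^ (k - l) := by
                gcongr
                omega
        refine h3.trans ?_
        gcongr
        refine Finset.sum_le_sum_of_subset_of_nonneg ?_ fun p _ _ => hx0 p
        exact Finset.product_subset_product (Finset.range_subset_range.2 (by omega))
          (Finset.range_subset_range.2 hnL)
      calc |h| ^ (k - i) * ‖((sweyl n j a b - 1) ^ i) (comp Ξ n)‖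
          ≤ |h| ^ (k - i) * (C n i * diffTotal n i j a b Ψ) := by gcongr
        _ = C n i * (|h| ^ (k - i) * diffTotal n i j a b Ψ) := by ring
        _ ≤ C₀ * (K ^ k * X) := by
            refine mul_le_mul ?_ h2 (mul_nonneg (by positivity) (diffTotal_nonneg _ _ _ _ _ _))
              hC₀0
            exact Finset.single_le_sum (f := fun p : ℕ × ℕ => C p.2 p.1)
              (fun p _ => hC p.2 p.1) hp
        _ = _ := by ring
  have hterm : ∀ p ∈ energyIdx k L, |(|h| ^ (k - p.1)) ^ 2 *
        (2 * (inner ℂ (((sweyl p.2 j a b - 1) ^ p.1) (comp Ψ p.2))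
          (((sweyl p.2 j a b - 1) ^ p.1) (comp Ξ p.2))).im)| ≤ x p * (2 * (C₀ * K ^ k * X)) := by
    intro p hp
    set f := ((sweyl p.2 j a b - 1) ^ p.1) (comp Ψ p.2)
    set g := ((sweyl p.2 j a b - 1) ^ p.1) (comp Ξ p.2)
    have h1 : |(inner ℂ f g).im| ≤ ‖f‖ * ‖g‖ :=
      (Complex.abs_im_le_norm _).trans (norm_inner_le_norm _ _)
    rw [abs_mul, abs_mul, abs_two, abs_of_nonneg (by positivity)]
    calc (|h| ^ (k - p.1)) ^ 2 * (2 * |(inner ℂ f g).im|)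
        ≤ (|h| ^ (k - p.1)) ^ 2 * (2 * (‖f‖ * ‖g‖)) := by gcongr
      _ = x p * (2 * wdiff k j h a b Ξ p) := by rw [hx, wdiff, wdiff]; ring
      _ ≤ _ := by
        have := hy p hp
        have := hx0 p
        gcongr
  calc _ ≤ ∑ p ∈ energyIdx k L, x p * (2 * (C₀ * K ^ k * X)) :=
        (Finset.abs_sum_le_sum_abs _ _).trans (Finset.sum_le_sum hterm)
    _ = 2 * (C₀ * K ^ k) * X ^ 2 := by rw [← Finset.sum_mul, ← hX]; ring
    _ ≤ 2 * (C₀ * K ^ k) * ((energyIdx k L).card * energy k L j h a b Ψ) := by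
        gcongr
        exact sq_sum_le_card_mul_sum_sq
    _ = _ := by ring

theorem hasDerivAt_energy {N : ℝ} (hN : N ≠ 0) {v : R3 → ℝ} (hv : MemLp v ⊤ volume) (k L : ℕ)
    (j : Fin m × Fin 3) (h a b : ℝ) (s t : ℝ) {Ψ : ℝ → Hilb m} {dΨ Θ : Hilb m}
    (hΨ : HasDerivAt Ψ dΨ t) (hΘ : HamGraph N v (Ψ t) Θ) :
    HasDerivAt (fun r => energy k L j h (a - (r - s) * b / N) b (Ψ r))
      (∑ p ∈ energyIdx k L, (|h| ^ (k - p.1)) ^ 2 *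
        (2 * (inner ℂ (((sweyl p.2 j (a - (t - s) * b / N) b - 1) ^ p.1) (comp (Ψ t) p.2))
          (((sweyl p.2 j (a - (t - s) * b / N) b - 1) ^ p.1)
            (comp (Complex.I • dΨ - Θ) p.2))).im)) t := by
  have e : (fun r => energy k L j h (a - (r - s) * b / N) b (Ψ r)) = fun r =>
      ∑ p ∈ energyIdx k L, (|h| ^ (k - p.1)) ^ 2 *
        ‖((sweyl p.2 j (a - (r - s) * b / N) b - 1) ^ p.1) (comp (Ψ r) p.2)‖ ^ 2 := by
    ext r
    simp only [energy, wdiff, mul_pow]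
  rw [e]
  exact HasDerivAt.fun_sum fun p _ =>
    (hasDerivAt_diff_sq hN hv p.2 j a b p.1 s t hΨ hΘ).const_mul _

/-- Gronwall's inequality along the drifting direction. The constant is uniform in `h`, hence an
initial size `h^(2k)` survives. -/
theorem exists_energy_bound {N M : ℝ} (hN : 1 ≤ N) {v : R3 → ℝ} (hv : MemLp v ⊤ volume)
    (hv' : ∀ x, v (-x) = v x) (w : 𝓢(R3, ℝ)) {X : ℝ → Tracers m} {φ : ℝ → L2R3}
    (hφ : Continuous φ) {U : ℝ → ℝ → Hilb m →L[ℂ] Hilb m}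
    (hU : IsTruncatedPropagator N M v w X φ U) (k : ℕ) (α β s t : ℝ) :
    ∃ C : ℝ, 0 ≤ C ∧ ∀ (Ψ : Hilb m) j h,
      energy k (⌊M⌋₊ + 3) j h (α * h - (t - s) * (β * h) / N) (β * h) (U t s Ψ) ≤
        C * energy k (⌊M⌋₊ + 3) j h (α * h) (β * h) Ψ := by
  have hN0 : N ≠ 0 := by positivity
  obtain ⟨R, hR⟩ := (isCompact_uIcc (a := s) (b := t)).exists_bound_of_continuousOn hφ.continuousOn
  -- Bounds the drifting shift `αh - (r - s)βh/N` by `K|h|` for all `r` between `s` and `t`, using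
  -- `N ≥ 1`.
  set K := 1 + |α| + |t - s| * |β| with hKdef
  have hK : 1 ≤ K := by
    have : 0 ≤ |t - s| * |β| := by positivity
    have := abs_nonneg α
    linarith
  obtain ⟨C, hC, hrate⟩ := exists_energy_rate (m := m) R N M hK hv hv' w k
  set L := ⌊M⌋₊ + 3 with hL
  refine ⟨Real.exp (C * |t - s|), (Real.exp_pos _).le, fun Ψ j h => ?_⟩
  have hclosed : IsClosed {Ψ : Hilb m |
      energy k L j h (α * h - (t - s) * (β * h) / N) (β * h) (U t s Ψ) ≤
        Real.exp (C * |t - s|) * energy k L j h (α * h) (β * h) Ψ} :=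
    isClosed_le ((continuous_energy _ _ _ _ _ _).comp (U t s).continuous)
      (continuous_const.mul (continuous_energy _ _ _ _ _ _))
  -- For fixed `h` both sides are continuous in `Ψ`, as only bounded operators occur. It is
  -- therefore enough to argue on `𝒟(ℍ)`, where the evolution equation holds.
  refine closure_minimal ?_ hclosed (dense_hamDomain (by linarith : 0 ≤ N) hv Ψ)
  intro Ψ hΨ
  obtain ⟨dΨ, Θ, -, hd, -, hΘ, hrep⟩ := hU.solves Ψ hΨ s
  have hder := fun r => hasDerivAt_energy hN0 hv k L j h (α * h) (β * h) s r (hd r) (hΘ r)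
  set E' : ℝ → ℝ := fun r => ∑ p ∈ energyIdx k L, (|h| ^ (k - p.1)) ^ 2 *
        (2 * (inner ℂ (((sweyl p.2 j (α * h - (r - s) * (β * h) / N) (β * h) - 1) ^ p.1)
          (comp (U r s Ψ) p.2)) (((sweyl p.2 j (α * h - (r - s) * (β * h) / N) (β * h) - 1) ^ p.1)
            (comp (Complex.I • dΨ r - Θ r) p.2))).im) with hE'
  set E : ℝ → ℝ := fun r => energy k L j h (α * h - (r - s) * (β * h) / N) (β * h) (U r s Ψ) with hE
  have hEb : ∀ r ∈ Set.uIcc s t, |E' r| ≤ C * E r := fun r hr => by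
    refine hrate (φ r) (X r) (hR r hr) (U r s Ψ) _ (hrep r) j h _ _ ?_
    have h1 : |r - s| ≤ |t - s| := Set.abs_sub_left_of_mem_uIcc hr
    calc |α * h - (r - s) * (β * h) / N| ≤ |α * h| + |(r - s) * (β * h) / N| := abs_sub _ _
      _ ≤ |α| * |h| + |t - s| * (|β| * |h|) := by
          rw [abs_mul, abs_div, abs_mul, abs_mul β h, abs_of_pos (by linarith : 0 < N)]
          gcongr
          refine (div_le_self (by positivity) hN).trans ?_
          gcongr
      _ ≤ K * |h| := by
          rw [hKdef]
          nlinarith [abs_nonneg h]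
  -- Parametrizing the segment from `s` to `t` by `[0,1]` lets one forward Gronwall argument cover
  -- both time directions.
  have hF : ∀ x : ℝ, HasDerivAt (fun x => E (s + x * (t - s))) (E' (s + x * (t - s)) * (t - s)) x :=
    fun x => by
      have h1 : HasDerivAt (fun x : ℝ => s + x * (t - s)) (t - s) x := by
        simpa using ((hasDerivAt_id x).mul_const (t - s)).const_add s
      exact (hder (s + x * (t - s))).comp x h1
  have hEnn : ∀ r, 0 ≤ E r := fun r => energy_nonneg _ _ _ _ _ _ _
  have hmem : ∀ x ∈ Set.Icc (0 : ℝ) 1, s + x * (t - s) ∈ Set.uIcc s t := fun x hx => by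
    rw [Set.mem_uIcc]
    rcases le_total s t with hst | hst
    · left
      constructor <;> nlinarith [hx.1, hx.2]
    · right
      constructor <;> nlinarith [hx.1, hx.2]
  have key := norm_le_gronwallBound_of_norm_deriv_right_le
    (f := fun x => E (s + x * (t - s))) (f' := fun x => E' (s + x * (t - s)) * (t - s))
    (δ := E s) (K := C * |t - s|) (ε := 0) (a := 0) (b := 1)
    (fun x _ => (hF x).continuousAt.continuousWithinAt)
    (fun x _ => (hF x).hasDerivWithinAt)
    (by simp [abs_of_nonneg (hEnn s)])
    (fun x hx => by
      rw [Real.norm_eq_abs, Real.norm_eq_abs, abs_mul, abs_of_nonneg (hEnn _), add_zero]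
      have := hEb _ (hmem x ⟨hx.1, hx.2.le⟩)
      calc _ ≤ C * E (s + x * (t - s)) * |t - s| := by gcongr
        _ = _ := by ring) 1 ⟨zero_le_one, le_rfl⟩
  rw [gronwallBound_ε0, Real.norm_eq_abs, abs_of_nonneg (hEnn _)] at key
  have e1 : s + 1 * (t - s) = t := by ring
  have e2 : E s = energy k L j h (α * h) (β * h) Ψ := by
    simp [hE, hU.self_eq]
  rw [e1, e2, sub_zero, mul_one, mul_comm] at key
  exact key

/-- Above the cut-off there is no source, so the derivative of the squared norm vanishes. With `k =
0` this is conservation of the norm in each such sector. -/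
theorem norm_diff_eq {N M : ℝ} (hN : 1 ≤ N) {v : R3 → ℝ} (hv : MemLp v ⊤ volume)
    {w : R3 → ℝ} {X : ℝ → Tracers m} {φ : ℝ → L2R3} {U : ℝ → ℝ → Hilb m →L[ℂ] Hilb m}
    (hU : IsTruncatedPropagator N M v w X φ U) (k : ℕ) (j : Fin m × Fin 3) (a b s t : ℝ)
    (hn : M < n) (Ψ : Hilb m) :
    ‖((sweyl n j (a - (t - s) * b / N) b - 1) ^ k) (comp (U t s Ψ) n)‖ =
      ‖((sweyl n j a b - 1) ^ k) (comp Ψ n)‖ := by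
  have hN0 : N ≠ 0 := by positivity
  have hclosed : IsClosed {Ψ : Hilb m |
      ‖((sweyl n j (a - (t - s) * b / N) b - 1) ^ k) (comp (U t s Ψ) n)‖ =
      ‖((sweyl n j a b - 1) ^ k) (comp Ψ n)‖} :=
    isClosed_eq ((ContinuousLinearMap.continuous _).comp
        ((continuous_comp n).comp (U t s).continuous)).norm
      ((ContinuousLinearMap.continuous _).comp (continuous_comp n)).norm
  refine closure_minimal ?_ hclosed (dense_hamDomain (by linarith : 0 ≤ N) hv Ψ)
  intro Ψ hΨ
  obtain ⟨dΨ, Θ, -, hd, -, hΘ, hrep⟩ := hU.solves Ψ hΨ s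
  have hder : ∀ r, HasDerivAt (fun r => ‖((sweyl n j (a - (r - s) * b / N) b - 1) ^ k)
      (comp (U r s Ψ) n)‖ ^ 2) 0 r := fun r => by
    have := hasDerivAt_diff_sq hN0 hv n j a b k s r (hd r) (hΘ r)
    rwa [rep_comp_eq_zero (hrep r) hn, map_zero, inner_zero_right, Complex.zero_im, mul_zero] at this
  have h1 := is_const_of_deriv_eq_zero (fun r => (hder r).differentiableAt)
    (fun r => (hder r).deriv) t s
  have h2 := (pow_left_inj₀ (norm_nonneg _) (norm_nonneg _) two_ne_zero).1 h1
  simpa [hU.self_eq] using h2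

/-! ### Moments and differences -/

theorem sweyl_zero_left (j : Fin m × Fin 3) (b : ℝ) :
    sweyl n j 0 b = mulOp volume (fun z : Config m n =>
      Complex.exp (Complex.I * ((b * tracers z j : ℝ) : ℂ))) := by
  have h : MemLp (fun z : Config m n => Complex.exp (Complex.I * ((b * tracers z j : ℝ) : ℂ)))
      ⊤ volume := by
    have hc := continuous_tracers (m := m) (n := n)
    refine memLp_top_of_norm_le (C := 1) (Continuous.aestronglyMeasurable (by fun_prop))
      fun z => ?_
    rw [mul_comm, Complex.norm_exp_ofReal_mul_I]
  ext1 f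
  refine Lp.ext ?_
  filter_upwards [sweyl_coe j 0 b f, mulOp_coe h f] with z h1 h2
  rw [h1, h2, zero_div, add_zero, zero_smul, add_zero]

theorem measurable_tracers_apply (j : Fin m × Fin 3) (c : ℝ) :
    Measurable fun z : Config m n => c * tracers z j := by
  have hc := continuous_tracers (m := m) (n := n)
  exact Continuous.measurable (by fun_prop)

theorem sweyl_phase_eq (j : Fin m × Fin 3) (c b : ℝ) :
    sweyl n j 0 (c * b) = mulOp volume (fun z : Config m n =>
      Complex.exp (Complex.I * ((b * (c * tracers z j) : ℝ) : ℂ))) := by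
  rw [sweyl_zero_left]
  congr 1
  ext z
  congr 3
  ring

theorem norm_phase_diff_le (j : Fin m × Fin 3) (c : ℝ) (i : ℕ) {f g : Sector m n}
    (hg : ∀ᵐ z, g z = (((c * ‖tracers z‖) ^ i : ℝ) : ℂ) * f z) (b : ℝ) :
    ‖((sweyl n j 0 (c * b) - 1) ^ i) f‖ ≤ |b| ^ i * ‖g‖ := by
  rw [sweyl_phase_eq]
  refine norm_mulOp_phase_sub_one_pow_le (measurable_tracers_apply j c) f g i ?_ b
  filter_upwards [hg] with z hz
  rw [hz, norm_mul, Complex.norm_real, norm_pow, norm_mul, abs_mul, norm_norm, Real.norm_eq_abs]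
  gcongr
  exact PiLp.norm_apply_le (tracers z) j

theorem fourier_sweyl_sub_one_pow (j : Fin m × Fin 3) (a b : ℝ) (k : ℕ) : ∀ f : Sector m n,
    𝓕 (((sweyl n j a b - 1) ^ k) f) =
      ((sweyl n j (-(2 * Real.pi)⁻¹ * b) (2 * Real.pi * a) - 1) ^ k) (𝓕 f : Sector m n) := by
  induction k with
  | zero => intro f; rfl
  | succ k ih =>
    intro f
    rw [pow_succ, pow_succ, mul_apply_eq_comp, mul_apply_eq_comp, ih, sub_apply, sub_apply,
      fourier_sub', fourier_sweyl]
    rfl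

theorem norm_shift_diff (j : Fin m × Fin 3) (a : ℝ) (k : ℕ) (f : Sector m n) :
    ‖((sweyl n j a 0 - 1) ^ k) f‖ = ‖((sweyl n j 0 (2 * Real.pi * a) - 1) ^ k) (𝓕 f : Sector m n)‖ := by
  rw [← Lp.norm_fourier_eq, fourier_sweyl_sub_one_pow, mul_zero]

theorem norm_pow_le_sum (x : Tracers m) (k : ℕ) :
    ‖x‖ ^ (k + 1) ≤ (Fintype.card (Fin m × Fin 3) : ℝ) ^ k * ∑ j, |x j| ^ (k + 1) := by
  have h1 : ‖x‖ ≤ ∑ j, |x j| := by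
    refine abs_le_of_sq_le_sq' ?_ (Finset.sum_nonneg fun _ _ => abs_nonneg _) |>.2
    rw [EuclideanSpace.norm_sq_eq]
    exact Finset.sum_sq_le_sq_sum_of_nonneg fun _ _ => norm_nonneg _
  refine (pow_le_pow_left₀ (norm_nonneg _) h1 _).trans ?_
  exact pow_sum_le_card_mul_sum_pow (fun _ _ => abs_nonneg _) k

/-- Difference bounds in all tracer coordinates bound the moments of the tracer variable. -/
theorem exists_moment {c : ℝ} (hc : 0 ≤ c) (k : ℕ) (f : Sector m n) {A : ℝ} (hA : 0 ≤ A)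
    (hb : ∀ j h, 0 < h → h ≤ 1 → ‖((sweyl n j 0 (c * h) - 1) ^ (k + 1)) f‖ ≤ A * h ^ (k + 1)) :
    ∃ g : Sector m n, (∀ᵐ z, g z = (((c * ‖tracers z‖) ^ (k + 1) : ℝ) : ℂ) * f z) ∧
      ‖g‖ ≤ (Fintype.card (Fin m × Fin 3) : ℝ) ^ (k + 1) * A := by
  set D : ℝ := (Fintype.card (Fin m × Fin 3) : ℝ) with hD
  have h1 : ∀ j : Fin m × Fin 3, eLpNorm (fun z : Config m n =>
      (((c * tracers z j) ^ (k + 1) : ℝ) : ℂ) * f z) 2 volume ≤ ENNReal.ofReal A := fun j => by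
    refine eLpNorm_pow_mul_le_of_bound (measurable_tracers_apply j c) f (k + 1) fun h h0 h1 => ?_
    rw [← sweyl_phase_eq]
    exact hb j h h0 h1
  have hm : ∀ j : Fin m × Fin 3, AEStronglyMeasurable (fun z : Config m n =>
      ‖(((c * tracers z j) ^ (k + 1) : ℝ) : ℂ) * f z‖) volume := fun j => by
    refine AEStronglyMeasurable.norm (AEStronglyMeasurable.mul ?_ (Lp.aestronglyMeasurable f))
    exact (Complex.measurable_ofReal.comp
      ((measurable_tracers_apply j c).pow_const _)).aestronglyMeasurable
  have h2 : eLpNorm (fun z : Config m n => (((c * ‖tracers z‖) ^ (k + 1) : ℝ) : ℂ) * f z) 2 volume ≤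
      ENNReal.ofReal (D ^ (k + 1) * A) := by
    -- Comparing `‖𝐗‖` with the `ℓ¹` norm gives a factor `D^k` from the power mean inequality;
    -- summing the coordinate bounds gives one more factor `D`.
    have h3 : eLpNorm (∑ j, fun z : Config m n =>
        ‖(((c * tracers z j) ^ (k + 1) : ℝ) : ℂ) * f z‖) 2 volume ≤ ENNReal.ofReal (D * A) := by
      refine (eLpNorm_sum_le (fun j _ => hm j) (by norm_num)).trans ?_
      have h4 : ∀ j : Fin m × Fin 3, eLpNorm (fun z : Config m n =>
          ‖(((c * tracers z j) ^ (k + 1) : ℝ) : ℂ) * f z‖) 2 volume ≤ ENNReal.ofReal A := fun j => by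
        rw [eLpNorm_norm]; exact h1 j
      refine (Finset.sum_le_sum fun j _ => h4 j).trans (le_of_eq ?_)
      rw [Finset.sum_const, Finset.card_univ, nsmul_eq_mul, ENNReal.ofReal_mul (by positivity), hD,
        ENNReal.ofReal_natCast]
    have h5 : ∀ᵐ z : Config m n, ‖(((c * ‖tracers z‖) ^ (k + 1) : ℝ) : ℂ) * f z‖ ≤
        D ^ k * ‖(∑ j, fun z : Config m n =>
          ‖(((c * tracers z j) ^ (k + 1) : ℝ) : ℂ) * f z‖) z‖ := by
      refine Eventually.of_forall fun z => ?_
      rw [Finset.sum_apply, Real.norm_of_nonneg (Finset.sum_nonneg fun _ _ => norm_nonneg _)]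
      simp only [norm_mul, Complex.norm_real, norm_pow, Real.norm_eq_abs, abs_of_nonneg hc, abs_norm]
      rw [← Finset.sum_mul, ← mul_assoc]
      refine mul_le_mul_of_nonneg_right ?_ (norm_nonneg _)
      simp only [mul_pow]
      rw [← Finset.mul_sum, mul_left_comm]
      exact mul_le_mul_of_nonneg_left (norm_pow_le_sum (tracers z) k) (by positivity)
    refine (eLpNorm_le_mul_eLpNorm_of_ae_le_mul h5 2).trans ?_
    refine (mul_le_mul_right h3 _).trans (le_of_eq ?_)
    rw [← ENNReal.ofReal_mul (by positivity), pow_succ, mul_assoc]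
  have hmeas : AEStronglyMeasurable (fun z : Config m n =>
      (((c * ‖tracers z‖) ^ (k + 1) : ℝ) : ℂ) * f z) volume := by
    have hct := continuous_tracers (m := m) (n := n)
    exact AEStronglyMeasurable.mul (Continuous.aestronglyMeasurable (by fun_prop))
      (Lp.aestronglyMeasurable f)
  have hL : MemLp (fun z : Config m n => (((c * ‖tracers z‖) ^ (k + 1) : ℝ) : ℂ) * f z) 2 volume :=
    ⟨hmeas, h2.trans_lt ENNReal.ofReal_lt_top⟩
  refine ⟨hL.toLp, hL.coeFn_toLp, ?_⟩
  rw [Lp.norm_toLp]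
  exact ENNReal.toReal_le_of_le_ofReal (by positivity) h2

theorem permuteL2_of_moment {c : ℝ} {k : ℕ} {f g : Sector m n} (σ : Equiv.Perm (Fin n))
    (hg : ∀ᵐ z, g z = (((c * ‖tracers z‖) ^ k : ℝ) : ℂ) * f z) (hf : permuteL2 σ f = f) :
    permuteL2 σ g = g := by
  have hf' := permuteL2_coe σ f
  rw [hf] at hf'
  refine Lp.ext ?_
  filter_upwards [permuteL2_coe σ g, ae_permute σ hg, hg, hf'] with z h1 h2 h3 h4
  rw [h1, h2, h3, h4, permute_tracers]

theorem permuteL2_comp (Ψ : Hilb m) (n : ℕ) (σ : Equiv.Perm (Fin n)) :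
    permuteL2 σ (comp Ψ n) = comp Ψ n := Ψ.2 n σ

/-! ### Difference bounds for the initial data -/

theorem mem_domXPow_of_mem_dInfty {Ψ : Hilb m} (hΨ : Ψ ∈ DInfty m) (i : ℕ) : Ψ ∈ DomXPow m i := by
  rcases Nat.eq_zero_or_pos i with rfl | hi
  · exact ⟨Ψ, fun n => Eventually.of_forall fun z => by simp⟩
  · exact (Set.mem_iInter₂.1 hΨ i hi).1.1

theorem mem_domPPow_of_mem_dInfty {Ψ : Hilb m} (hΨ : Ψ ∈ DInfty m) (i : ℕ) : Ψ ∈ DomPPow m i := by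
  rcases Nat.eq_zero_or_pos i with rfl | hi
  · exact ⟨Ψ, fun n => Eventually.of_forall fun z => by simp⟩
  · exact (Set.mem_iInter₂.1 hΨ i hi).1.2

theorem summable_sq_sum {ι : Type*} (s : Finset ι) {f : ι → ℕ → ℝ}
    (hf : ∀ i ∈ s, Summable fun n => f i n ^ 2) : Summable fun n => (∑ i ∈ s, f i n) ^ 2 := by
  refine Summable.of_nonneg_of_le (fun n => sq_nonneg _) (fun n => sq_sum_le_card_mul_sum_sq) ?_
  exact (summable_sum hf).mul_left _

/-- The sector constants come from the vectors `|𝐗|^i Ψ` and `|𝐏|^i Ψ`, which lie in the Hilbert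
space; this is the origin of the square summability. -/
theorem exists_initial_bound {Ψ : Hilb m} (hΨ : Ψ ∈ DInfty m) (α β : ℝ) (k : ℕ) :
    ∃ A : ℕ → ℝ, (∀ n, 0 ≤ A n) ∧ (Summable fun n => A n ^ 2) ∧ ∀ n j h, |h| ≤ 1 →
      ‖((sweyl n j (α * h) (β * h) - 1) ^ k) (comp Ψ n)‖ ≤ A n * |h| ^ k := by
  choose F hF using mem_domXPow_of_mem_dInfty hΨ
  choose P hP using mem_domPPow_of_mem_dInfty hΨ
  obtain ⟨C₀, hC₀, hph⟩ := exists_diffBound_quadraticPhase (α * β / 2) k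
  -- Orders up to `2k` enter, since a mixed difference of order `k` costs `2k` pure ones. The
  -- prefactor absorbs the scaling of the directions by `α` and `β`.
  set B : ℕ → ℝ := fun n => (1 + |α| + |β|) ^ (2 * k) *
    ∑ i ∈ Finset.range (2 * k + 1), (‖comp (F i) n‖ + ‖comp (P i) n‖) with hB
  have hB0 : ∀ n, 0 ≤ B n := fun n => by
    rw [hB]
    exact mul_nonneg (by positivity) (Finset.sum_nonneg fun i _ => by positivity)
  have hsum : Summable fun n => B n ^ 2 := by
    simp only [hB, mul_pow]
    refine Summable.mul_left _ (summable_sq_sum _ fun i _ => ?_)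
    refine Summable.of_nonneg_of_le (fun n => sq_nonneg _) (fun n => add_sq_le) ?_
    exact ((summable_comp (F i)).add (summable_comp (P i))).mul_left 2
  have hle : ∀ n i, i ≤ 2 * k → ∀ c : ℝ, |c| ≤ 1 + |α| + |β| → ∀ x : ℝ, 0 ≤ x →
      x ≤ ‖comp (F i) n‖ + ‖comp (P i) n‖ → ∀ h : ℝ, |c * h| ^ i * x ≤ B n * |h| ^ i := by
    intro n i hi c hc x hx hxF h
    have h1 : |c| ^ i ≤ (1 + |α| + |β|) ^ (2 * k) :=
      (pow_le_pow_left₀ (abs_nonneg c) hc i).trans (pow_le_pow_right₀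
        (by have := abs_nonneg α; have := abs_nonneg β; linarith) hi)
    have h2 : x ≤ ∑ i ∈ Finset.range (2 * k + 1), (‖comp (F i) n‖ + ‖comp (P i) n‖) :=
      hxF.trans (Finset.single_le_sum (f := fun i => ‖comp (F i) n‖ + ‖comp (P i) n‖)
        (fun i _ => by positivity) (Finset.mem_range.2 (by omega)))
    rw [abs_mul, mul_pow, mul_right_comm]
    exact mul_le_mul_of_nonneg_right (mul_le_mul h1 h2 hx (by positivity)) (by positivity)
  refine ⟨fun n => Real.sqrt (2 ^ (2 * k) * (C₀ * (2 ^ (2 * k)))) * B n,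
    fun n => mul_nonneg (Real.sqrt_nonneg _) (hB0 n), ?_, fun n j h hh => ?_⟩
  · simp only [mul_pow]
    exact hsum.mul_left _
  · have hin : inner ℝ (β • dir n j) (α • dir n j) / 2 = α * β / 2 := by
      rw [inner_smul_left, inner_smul_right, inner_dir, tracers_dir_self]
      simp
      ring
    have key := norm_weyl_diff_le (k := k) hC₀ (α • dir n j) (β • dir n j)
      (by rw [hin]; exact hph) (comp Ψ n) (B n) (hB0 n)
      (fun i hi h _ => by
        have h1 := norm_phase_diff_le (n := n) j 1 i (f := comp Ψ n) (g := comp (F i) n)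
          (by simpa only [one_mul] using hF i n) (β * h)
        rw [one_mul] at h1
        have e : weyl 0 (h • β • dir n j) = sweyl n j 0 (β * h) := by
          rw [sweyl, zero_smul, smul_smul, mul_comm]
        rw [e]
        refine h1.trans (hle n i hi β ?_ _ (norm_nonneg _) ?_ h)
        · have := abs_nonneg α; linarith
        · have := norm_nonneg (comp (P i) n); linarith)
      (fun i hi h _ => by
        have h1 := norm_phase_diff_le (n := n) j (2 * Real.pi) i
          (f := (𝓕 (comp Ψ n) : Sector m n)) (g := (𝓕 (comp (P i) n) : Sector m n))
          (hP i n) (α * h)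
        have e : weyl (h • α • dir n j) 0 = sweyl n j (α * h) 0 := by
          rw [sweyl, zero_smul, smul_smul, mul_comm]
        rw [e, norm_shift_diff]
        rw [Lp.norm_fourier_eq] at h1
        refine h1.trans (hle n i hi α ?_ _ (norm_nonneg _) ?_ h)
        · have := abs_nonneg β; linarith
        · have := norm_nonneg (comp (F i) n); linarith) h hh
    rw [smul_smul, smul_smul, mul_comm h, mul_comm h] at key
    exact key

/-! ### Propagation -/

theorem exists_final_bound {N M : ℝ} (hN : 1 ≤ N) {v : R3 → ℝ} (hv : MemLp v ⊤ volume)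
    (hv' : ∀ x, v (-x) = v x) (w : 𝓢(R3, ℝ)) {X : ℝ → Tracers m} {φ : ℝ → L2R3}
    (hφ : Continuous φ) {U : ℝ → ℝ → Hilb m →L[ℂ] Hilb m}
    (hU : IsTruncatedPropagator N M v w X φ U) {Ψ : Hilb m} (hΨ : Ψ ∈ DInfty m)
    (k : ℕ) (α β s t : ℝ) :
    ∃ A : ℕ → ℝ, (∀ n, 0 ≤ A n) ∧ (Summable fun n => A n ^ 2) ∧ ∀ n j h, |h| ≤ 1 →
      ‖((sweyl n j (α * h - (t - s) * (β * h) / N) (β * h) - 1) ^ k) (comp (U t s Ψ) n)‖ ≤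
        A n * |h| ^ k := by
  choose A hA0 hAs hA using exists_initial_bound hΨ α β
  obtain ⟨C, hC, hen⟩ := exists_energy_bound hN hv hv' w hφ hU k α β s t
  set L := ⌊M⌋₊ + 3 with hL
  set B := ∑ p ∈ energyIdx k L, A p.1 p.2 ^ 2 with hB
  have hB0 : 0 ≤ B := Finset.sum_nonneg fun _ _ => sq_nonneg _
  -- Below `L` the energy bound applies, and its constant is harmless in finitely many sectors. From
  -- `L` on the initial bound is conserved, so summability of the tail is inherited.
  refine ⟨fun n => if n < L then Real.sqrt (C * B) else A k n, fun n => ?_, ?_, fun n j h hh => ?_⟩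
  · dsimp only
    split_ifs
    · exact Real.sqrt_nonneg _
    · exact hA0 k n
  · refine (summable_nat_add_iff L).1 ?_
    simpa using (summable_nat_add_iff L).2 (hAs k)
  · dsimp only
    split_ifs with hn
    · have h1 : energy k L j h (α * h) (β * h) Ψ ≤ B * (|h| ^ k) ^ 2 := by
        rw [energy, hB, Finset.sum_mul]
        refine Finset.sum_le_sum fun p hp => ?_
        have hpk : p.1 ≤ k := Nat.lt_succ_iff.1 (Finset.mem_range.1 (Finset.mem_product.1 hp).1)
        rw [← mul_pow]
        refine pow_le_pow_left₀ (wdiff_nonneg _ _ _ _ _ _ _) ?_ 2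
        rw [wdiff]
        calc _ ≤ |h| ^ (k - p.1) * (A p.1 p.2 * |h| ^ p.1) := by
              gcongr
              exact hA p.1 p.2 j h hh
          _ = A p.1 p.2 * |h| ^ k := by
              rw [mul_left_comm, ← pow_add, Nat.sub_add_cancel hpk]
      have h2 := Finset.single_le_sum (f := fun p => wdiff k j h
        (α * h - (t - s) * (β * h) / N) (β * h) (U t s Ψ) p ^ 2) (fun p _ => sq_nonneg _)
        (Finset.mem_product.2 ⟨Finset.self_mem_range_succ k, Finset.mem_range.2 hn⟩ :
          (k, n) ∈ energyIdx k L)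
      have h3 := (h2.trans (hen Ψ j h)).trans (mul_le_mul_of_nonneg_left h1 hC)
      simp only [wdiff, Nat.sub_self, pow_zero, one_mul] at h3
      rw [← mul_assoc C B] at h3
      have h4 := Real.sqrt_le_sqrt h3
      rwa [Real.sqrt_sq (norm_nonneg _), Real.sqrt_mul (by positivity),
        Real.sqrt_sq (by positivity)] at h4
    · have hMn : M < n := by
        have : ⌊M⌋₊ < n := by omega
        exact (Nat.lt_of_floor_lt this)
      rw [norm_diff_eq hN hv hU k j (α * h) (β * h) s t hMn Ψ]
      exact hA k n j h hh

section Invariance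

variable {N M : ℝ} {v : R3 → ℝ} {w : 𝓢(R3, ℝ)} {X : ℝ → Tracers m} {φ : ℝ → L2R3}
  {U : ℝ → ℝ → Hilb m →L[ℂ] Hilb m}

theorem propagator_mem_domXPow (hN : 1 ≤ N) (hv : MemLp v ⊤ volume) (hv' : ∀ x, v (-x) = v x)
    (hφ : Continuous φ) (hU : IsTruncatedPropagator N M v w X φ U) {Ψ : Hilb m}
    (hΨ : Ψ ∈ DInfty m) (s t : ℝ) (k : ℕ) : U t s Ψ ∈ DomXPow m (k + 1) := by
  -- The shift `(t - s)/N` is chosen so that the drift cancels it at time `t`, leaving the pure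
  -- position direction.
  obtain ⟨A, hA0, hAs, hA⟩ := exists_final_bound hN hv hv' w hφ hU hΨ (k + 1) ((t - s) / N) 1 s t
  choose g hg hgn using fun n => exists_moment zero_le_one k (comp (U t s Ψ) n) (hA0 n)
    fun j h h0 h1 => by
      have := hA n j h (by rwa [abs_of_pos h0])
      have e : (t - s) / N * h - (t - s) * (1 * h) / N = 0 := by ring
      rwa [e, abs_of_pos h0] at this
  obtain ⟨Φ, hΦ⟩ := exists_hilb g (fun n σ => permuteL2_of_moment σ (hg n) (permuteL2_comp _ n σ))
    ((hAs.mul_left (((Fintype.card (Fin m × Fin 3) : ℝ) ^ (k + 1)) ^ 2)).of_nonneg_of_le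
      (fun n => sq_nonneg _) fun n => by rw [← mul_pow]; gcongr; exact hgn n)
  refine ⟨Φ, fun n => ?_⟩
  rw [hΦ]
  simpa only [one_mul] using hg n

theorem propagator_mem_domPPow (hN : 1 ≤ N) (hv : MemLp v ⊤ volume) (hv' : ∀ x, v (-x) = v x)
    (hφ : Continuous φ) (hU : IsTruncatedPropagator N M v w X φ U) {Ψ : Hilb m}
    (hΨ : Ψ ∈ DInfty m) (s t : ℝ) (k : ℕ) : U t s Ψ ∈ DomPPow m (k + 1) := by
  -- With `β = 0` there is no drift: the direction is pure momentum at both times.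
  obtain ⟨A, hA0, hAs, hA⟩ := exists_final_bound hN hv hv' w hφ hU hΨ (k + 1) 1 0 s t
  choose g hg hgn using fun n => exists_moment (by positivity : 0 ≤ 2 * Real.pi) k
    (𝓕 (comp (U t s Ψ) n) : Sector m n) (hA0 n) fun j h h0 h1 => by
      have := hA n j h (by rwa [abs_of_pos h0])
      rwa [one_mul, zero_mul, mul_zero, zero_div, sub_zero, norm_shift_diff, abs_of_pos h0] at this
  obtain ⟨Φ, hΦ⟩ := exists_hilb (fun n => (𝓕⁻ (g n) : Sector m n))
    (fun n σ => by
      rw [permuteL2_fourierInv, permuteL2_of_moment σ (hg n)]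
      rw [← fourier_permuteL2, permuteL2_comp])
    ((hAs.mul_left (((Fintype.card (Fin m × Fin 3) : ℝ) ^ (k + 1)) ^ 2)).of_nonneg_of_le
      (fun n => sq_nonneg _) fun n => by
        rw [← mul_pow, ← Lp.norm_fourier_eq, fourier_fourierInv_eq]
        gcongr
        exact hgn n)
  refine ⟨Φ, fun n => ?_⟩
  rw [FourierMul, hΦ, fourier_fourierInv_eq]
  exact hg n

/-- Sector norms above `M` are conserved, so the tail of `∑ n^(2k) ‖Ψ_n‖²` is that of the initial
vector and the remaining sectors are finite in number. The coordinate `j` only names a Weyl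
operator, which enters with exponent zero. -/
theorem propagator_mem_domNPow (j : Fin m × Fin 3) (hN : 1 ≤ N) (hv : MemLp v ⊤ volume)
    (hU : IsTruncatedPropagator N M v w X φ U) {Ψ : Hilb m} (s t : ℝ) {k : ℕ}
    (hΨ : Ψ ∈ DomNPow m k) : U t s Ψ ∈ DomNPow m k := by
  obtain ⟨Φ₀, hΦ₀⟩ := hΨ
  obtain ⟨Φ, hΦ⟩ := exists_hilb (fun n => ((n : ℂ) ^ k) • comp (U t s Ψ) n)
    (fun n σ => by rw [map_smul, permuteL2_comp]) (by
      refine (summable_nat_add_iff (⌊M⌋₊ + 1)).1 ?_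
      refine ((summable_nat_add_iff (⌊M⌋₊ + 1)).2 (summable_comp Φ₀)).congr fun n => ?_
      have hMn : M < (n + (⌊M⌋₊ + 1) : ℕ) := Nat.lt_of_floor_lt (by omega)
      have h1 := norm_diff_eq hN hv hU 0 j 0 0 s t hMn Ψ
      simp only [pow_zero, one_apply_eq_self] at h1
      rw [hΦ₀, norm_smul, norm_smul, h1])
  exact ⟨Φ, hΦ⟩

end Invariance

end TracerBoson

end

open TracerBoson MeasureTheory in
/-- The truncated dynamics preserves `𝒟_∞`. -/
theorem mainTheorem7 (m : ℕ) (hm : 1 ≤ m) (N M : ℝ) (hN : 1 ≤ N) (hM : 1 ≤ M)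
    (v : R3 → ℝ) (hv : MemLp v ⊤ volume) (hv_even : ∀ x, v (-x) = v x)
    (w : SchwartzMap R3 ℝ) (hw_even : ∀ x, w (-x) = w x)
    (X₀ V₀ : Tracers m) (φ₀ : L2R3)
    (X : ℝ → Tracers m) (φ : ℝ → L2R3)
    (hXφ : IsMeanFieldSolution v w X₀ V₀ φ₀ X φ)
    (U : ℝ → ℝ → Hilb m →L[ℂ] Hilb m)
    (hU : IsTruncatedPropagator N M v w X φ U)
    (Ψ₀ : Hilb m) (hΨ₀ : Ψ₀ ∈ DInfty m) (s t : ℝ) :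
    U t s Ψ₀ ∈ DInfty m := by
  obtain ⟨-, dφ, -, -, hdφ, -⟩ := hXφ
  have hφ : Continuous φ := continuous_iff_continuousAt.2 fun t => (hdφ t).continuousAt
  refine Set.mem_iInter₂.2 fun k hk => ?_
  obtain ⟨k, rfl⟩ : ∃ l, k = l + 1 := ⟨k - 1, by omega⟩
  exact ⟨⟨propagator_mem_domXPow hN hv hv_even hφ hU hΨ₀ s t k,
    propagator_mem_domPPow hN hv hv_even hφ hU hΨ₀ s t k⟩,
    propagator_mem_domNPow (⟨0, hm⟩, 0) hN hv hU s t (Set.mem_iInter₂.1 hΨ₀ (k + 1) hk).2⟩
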